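/- Let $G=(V,E)$ be a finite simple graph; $G$ is chordal if every cycle of length at least $4$ has a chord. Let $$Z_G(\mathbf x)=\sum_{I\subseteq V\ \text{independent}}(-1)^{|I|}\prod_{v\in I}x_v ,$$ and let $\mathcal R(G)$ be the set of all $\mathbf r\in[0,\infty)^V$ such that $Z_G(\mathbf w)>0$ for all real vectors $\mathbf w$ with $0\le\mathbf w\le\mathbf r$ (entrywise). For $\mathbf h,\mathbf g\in\mathbb N^V$ with all $h_v\ge 1$ (entries of $\mathbf g$ may be $0$), a strategy for the hat guessing game $(G,\mathbf h,\mathbf g)$ is a family $(\Gamma_v)_{v\in V}$, where $\Gamma_v$ maps each tuple of hat colors $(c_u)_{u\in N(v)}$, $c_u\in\{0,\dots,h_u-1\}$, to a set of exactly $g_v$ elements of $\{0,\dots,h_v-1\}$. It is winning if for every $\varphi$ with $\varphi(v)\in\{0,\dots,h_v-1\}$ for all $v\in V$ there is $v\in V$ with $\varphi(v)\in\Gamma_v\bigl((\varphi(u))_{u\in N(v)}\bigr)$. There is a polynomial-time algorithm that, given a chordal graph $G=(V,E)$ with $V=\{0,\dots,n-1\}$ (by its adjacency matrix) and a vector $\mathbf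 r=(r_v)_{v\in V}$ of nonnegative rational numbers (by numerators and denominators in binary), decides whether $\mathbf r\in\mathcal R(G)$. Moreover, if $\mathbf r\notin\mathcal R(G)$, it outputs vectors $\mathbf h,\mathbf g\in\mathbb N^V$ with $h_v\ge1$ and $g_v/h_v\le r_v$ for every $v\in V$, together with a representation $\sigma$ of a winning strategy $(\Gamma_v)_{v\in V}$ for $(G,\mathbf h,\mathbf g)$, and the bit length of this output is polynomial in that of the input. Here "representation" means that there is one fixed polynomial-time algorithm, independent of $G$ and $\mathbf r$, which, given $\sigma$, a vertex $v$, the hat colors $(c_u)_{u\in N(v)}$ and a color $a\in\{0,\dots,h_v-1\}$, decides whether $a\in\Gamma_v\bigl((c_u)_{u\in N(v)}\bigr)$. (Running times are measured on a random access machine with bit-length cost.) -/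

import Mathlib

namespace HatGame

/-! ### Graphs and the region `𝓡(G)` -/

/-- Every cycle of length at least `4` has a chord: an edge of the graph that joins two vertices
of the cycle and is not an edge of the cycle. -/
def IsChordal {V : Type*} (G : SimpleGraph V) : Prop :=
  ∀ (u : V) (c : G.Walk u u), c.IsCycle → 4 ≤ c.length →
    ∃ x ∈ c.support, ∃ y ∈ c.support, G.Adj x y ∧ s(x, y) ∉ c.edges

open Classical in
/-- The signed independence polynomial `Z_G`, evaluated at a real vector `x`. -/
noncomputable def signedIndepPoly {V : Type*} [Fintype V] (G : SimpleGraph V) (x : V → ℝ) : ℝ :=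
  ∑ I ∈ (Finset.univ : Finset (Finset V)).filter (fun I : Finset V => G.IsIndepSet (I : Set V)),
    (-1) ^ I.card * ∏ v ∈ I, x v

/-- The set `𝓡(G)` of the nonnegative vectors `r` such that `Z_G(w) > 0` whenever `0 ≤ w ≤ r`. -/
def region {V : Type*} [Fintype V] (G : SimpleGraph V) : Set (V → ℝ) :=
  {r | 0 ≤ r ∧ ∀ w : V → ℝ, 0 ≤ w → w ≤ r → 0 < signedIndepPoly G w}

/-! ### The hat guessing game `(G, h, g)` -/

/-- What the bear on `v` sees: the hat colors of his neighbors. -/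
abbrev View {V : Type*} (G : SimpleGraph V) (h : V → ℕ) (v : V) : Type _ :=
  (u : G.neighborSet v) → Fin (h u)

/-- A strategy: each bear `v` guesses a set of exactly `g v` of his `h v` colors, depending only
on the hat colors of his neighbors. -/
abbrev Strategy {V : Type*} (G : SimpleGraph V) (h g : V → ℕ) : Type _ :=
  (v : V) → View G h v → {A : Finset (Fin (h v)) // A.card = g v}

/-- In every hats arrangement at least one bear guesses correctly. -/
def Strategy.IsWinning {V : Type*} {G : SimpleGraph V} {h g : V → ℕ}
    (Γ : Strategy G h g) : Prop :=
  ∀ φ : (v : V) → Fin (h v), ∃ v, φ v ∈ (Γ v (fun u => φ u)).1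

/-! ### Random access machines

A program uses finitely many arrays of natural numbers (a scalar variable is a cell of an array),
with indirect addressing. Time is charged by bit length: reading or writing a cell costs the length
of its index and of its contents, and an arithmetic operation costs the product of the lengths of
its operands. -/

/-- The memory: `s A i` is the content of cell `i` of array `A`. -/
abbrev Mem : Type := ℕ → ℕ → ℕ

inductive Op : Type
  | add | sub | mul | div | mod

def Op.eval : Op → ℕ → ℕ → ℕ
  | .add, a, b => a + b
  | .sub, a, b => a - b
  | .mul, a, b => a * b
  | .div, a, b => a / b
  | .mod, a, b => a % b

inductive Expr : Type
  | const (k : ℕ)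
  | read (A : ℕ) (i : Expr)
  | bin (o : Op) (a b : Expr)

def Expr.eval (s : Mem) : Expr → ℕ
  | .const k => k
  | .read A i => s A (i.eval s)
  | .bin o a b => o.eval (a.eval s) (b.eval s)

def Expr.cost (s : Mem) : Expr → ℕ
  | .const k => k.size + 1
  | .read A i => i.cost s + (i.eval s).size + (s A (i.eval s)).size + 1
  | .bin _ a b => a.cost s + b.cost s + ((a.eval s).size + 1) * ((b.eval s).size + 1)

inductive Prog : Type
  | skip
  | write (A : ℕ) (i e : Expr)
  | seq (p q : Prog)
  | branch (e : Expr) (p q : Prog)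
  | loop (e : Expr) (p : Prog)

/-- `Runs p s t s'`: started on memory `s`, the program `p` halts after time `t` with memory `s'`.
A test is passed if its value is nonzero; `loop e p` repeats `p` as long as the test `e` is
passed. -/
inductive Runs : Prog → Mem → ℕ → Mem → Prop
  | skip (s : Mem) : Runs .skip s 1 s
  | write (A : ℕ) (i e : Expr) (s : Mem) :
      Runs (.write A i e) s
        (i.cost s + e.cost s + (i.eval s).size + (e.eval s).size + 1)
        (Function.update s A (Function.update (s A) (i.eval s) (e.eval s)))
  | seq {p q : Prog} {s s' s'' : Mem} {t t' : ℕ} :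
      Runs p s t s' → Runs q s' t' s'' → Runs (.seq p q) s (t + t' + 1) s''
  | branch_pass {e : Expr} {p q : Prog} {s s' : Mem} {t : ℕ} :
      e.eval s ≠ 0 → Runs p s t s' → Runs (.branch e p q) s (e.cost s + t + 1) s'
  | branch_fail {e : Expr} {p q : Prog} {s s' : Mem} {t : ℕ} :
      e.eval s = 0 → Runs q s t s' → Runs (.branch e p q) s (e.cost s + t + 1) s'
  | loop_pass {e : Expr} {p : Prog} {s s' s'' : Mem} {t t' : ℕ} :
      e.eval s ≠ 0 → Runs p s t s' → Runs (.loop e p) s' t' s'' →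
        Runs (.loop e p) s (e.cost s + t + t' + 1) s''
  | loop_fail {e : Expr} {p : Prog} {s : Mem} :
      e.eval s = 0 → Runs (.loop e p) s (e.cost s + 1) s

/-- The initial memory on input `x`: array `0` holds the length of `x` and then its entries;
all other cells are `0`. -/
def initMem (x : List ℕ) : Mem :=
  fun A i => if A = 0 then (x.length :: x).getD i 0 else 0

/-- The output is read from array `1`: its length and then its entries. -/
def output (s : Mem) : List ℕ :=
  (List.range (s 1 0)).map fun i => s 1 (i + 1)

/-- On input `x`, the program `p` halts within time `T` with output `y`. -/
def OutputsWithin (p : Prog) (x : List ℕ) (T : ℕ) (y : List ℕ) : Prop :=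
  ∃ t s, Runs p (initMem x) t s ∧ t ≤ T ∧ output s = y

/-- The number of bits of a list of natural numbers written in binary, with one separator bit per
entry. -/
def bitSize (x : List ℕ) : ℕ :=
  (x.map fun k => k.size + 1).sum

/-! ### Encodings -/

open Classical in
/-- The input `(G, r)`: the number `n` of vertices, the adjacency matrix row by row, the
numerators and the denominators of `r` in lowest terms. -/
noncomputable def encodeInput {n : ℕ} (G : SimpleGraph (Fin n)) (r : Fin n → ℚ≥0) : List ℕ :=
  n :: ((List.finRange n).flatMap fun u => List.ofFn fun v => if G.Adj u v then 1 else 0)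
    ++ List.ofFn (fun v => (r v).num) ++ List.ofFn (fun v => (r v).den)

open Classical in
/-- The question, put to the strategy with description `σ`, whether the bear on `v` who sees the
hat colors `c` includes the color `a` in his guesses. Entry `u` of the list of seen colors is `0`
for every `u` that is not a neighbor of `v`. -/
noncomputable def encodeQuery {n : ℕ} {G : SimpleGraph (Fin n)} {h : Fin n → ℕ} (σ : List ℕ)
    (v : Fin n) (c : View G h v) (a : Fin (h v)) : List ℕ :=
  n :: (v : ℕ) :: (a : ℕ) ::
    List.ofFn (fun u => if hu : G.Adj v u then (c ⟨u, hu⟩ : ℕ) else 0) ++ σ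

open Classical in
/-- The list `σ` represents the strategy `Γ` with respect to the evaluation program `ev`: given
`σ`, a vertex `v`, the hat colors seen by the bear on `v` and a color `a`, the program `ev` decides,
in time `q` of the length of these data, whether the bear guesses `a`. -/
def Represents (ev : Prog) (q : Polynomial ℕ) {n : ℕ} {G : SimpleGraph (Fin n)}
    {h g : Fin n → ℕ} (σ : List ℕ) (Γ : Strategy G h g) : Prop :=
  ∀ (v : Fin n) (c : View G h v) (a : Fin (h v)),
    OutputsWithin ev (encodeQuery σ v c a) (q.eval (bitSize (encodeQuery σ v c a)))
      [if a ∈ (Γ v c).1 then 1 else 0]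

end HatGame

/-! The neighbors of a simplicial vertex `v` form a clique, so an independent set contains at most
one of them. This gives $Z_G(x) = (1-x_v)\,Z_{G-v}(x')$, where $x'_u = x_u/(1-x_v)$ for neighbors
$u$ of $v$ and $x'_u = x_u$ otherwise. Since $x \mapsto x'$ is monotone and can be inverted for
fixed $x_v<1$, the vector $r$ lies in the region of $G$ iff $r_v<1$ and $r'$ lies in the region of
$G-v$ (`positiveBelow_insert_iff`). Chordal graphs always offer a simplicial vertex
(`IsChordal.exists_simplicial`), so membership means that $n$ successive eliminations never meet a
pivot of weight at least $1$, which would be a failure (`Data.fl_eq_zero_iff`).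

The numbers stay short. Let $D$ be the product of the denominators and $E$ the set of eliminated
vertices. Until a failure, the current weights have the common denominator $M = D\,Z_E(r)$, and the
numerator of $u$ is $D\,(Z_E(r)-Z_{E\cup\{u\}}(r))$; both are integers (`Data.exists_int_eq`,
`Data.exact_next`). Thus $M\le D$, numerators never grow, and no fraction has to be reduced.

The eliminations also give the strategy. A color is a mixed-radix number with one digit per
elimination $t$; this digit has $M_t$ values on the clique formed by the pivot and its later
neighbors, and one value elsewhere. Members of the clique see each other, so each candidate for the
own color determines the sum of the digits modulo $M_t$. With $a_t = \min(N_t, M_t)$, where $N_t$ is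
the numerator of the pivot, the pivot bets that the sum is below $a_t$ and its later neighbors bet
that it is at least $a_t$. A bear guesses the colors for which all his bets hold. A failure has
$a_t=M_t$, so some sum is below its threshold; the pivot of the first such elimination wins all its
bets (`Data.strategy_isWinning`). Counting digit by digit gives the number of guesses
(`Data.card_digits`), and each elimination changes the ratio of guesses to colors in a way that
keeps it at most $r_v$ (`Data.ratio_state`).

The machine programs are compiled from commands with counted loops. A calculus of weakest
preconditions proves them correct and bounds the word length $B$ and the rounds $N$ per loop; the
time is then at most a polynomial in $N$ times $(B+1)^2$ (`Cmd.runs_compile`). -/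

namespace HatGame

/-! ### Structured commands with counted loops -/

namespace Expr

instance (k : ℕ) : OfNat Expr k := ⟨.const k⟩
instance : Add Expr := ⟨.bin .add⟩
instance : Sub Expr := ⟨.bin .sub⟩
instance : Mul Expr := ⟨.bin .mul⟩
instance : Div Expr := ⟨.bin .div⟩
instance : Mod Expr := ⟨.bin .mod⟩

@[simp] theorem eval_const (s : Mem) (k : ℕ) : (const k).eval s = k := rfl
@[simp] theorem eval_ofNat (s : Mem) (k : ℕ) :
    (no_index (OfNat.ofNat k) : Expr).eval s = OfNat.ofNat k := rfl
@[simp] theorem eval_read (s : Mem) (A : ℕ) (i : Expr) : (read A i).eval s = s A (i.eval s) := rfl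
@[simp] theorem eval_add (s : Mem) (a b : Expr) : (a + b).eval s = a.eval s + b.eval s := rfl
@[simp] theorem eval_sub (s : Mem) (a b : Expr) : (a - b).eval s = a.eval s - b.eval s := rfl
@[simp] theorem eval_mul (s : Mem) (a b : Expr) : (a * b).eval s = a.eval s * b.eval s := rfl
@[simp] theorem eval_div (s : Mem) (a b : Expr) : (a / b).eval s = a.eval s / b.eval s := rfl
@[simp] theorem eval_mod (s : Mem) (a b : Expr) : (a % b).eval s = a.eval s % b.eval s := rfl

/-- A factor that bounds the length of the value of an expression in terms of the word length. -/
def width : Expr → ℕ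
  | .const k => k.size
  | .read _ _ => 1
  | .bin _ a b => a.width + b.width + 1

/-- A factor that bounds the cost of an expression in terms of the square of the word length. -/
def weight : Expr → ℕ
  | .const k => k.size + 1
  | .read _ i => i.weight + i.width + 2
  | .bin _ a b => a.weight + b.weight + (a.width + 1) * (b.width + 1)

end Expr

theorem Op.size_eval_le (o : Op) (a b : ℕ) : (o.eval a b).size ≤ a.size + b.size + 1 := by
  have ha := Nat.lt_size_self a
  have hb := Nat.lt_size_self b
  cases o with
  | add =>
    rw [Nat.size_le, Op.eval]
    have h1 : 2 ^ a.size ≤ 2 ^ (a.size + b.size) := Nat.pow_le_pow_right (by norm_num) (by omega)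
    have h2 : 2 ^ b.size ≤ 2 ^ (a.size + b.size) := Nat.pow_le_pow_right (by norm_num) (by omega)
    rw [pow_succ]
    omega
  | sub => exact (Nat.size_le_size (Nat.sub_le a b)).trans (by omega)
  | mul =>
    rw [Nat.size_le, Op.eval]
    calc a * b < 2 ^ a.size * 2 ^ b.size := Nat.mul_lt_mul'' ha hb
      _ ≤ 2 ^ (a.size + b.size + 1) := by
        rw [← pow_add]
        exact Nat.pow_le_pow_right (by norm_num) (by omega)
  | div => exact (Nat.size_le_size (Nat.div_le_self a b)).trans (by omega)
  | mod => exact (Nat.size_le_size (Nat.mod_le a b)).trans (by omega)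

/-- All cells hold numbers of at most `B` bits. -/
def Mem.Bounded (B : ℕ) (s : Mem) : Prop := ∀ A i, s A i < 2 ^ B

/-- The memory after the value `v` has been written to cell `i` of array `A`. -/
def Mem.set (s : Mem) (A i v : ℕ) : Mem := Function.update s A (Function.update (s A) i v)

theorem Mem.set_apply (s : Mem) (A i v A' : ℕ) :
    s.set A i v A' = if A' = A then Function.update (s A) i v else s A' := by
  unfold Mem.set
  by_cases h : A' = A
  · subst h; simp
  · simp [h]

@[simp] theorem Mem.set_same (s : Mem) (A i v : ℕ) : s.set A i v A = Function.update (s A) i v := by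
  simp [Mem.set]

theorem Mem.set_of_ne (s : Mem) {A A' : ℕ} (i v : ℕ) (h : A' ≠ A) : s.set A i v A' = s A' := by
  simp [Mem.set, h]

theorem Mem.Bounded.set {B : ℕ} {s : Mem} (hs : s.Bounded B) (A i : ℕ) {v : ℕ} (hv : v < 2 ^ B) :
    (s.set A i v).Bounded B := by
  intro A' i'
  rw [Mem.set_apply]
  split_ifs with h
  · by_cases h' : i' = i
    · subst h'; simpa using hv
    · simpa [h'] using hs A i'
  · exact hs A' i'

namespace Expr

theorem size_eval_le {B : ℕ} {s : Mem} (hs : s.Bounded B) (e : Expr) :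
    (e.eval s).size ≤ e.width * (B + 1) := by
  induction e with
  | const k => simp only [eval, width]; nlinarith
  | read A i _ =>
    simp only [eval, width]
    have := Nat.size_le.2 (hs A (i.eval s))
    omega
  | bin o a b iha ihb =>
    simp only [eval, width]
    have := o.size_eval_le (a.eval s) (b.eval s)
    nlinarith

/-- Operand lengths are linear in the word length and a binary operation costs their product, hence
the square. -/
theorem cost_le {B : ℕ} {s : Mem} (hs : s.Bounded B) (e : Expr) :
    e.cost s ≤ e.weight * (B + 1) ^ 2 := by
  have hB : B + 1 ≤ (B + 1) ^ 2 := Nat.le_self_pow (by norm_num) _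
  induction e with
  | const k => simp only [cost, weight]; nlinarith
  | read A i ih =>
    simp only [cost, weight]
    have h1 := Nat.size_le.2 (hs A (i.eval s))
    have h2 : (i.eval s).size ≤ i.width * (B + 1) ^ 2 :=
      (size_eval_le hs i).trans (Nat.mul_le_mul_left _ hB)
    nlinarith
  | bin o a b iha ihb =>
    simp only [cost, weight]
    have h1 : (a.eval s).size + 1 ≤ (a.width + 1) * (B + 1) := by
      have := size_eval_le hs a; nlinarith
    have h2 : (b.eval s).size + 1 ≤ (b.width + 1) * (B + 1) := by
      have := size_eval_le hs b; nlinarith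
    have h3 := Nat.mul_le_mul h1 h2
    nlinarith

end Expr

/-- Programs whose only loops are counted: `times c e p` runs `p` once for each value `k` below the
value of `e`; during these runs cell `0` of array `c` holds `k`. -/
inductive Cmd : Type
  | skip
  | write (A : ℕ) (i e : Expr)
  | seq (p q : Cmd)
  | cond (e : Expr) (p q : Cmd)
  | times (c : ℕ) (e : Expr) (p : Cmd)

namespace Cmd

instance : AndThen Cmd := ⟨fun p q => .seq p (q ())⟩

/-- The arrays that a command may change. -/
def writes : Cmd → List ℕ
  | skip => []
  | write A _ _ => [A]
  | seq p q => p.writes ++ q.writes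
  | cond _ p q => p.writes ++ q.writes
  | times c _ p => c :: p.writes

/-- No loop body changes the counter of its loop. -/
def WellFormed : Cmd → Prop
  | skip => True
  | write _ _ _ => True
  | seq p q => p.WellFormed ∧ q.WellFormed
  | cond _ p q => p.WellFormed ∧ q.WellFormed
  | times c _ p => c ∉ p.writes ∧ p.WellFormed

/-- The effect of a command on the memory. -/
def exec : Cmd → Mem → Mem
  | skip, s => s
  | write A i e, s => s.set A (i.eval s) (e.eval s)
  | seq p q, s => q.exec (p.exec s)
  | cond e p q, s => if e.eval s ≠ 0 then p.exec s else q.exec s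
  -- Cell `1` of array `c` keeps the number of rounds, evaluated once at entry, so the body may
  -- change what `e` reads.
  | times c e p, s =>
    Nat.rec ((s.set c 1 (e.eval s)).set c 0 0) (fun k s' => (p.exec s').set c 0 (k + 1)) (e.eval s)

/-- The memory before run `k` of the body of `times c e p`. -/
def iter (c : ℕ) (e : Expr) (p : Cmd) (s : Mem) (k : ℕ) : Mem :=
  Nat.rec ((s.set c 1 (e.eval s)).set c 0 0) (fun k s' => (p.exec s').set c 0 (k + 1)) k

/-- All values written have at most `B` bits and each loop makes at most `N` rounds. -/
def Safe (B N : ℕ) : Cmd → Mem → Prop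
  | skip, _ => True
  | write _ _ e, s => e.eval s < 2 ^ B
  | seq p q, s => p.Safe B N s ∧ q.Safe B N (p.exec s)
  | cond e p q, s => if e.eval s ≠ 0 then p.Safe B N s else q.Safe B N s
  | times c e p, s => e.eval s ≤ N ∧ ∀ k < e.eval s, p.Safe B N (iter c e p s k)

/-- The translation into programs of the random access machine. -/
def compile : Cmd → Prog
  | skip => .skip
  | write A i e => .write A i e
  | seq p q => .seq p.compile q.compile
  | cond e p q => .branch e p.compile q.compile
  | times c e p =>
    .seq (.write c 1 e) (.seq (.write c 0 0)
      -- By truncation the test is nonzero exactly while the counter is below the limit.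
      (.loop (.read c 1 - .read c 0) (.seq p.compile (.write c 0 (.read c 0 + 1)))))

theorem exec_frame {p : Cmd} {A : ℕ} (hA : A ∉ p.writes) (s : Mem) : p.exec s A = s A := by
  induction p generalizing s with
  | skip => rfl
  | write A' i e =>
    simp only [writes, List.mem_singleton] at hA
    exact Mem.set_of_ne _ _ _ hA
  | seq p q ihp ihq =>
    simp only [writes, List.mem_append, not_or] at hA
    simp only [exec]
    rw [ihq hA.2, ihp hA.1]
  | cond e p q ihp ihq =>
    simp only [writes, List.mem_append, not_or] at hA
    simp only [exec]
    split_ifs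
    · exact ihp hA.1 s
    · exact ihq hA.2 s
  | times c e p ih =>
    simp only [writes, List.mem_cons, not_or] at hA
    simp only [exec]
    generalize hn : e.eval s = n
    have : ∀ m, (Nat.rec ((s.set c 1 n).set c 0 0) (fun k s' => (p.exec s').set c 0 (k + 1)) m : Mem)
        A = s A := by
      intro m
      induction m with
      | zero => simp [Mem.set_of_ne _ _ _ hA.1]
      | succ k ihk => simp only [Mem.set_of_ne _ _ _ hA.1]; rw [ih hA.2, ihk]
    exact this n

theorem iter_frame {c : ℕ} {p : Cmd} {A : ℕ} (hc : A ≠ c) (hA : A ∉ p.writes) (e : Expr) (s : Mem)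
    (k : ℕ) : iter c e p s k A = s A := by
  induction k with
  | zero => simp [iter, Mem.set_of_ne _ _ _ hc]
  | succ k ih =>
    simp only [iter, Mem.set_of_ne _ _ _ hc] at ih ⊢
    rw [exec_frame hA, ih]

theorem iter_counter {c : ℕ} {p : Cmd} (hc : c ∉ p.writes) (e : Expr) (s : Mem) (k : ℕ) :
    iter c e p s k c 0 = k ∧ iter c e p s k c 1 = e.eval s := by
  induction k with
  | zero => simp [iter]
  | succ k ih =>
    have h : iter c e p s (k + 1) = (p.exec (iter c e p s k)).set c 0 (k + 1) := rfl
    rw [h, Mem.set_same, exec_frame hc]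
    simpa using ih.2

open Polynomial in
/-- A bound, as a polynomial in the number of rounds of each loop, for the running time divided by
the square of the word length. -/
noncomputable def timeBound : Cmd → Polynomial ℕ
  | skip => 1
  | write _ i e => C (i.weight + e.weight + i.width + e.width + 1)
  | seq p q => p.timeBound + q.timeBound + 1
  | cond e p q => C e.weight + p.timeBound + q.timeBound + 1
  -- The constants 60 are generous: in units of the squared word length, the overhead is at most 28
  -- per round, and at most 24 at entry and exit.
  | times _ e p => C (e.weight + e.width + 60) + X * (p.timeBound + 60)

theorem runs_write {B : ℕ} {s : Mem} (hs : s.Bounded B) (A : ℕ) (i e : Expr) :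
    ∃ t, Runs (.write A i e) s t (s.set A (i.eval s) (e.eval s)) ∧
      t ≤ (i.weight + e.weight + i.width + e.width + 1) * (B + 1) ^ 2 := by
  refine ⟨_, Runs.write A i e s, ?_⟩
  have hB : B + 1 ≤ (B + 1) ^ 2 := Nat.le_self_pow (by norm_num) _
  have h1 := Expr.cost_le hs i
  have h2 := Expr.cost_le hs e
  have h3 := (Expr.size_eval_le hs i).trans (Nat.mul_le_mul_left _ hB)
  have h4 := (Expr.size_eval_le hs e).trans (Nat.mul_le_mul_left _ hB)
  nlinarith

theorem runs_compile {B N : ℕ} (hN : N < 2 ^ B) {p : Cmd} (hp : p.WellFormed) {s : Mem}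
    (hs : s.Bounded B) (h : p.Safe B N s) :
    (p.exec s).Bounded B ∧
      ∃ t, Runs p.compile s t (p.exec s) ∧ t ≤ p.timeBound.eval N * (B + 1) ^ 2 := by
  have hB : 1 ≤ (B + 1) ^ 2 := Nat.one_le_pow _ _ (by omega)
  induction p generalizing s with
  | skip => exact ⟨hs, 1, Runs.skip s, by simpa [timeBound] using hB⟩
  | write A i e =>
    refine ⟨hs.set _ _ h, ?_⟩
    obtain ⟨t, ht, ht'⟩ := runs_write hs A i e
    exact ⟨t, ht, by simpa [timeBound] using ht'⟩
  | seq p q ihp ihq =>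
    obtain ⟨b1, t1, r1, c1⟩ := ihp hp.1 hs h.1
    obtain ⟨b2, t2, r2, c2⟩ := ihq hp.2 b1 h.2
    refine ⟨b2, _, Runs.seq r1 r2, ?_⟩
    simp only [timeBound, Polynomial.eval_add, Polynomial.eval_one]
    nlinarith
  | cond e p q ihp ihq =>
    have he := Expr.cost_le hs e
    by_cases h0 : e.eval s = 0
    · simp only [Safe, h0, ne_eq, not_true_eq_false, if_false] at h
      obtain ⟨b1, t1, r1, c1⟩ := ihq hp.2 hs h
      simp only [exec, h0, ne_eq, not_true_eq_false, if_false]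
      refine ⟨b1, _, Runs.branch_fail h0 r1, ?_⟩
      simp only [timeBound, Polynomial.eval_add, Polynomial.eval_one, Polynomial.eval_C]
      nlinarith
    · simp only [Safe, h0, ne_eq, not_false_eq_true, if_true] at h
      obtain ⟨b1, t1, r1, c1⟩ := ihp hp.1 hs h
      simp only [exec, h0, ne_eq, not_false_eq_true, if_true]
      refine ⟨b1, _, Runs.branch_pass h0 r1, ?_⟩
      simp only [timeBound, Polynomial.eval_add, Polynomial.eval_one, Polynomial.eval_C]
      nlinarith
  | times c e p ih =>
    obtain ⟨hn, hsafe⟩ := h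
    set n := e.eval s with hn_def
    have hb : ∀ k ≤ n, (iter c e p s k).Bounded B := by
      intro k hk
      induction k with
      | zero => exact (hs.set _ _ (by omega)).set _ _ (by positivity)
      | succ k ihk =>
        exact ((ih hp.2 (ihk (by omega)) (hsafe k (by omega))).1).set _ _ (by omega)
    refine ⟨hb n le_rfl, ?_⟩
    set L : Prog := .loop (.read c 1 - .read c 0) (.seq p.compile (.write c 0 (.read c 0 + 1)))
      with hL
    have htest : ∀ k, (Expr.read c 1 - Expr.read c 0).eval (iter c e p s k) = n - k := by
      intro k
      obtain ⟨h0, h1⟩ := iter_counter hp.1 e s k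
      simp [h0, h1, hn_def]
    have hw : (Expr.read c 1 - Expr.read c 0).weight = 12 := rfl
    -- Induction on the number `j` of rounds that are left, because `Runs` unfolds a loop from its
    -- front.
    have hloop : ∀ j ≤ n, ∃ t, Runs L (iter c e p s (n - j)) t (iter c e p s n) ∧
        t ≤ (15 + j * (p.timeBound.eval N + 60)) * (B + 1) ^ 2 := by
      intro j
      induction j with
      | zero =>
        intro _
        refine ⟨_, Runs.loop_fail (by rw [htest]; omega), ?_⟩
        have := Expr.cost_le (hb n le_rfl) (Expr.read c 1 - Expr.read c 0)
        rw [hw] at this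
        simp only [Nat.sub_zero]
        nlinarith
      | succ j ihj =>
        intro hj
        obtain ⟨t, rt, ct⟩ := ihj (by omega)
        have hk : n - (j + 1) < n := by omega
        set k := n - (j + 1)
        have hk1 : n - j = k + 1 := by omega
        obtain ⟨b1, t1, r1, c1⟩ := ih hp.2 (hb k hk.le) (hsafe k hk)
        obtain ⟨t2, r2, c2⟩ := runs_write b1 c 0 (.read c 0 + 1)
        have hcnt : (Expr.read c 0 + 1).eval (p.exec (iter c e p s k)) = k + 1 := by
          have := (iter_counter hp.1 e s k).1
          simp [exec_frame hp.1, this]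
        rw [hcnt] at r2
        have h3 : (p.exec (iter c e p s k)).set c ((0 : Expr).eval (p.exec (iter c e p s k)))
            (k + 1) = iter c e p s (n - j) := by rw [hk1]; rfl
        rw [h3] at r2
        refine ⟨_, Runs.loop_pass (by rw [htest]; omega) (Runs.seq r1 r2) rt, ?_⟩
        have h4 := Expr.cost_le (hb k hk.le) (Expr.read c 1 - Expr.read c 0)
        rw [hw] at h4
        have h5 : ((0 : Expr).weight + (Expr.read c 0 + 1).weight + (0 : Expr).width +
          (Expr.read c 0 + 1).width + 1) = 14 := rfl
        rw [h5] at c2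
        nlinarith
    obtain ⟨t, rt, ct⟩ := hloop n le_rfl
    obtain ⟨t1, r1, c1⟩ := runs_write hs c 1 e
    have b1 : (s.set c 1 n).Bounded B := hs.set _ _ (by omega)
    obtain ⟨t2, r2, c2⟩ := runs_write b1 c 0 0
    rw [Nat.sub_self] at rt
    refine ⟨_, Runs.seq r1 (Runs.seq r2 rt), ?_⟩
    have h5 : (1 : Expr).weight + e.weight + (1 : Expr).width + e.width + 1
      = e.weight + e.width + 4 := by
        have h1 : (1 : Expr).weight = 2 := rfl
        have h2 : (1 : Expr).width = 1 := rfl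
        omega
    have h6 : (0 : Expr).weight + (0 : Expr).weight + (0 : Expr).width + (0 : Expr).width + 1 = 3 :=
      rfl
    rw [h5] at c1
    rw [h6] at c2
    simp only [timeBound, Polynomial.eval_add, Polynomial.eval_mul, Polynomial.eval_C,
      Polynomial.eval_X, Polynomial.eval_ofNat]
    have h7 : n * (p.timeBound.eval N + 60) ≤ N * (p.timeBound.eval N + 60) :=
      Nat.mul_le_mul_right _ hn
    nlinarith

/-! ### Weakest preconditions -/

/-- The command is safe when started on `s` and leads to a memory with property `Q`. -/
def Wp (B N : ℕ) (p : Cmd) (Q : Mem → Prop) (s : Mem) : Prop := p.Safe B N s ∧ Q (p.exec s)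

variable {B N : ℕ} {Q : Mem → Prop} {s : Mem}

theorem wp_skip : Wp B N skip Q s ↔ Q s := by simp [Wp, Safe, exec]

theorem wp_write {A : ℕ} {i e : Expr} :
    Wp B N (write A i e) Q s ↔ e.eval s < 2 ^ B ∧ Q (s.set A (i.eval s) (e.eval s)) := Iff.rfl

theorem wp_seq {p q : Cmd} : Wp B N (p >> q) Q s ↔ Wp B N p (Wp B N q Q) s := and_assoc

theorem wp_cond {e : Expr} {p q : Cmd} :
    Wp B N (cond e p q) Q s ↔ if e.eval s = 0 then Wp B N q Q s else Wp B N p Q s := by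
  by_cases h : e.eval s = 0 <;> simp [Wp, Safe, exec, h]

/-- The rule of consequence merged with the frame rule: the arrays that are not written remain known
afterwards. -/
theorem Wp.mono {p : Cmd} {Q' : Mem → Prop} (h : Wp B N p Q' s)
    (hQ : ∀ s', (∀ A, A ∉ p.writes → s' A = s A) → Q' s' → Q s') : Wp B N p Q s :=
  ⟨h.1, hQ _ (fun _ hA => exec_frame hA s) h.2⟩

/-- By `hI` the invariant must not depend on array `c`, which the loop itself changes between
rounds. Arrays outside `writes` are supplied unchanged in each round, so the invariant need not
mention them. -/
theorem wp_times {c : ℕ} {e : Expr} {p : Cmd} (hc : c ∉ p.writes) (I : ℕ → Mem → Prop) {n : ℕ}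
    (hn : e.eval s = n) (hN : n ≤ N)
    (hI : ∀ k s s', (∀ A, A ≠ c → s' A = s A) → I k s → I k s')
    (h0 : I 0 s)
    (hstep : ∀ k < n, ∀ s', (∀ A, A ∉ (times c e p).writes → s' A = s A) → s' c 0 = k → I k s' →
      Wp B N p (I (k + 1)) s') :
    Wp B N (times c e p) (I n) s := by
  subst hn
  have hset : ∀ (s' : Mem) (i v A : ℕ), A ≠ c → s'.set c i v A = s' A :=
    fun s' i v A hA => Mem.set_of_ne s' i v hA
  have key : ∀ k ≤ e.eval s, I k (iter c e p s k) ∧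
      ∀ j < k, p.Safe B N (iter c e p s j) := by
    intro k hk
    induction k with
    | zero =>
      refine ⟨hI 0 s _ (fun A hA => ?_) h0, by simp⟩
      simp [iter, hset _ _ _ _ hA]
    | succ k ih =>
      obtain ⟨h1, h2⟩ := ih (by omega)
      have h3 := hstep k (by omega) (iter c e p s k) (fun A hA => by
        simp only [writes, List.mem_cons, not_or] at hA
        exact iter_frame hA.1 hA.2 e s k) (iter_counter hc e s k).1 h1
      refine ⟨hI _ _ _ (fun A hA => hset _ _ _ _ hA) h3.2, fun j hj => ?_⟩
      rcases Nat.lt_succ_iff_lt_or_eq.1 hj with hj | rfl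
      · exact h2 j hj
      · exact h3.1
  obtain ⟨h1, h2⟩ := key _ le_rfl
  exact ⟨⟨hN, h2⟩, h1⟩

end Cmd

end HatGame

namespace HatGame

/-! ### Simplicial vertices of chordal graphs -/

section Chordal

variable {V : Type*} {G : SimpleGraph V}

/-- The neighbors of `s` in `W` are pairwise adjacent. -/
def IsSimplicialIn (G : SimpleGraph V) (W : Finset V) (s : V) : Prop :=
  ∀ x ∈ W, ∀ y ∈ W, G.Adj s x → G.Adj s y → x ≠ y → G.Adj x y

/-- The edges of `G` with both ends in `U`. -/
def within (G : SimpleGraph V) (U : Set V) : SimpleGraph V where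
  Adj a b := G.Adj a b ∧ a ∈ U ∧ b ∈ U
  symm := ⟨fun _ _ h => ⟨h.1.symm, h.2.2, h.2.1⟩⟩
  loopless := ⟨fun _ h => G.loopless.irrefl _ h.1⟩

theorem within_le (U : Set V) : within G U ≤ G := fun _ _ h => h.1

theorem within_mono {U U' : Set V} (h : U ⊆ U') : within G U ≤ within G U' :=
  fun _ _ hab => ⟨hab.1, h hab.2.1, h hab.2.2⟩

theorem mem_of_mem_support_within {U : Set V} {x y : V} (p : (within G U).Walk x y) (hx : x ∈ U)
    {a : V} (ha : a ∈ p.support) : a ∈ U := by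
  induction p with
  | nil => simp_all
  | cons h p ih =>
    rw [SimpleGraph.Walk.support_cons, List.mem_cons] at ha
    rcases ha with rfl | ha
    · exact hx
    · exact ih h.2.2 ha

theorem getVert_mem_edges {x y : V} (p : G.Walk x y) {i : ℕ} (hi : i < p.length) :
    s(p.getVert i, p.getVert (i + 1)) ∈ p.edges := by
  induction p generalizing i with
  | nil => simp at hi
  | cons h p ih =>
    cases i with
    | zero => simp
    | succ i =>
      simp only [SimpleGraph.Walk.length_cons, Nat.add_lt_add_iff_right] at hi
      simpa using Or.inr (ih hi)

/-- A shortest path has no chords. -/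
theorem mem_edges_of_length_eq_dist {x y : V} (p : G.Walk x y) (hp : p.length = G.dist x y)
    {a b : V} (ha : a ∈ p.support) (hb : b ∈ p.support) (hab : G.Adj a b) : s(a, b) ∈ p.edges := by
  rw [SimpleGraph.Walk.mem_support_iff_exists_getVert] at ha hb
  obtain ⟨i, rfl, hi⟩ := ha
  obtain ⟨j, rfl, hj⟩ := hb
  have key : ∀ i j, j ≤ p.length → i < j → G.Adj (p.getVert i) (p.getVert j) →
      s(p.getVert i, p.getVert j) ∈ p.edges := by
    intro i j hj hij h
    -- Shortcutting from position `i` to position `j` by the edge gives a walk of length `i + 1 +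
    -- (p.length - j)`, so `j ≤ i + 1`.
    have h1 := SimpleGraph.dist_le ((p.take i).append (.cons h (p.drop j)))
    rw [SimpleGraph.Walk.length_append, SimpleGraph.Walk.length_cons, SimpleGraph.Walk.take_length,
      SimpleGraph.Walk.drop_length] at h1
    have h2 : j = i + 1 := by omega
    subst h2
    exact getVert_mem_edges p (by omega)
  rcases lt_trichotomy i j with h | rfl | h
  · exact key i j hj h hab
  · exact absurd hab (G.loopless.irrefl _)
  · rw [Sym2.eq_swap]
    exact key j i hi h hab.symm

/-- In a chordal graph, two neighbors of `v` that are joined by a path through non-neighbors of `v`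
are adjacent. -/
theorem IsChordal.adj_of_reachable (hG : IsChordal G) {v x y : V} (hxy : x ≠ y) (hx : G.Adj v x)
    (hy : G.Adj v y) {U : Set V} (hU : ∀ c ∈ U, c ≠ v ∧ ¬ G.Adj v c)
    (hr : (within G (U ∪ {x, y})).Reachable x y) : G.Adj x y := by
  by_contra hn
  -- A shortest path from `x` to `y`, closed up through `v`, is a cycle of length at least `4`. Its
  -- chord cannot join two vertices of the path, by minimality, and cannot start at `v`, whose only
  -- neighbors on the path are `x` and `y`.
  obtain ⟨p, hp, hlen⟩ := hr.exists_path_of_dist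
  have hmem : ∀ a ∈ p.support, a ∈ U ∪ {x, y} := fun a ha =>
    mem_of_mem_support_within p (by simp) ha
  have hv : v ∉ p.support := by
    intro h
    rcases hmem v h with h | h | h
    · exact (hU v h).1 rfl
    · exact hx.ne h
    · exact hy.ne h
  have hlen2 : 2 ≤ p.length := by
    by_contra h
    have h3 : p.length = 0 ∨ p.length = 1 := by omega
    rcases h3 with h3 | h3
    · exact hxy (SimpleGraph.Walk.eq_of_length_eq_zero h3)
    · exact hn (SimpleGraph.Walk.adj_of_length_eq_one h3).1
  set q := p.mapLe (within_le (G := G) (U ∪ {x, y})) with hq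
  have hqs : q.support = p.support := by simp [hq]
  have hqe : q.edges = p.edges := by simp [hq]
  have hc : (SimpleGraph.Walk.cons hx (q.concat hy.symm)).IsCycle := by
    rw [SimpleGraph.Walk.cons_isCycle_iff]
    refine ⟨(hp.mapLe _).concat (by rw [← hq, hqs]; exact hv) _, ?_⟩
    rw [SimpleGraph.Walk.edges_concat, List.concat_eq_append, List.mem_append]
    rintro (h | h)
    · exact hv (hqs ▸ SimpleGraph.Walk.fst_mem_support_of_mem_edges _ h)
    · simp only [List.mem_singleton, Sym2.eq_iff] at h
      rcases h with ⟨h, _⟩ | ⟨_, h⟩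
      · exact hy.ne h
      · exact hxy h
  have hcl : 4 ≤ (SimpleGraph.Walk.cons hx (q.concat hy.symm)).length := by
    simp [hq]; omega
  obtain ⟨a, ha, b, hb, hab, he⟩ := hG v _ hc hcl
  have hsup : ∀ a ∈ (SimpleGraph.Walk.cons hx (q.concat hy.symm)).support,
      a = v ∨ a ∈ p.support := by
    intro a ha
    rw [SimpleGraph.Walk.support_cons, SimpleGraph.Walk.support_concat, hqs] at ha
    simp only [List.mem_cons, List.mem_append, List.not_mem_nil, or_false] at ha
    tauto
  simp only [SimpleGraph.Walk.edges_cons, SimpleGraph.Walk.edges_concat, hqe,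
    List.concat_eq_append, List.mem_cons, List.mem_append, List.not_mem_nil, or_false,
    not_or] at he
  have hspoke : ∀ b ∈ p.support, G.Adj v b → b = x ∨ b = y := by
    intro b hb hvb
    rcases hmem b hb with h | h | h
    · exact absurd hvb (hU b h).2
    · exact Or.inl h
    · exact Or.inr h
  rcases hsup a ha with rfl | ha'
  · rcases hsup b hb with rfl | hb'
    · exact hab.ne rfl
    · rcases hspoke b hb' hab with rfl | rfl
      · exact he.1 rfl
      · exact he.2.2 Sym2.eq_swap
  · rcases hsup b hb with rfl | hb'
    · rcases hspoke a ha' hab.symm with rfl | rfl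
      · exact he.1 Sym2.eq_swap
      · exact he.2.2 rfl
    · exact he.2.1 (mem_edges_of_length_eq_dist p hlen ha' hb' ⟨hab, hmem a ha', hmem b hb'⟩)

open Classical in
-- Dirac's argument. Let `C` be the component of `z` among the non-neighbors of `v` in `W`, and `S`
-- the set of its outside neighbors in `W`. Then `S` consists of neighbors of `v` and is a clique by
-- chordality. A vertex of `C` has all its neighbors in `C ∪ S`, which misses `v`, so it suffices to
-- find a vertex of `C` that is simplicial there, by induction.
theorem IsChordal.exists_simplicial_not_adj (hG : IsChordal G) (W : Finset V) {v z : V}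
    (hv : v ∈ W) (hz : z ∈ W) (hzv : z ≠ v) (hvz : ¬ G.Adj v z) :
    ∃ s ∈ W, s ≠ v ∧ ¬ G.Adj v s ∧ IsSimplicialIn G W s := by
  induction W using Finset.strongInduction generalizing v z with
  | H W ih =>
  set U : Set V := {c | c ∈ W ∧ c ≠ v ∧ ¬ G.Adj v c} with hU
  set C : Finset V := W.filter (fun c => c ∈ U ∧ (within G U).Reachable z c) with hC
  set S : Finset V := W.filter (fun x => x ∉ C ∧ ∃ c ∈ C, G.Adj x c) with hS
  have hzC : z ∈ C := by simp [hC, hU, hz, hzv, hvz]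
  have hCU : ∀ c ∈ C, c ∈ U := fun c hc => (Finset.mem_filter.1 hc).2.1
  have hCr : ∀ c ∈ C, (within G U).Reachable z c := fun c hc => (Finset.mem_filter.1 hc).2.2
  have hSU : ∀ x ∈ S, G.Adj v x := by
    intro x hx
    obtain ⟨hxW, hxC, c, hc, hxc⟩ := Finset.mem_filter.1 hx
    by_contra hvx
    have hxv : x ≠ v := by
      rintro rfl
      exact (hCU c hc).2.2 hxc
    have hxU : x ∈ U := ⟨hxW, hxv, hvx⟩
    refine hxC (Finset.mem_filter.2 ⟨hxW, hxU, (hCr c hc).trans ?_⟩)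
    exact SimpleGraph.Adj.reachable ⟨hxc.symm, hCU c hc, hxU⟩
  have hSc : ∀ x ∈ S, ∀ y ∈ S, x ≠ y → G.Adj x y := by
    intro x hx y hy hxy
    obtain ⟨_, _, c, hc, hxc⟩ := Finset.mem_filter.1 hx
    obtain ⟨_, _, d, hd, hyd⟩ := Finset.mem_filter.1 hy
    refine hG.adj_of_reachable hxy (hSU x hx) (hSU y hy) (U := U) (fun c hc => hc.2) ?_
    have h1 : (within G (U ∪ {x, y})).Reachable x c :=
      SimpleGraph.Adj.reachable ⟨hxc, by simp, Or.inl (hCU c hc)⟩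
    have h2 : (within G (U ∪ {x, y})).Reachable c d :=
      (((hCr c hc).symm).trans (hCr d hd)).mono (within_mono Set.subset_union_left)
    have h3 : (within G (U ∪ {x, y})).Reachable d y :=
      SimpleGraph.Adj.reachable ⟨hyd.symm, Or.inl (hCU d hd), by simp⟩
    exact (h1.trans h2).trans h3
  set W' := C ∪ S with hW'
  have hW'W : W' ⊂ W := by
    rw [Finset.ssubset_iff_of_subset
      (Finset.union_subset (Finset.filter_subset _ _) (Finset.filter_subset _ _))]
    refine ⟨v, hv, ?_⟩
    rw [Finset.mem_union, not_or]
    exact ⟨fun h => (hCU v h).2.1 rfl, fun h => (hSU v h).ne rfl⟩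
  suffices h : ∃ c ∈ C, IsSimplicialIn G W' c by
    obtain ⟨c, hc, hcs⟩ := h
    refine ⟨c, (Finset.mem_filter.1 hc).1, (hCU c hc).2.1, (hCU c hc).2.2, ?_⟩
    have hN : ∀ x ∈ W, G.Adj c x → x ∈ W' := by
      intro x hx hcx
      by_cases hxC : x ∈ C
      · exact Finset.mem_union_left _ hxC
      · exact Finset.mem_union_right _ (Finset.mem_filter.2 ⟨hx, hxC, c, hc, hcx.symm⟩)
    exact fun x hx y hy hcx hcy hxy => hcs x (hN x hx hcx) y (hN y hy hcy) hcx hcy hxy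
  -- The induction is started at a vertex `a` with a non-neighbor; the simplicial vertex found is
  -- not adjacent to `a`. If `a ∈ S`, it lies outside the clique `S`. If only `a ∈ C` is possible,
  -- all of `S` is adjacent to everything, so again it lies in `C`. Without any such `a` the set is
  -- complete and `z` serves.
  by_cases hA : ∃ a ∈ S, ∃ b ∈ W', b ≠ a ∧ ¬ G.Adj a b
  · obtain ⟨a, ha, b, hb, hba, hab⟩ := hA
    obtain ⟨s, hs, hsa, has, hss⟩ := ih W' hW'W (Finset.mem_union_right _ ha) hb hba hab
    rcases Finset.mem_union.1 hs with h | h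
    · exact ⟨s, h, hss⟩
    · exact absurd (hSc a ha s h hsa.symm) has
  push Not at hA
  by_cases hA' : ∃ a ∈ C, ∃ b ∈ W', b ≠ a ∧ ¬ G.Adj a b
  · obtain ⟨a, ha, b, hb, hba, hab⟩ := hA'
    obtain ⟨s, hs, hsa, has, hss⟩ := ih W' hW'W (Finset.mem_union_left _ ha) hb hba hab
    rcases Finset.mem_union.1 hs with h | h
    · exact ⟨s, h, hss⟩
    · exact absurd (hA s h a (Finset.mem_union_left _ ha) hsa.symm).symm has
  push Not at hA'
  refine ⟨z, hzC, fun x hx y hy _ _ hxy => ?_⟩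
  rcases Finset.mem_union.1 hx with h | h
  · exact hA' x h y hy hxy.symm
  · exact hA x h y hy hxy.symm

/-- Every nonempty set of vertices of a chordal graph has a simplicial vertex. -/
theorem IsChordal.exists_simplicial (hG : IsChordal G) {W : Finset V} (hW : W.Nonempty) :
    ∃ s ∈ W, IsSimplicialIn G W s := by
  by_cases h : ∃ v ∈ W, ∃ z ∈ W, z ≠ v ∧ ¬ G.Adj v z
  · obtain ⟨v, hv, z, hz, hzv, hvz⟩ := h
    obtain ⟨s, hs, _, _, hss⟩ := hG.exists_simplicial_not_adj W hv hz hzv hvz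
    exact ⟨s, hs, hss⟩
  · push Not at h
    obtain ⟨v, hv⟩ := hW
    exact ⟨v, hv, fun x hx y hy _ _ hxy => h x hx y hy hxy.symm⟩

end Chordal

end HatGame

namespace HatGame

/-! ### The signed independence polynomial under elimination of a simplicial vertex -/

section Elimination

variable {V : Type*} {G : SimpleGraph V}

/-- The term of the set `I` in the signed independence polynomial. -/
def indepTerm (x : V → ℝ) (I : Finset V) : ℝ := (-1) ^ I.card * ∏ v ∈ I, x v

open Classical in
/-- The weights after the elimination of `v`. -/
noncomputable def eliminate (G : SimpleGraph V) (v : V) (x : V → ℝ) : V → ℝ :=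
  fun u => if G.Adj v u then x u / (1 - x v) else x u

theorem eliminate_nonneg {v : V} {x : V → ℝ} (hx : 0 ≤ x) (hv : x v < 1) :
    0 ≤ eliminate G v x := by
  intro u
  simp only [eliminate]
  split_ifs
  · exact div_nonneg (hx u) (by linarith)
  · exact hx u

variable [DecidableEq V]

open Classical in
/-- The signed independence polynomial of the subgraph induced by `W`. -/
noncomputable def indepSum (G : SimpleGraph V) (W : Finset V) (x : V → ℝ) : ℝ :=
  ∑ I ∈ W.powerset.filter (fun I : Finset V => G.IsIndepSet (I : Set V)), indepTerm x I

theorem indepSum_univ [Fintype V] (x : V → ℝ) :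
    indepSum G Finset.univ x = signedIndepPoly G x := by
  simp only [indepSum, signedIndepPoly, indepTerm, Finset.powerset_univ]
  refine Finset.sum_congr ?_ fun _ _ => rfl
  ext I
  simp only [Finset.mem_filter]

theorem indepSum_congr {W : Finset V} {x y : V → ℝ} (h : ∀ u ∈ W, x u = y u) :
    indepSum G W x = indepSum G W y := by
  classical
  refine Finset.sum_congr rfl fun I hI => ?_
  have hIW := Finset.mem_powerset.1 (Finset.mem_filter.1 hI).1
  simp only [indepTerm]
  rw [Finset.prod_congr rfl fun u hu => h u (hIW hu)]

@[simp] theorem indepSum_empty (x : V → ℝ) : indepSum G ∅ x = 1 := by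
  simp [indepSum, indepTerm, Finset.sum_filter]

theorem indepSum_zero {W : Finset V} {x : V → ℝ} (h : ∀ u ∈ W, x u = 0) : indepSum G W x = 1 := by
  classical
  unfold indepSum
  rw [Finset.sum_eq_single ∅]
  · simp [indepTerm]
  · intro I hI hne
    obtain ⟨u, hu⟩ := Finset.nonempty_iff_ne_empty.2 hne
    have hIW := Finset.mem_powerset.1 (Finset.mem_filter.1 hI).1
    simp [indepTerm, Finset.prod_eq_zero hu (h u (hIW hu))]
  · simp

/-- The polynomial of the subgraph induced by `W` is positive on the box below `x`. -/
def PositiveBelow (G : SimpleGraph V) (W : Finset V) (x : V → ℝ) : Prop :=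
  ∀ w : V → ℝ, 0 ≤ w → w ≤ x → 0 < indepSum G W w

open Classical in
-- The independent sets are split according to whether they contain `v`.
theorem indepSum_insert {W : Finset V} {v : V} (hv : v ∉ W) (x : V → ℝ) :
    indepSum G (insert v W) x =
      indepSum G W x - x v * indepSum G (W.filter fun u => ¬ G.Adj v u) x := by
  unfold indepSum
  rw [Finset.powerset_insert, Finset.filter_union, Finset.sum_union]
  · rw [sub_eq_add_neg]
    congr 1
    rw [Finset.mul_sum, ← Finset.sum_neg_distrib]
    symm
    refine Finset.sum_bij (fun I _ => insert v I) ?_ ?_ ?_ ?_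
    · intro I hI
      simp only [Finset.mem_filter, Finset.mem_powerset, Finset.mem_image] at hI ⊢
      refine ⟨⟨I, hI.1.trans (Finset.filter_subset _ _), rfl⟩, ?_⟩
      intro a ha b hb hab
      simp only [Finset.coe_insert, Set.mem_insert_iff, Finset.mem_coe] at ha hb
      have hn : ∀ u ∈ I, ¬ G.Adj v u := fun u hu => (Finset.mem_filter.1 (hI.1 hu)).2
      rcases ha with rfl | ha <;> rcases hb with rfl | hb
      · exact absurd rfl hab
      · exact hn b hb
      · exact fun h => hn a ha h.symm
      · exact hI.2 ha hb hab
    · intro I hI J hJ h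
      simp only [Finset.mem_filter, Finset.mem_powerset] at hI hJ
      have hvI : v ∉ I := fun h => hv (Finset.mem_filter.1 (hI.1 h)).1
      have hvJ : v ∉ J := fun h => hv (Finset.mem_filter.1 (hJ.1 h)).1
      rw [← Finset.erase_insert hvI, ← Finset.erase_insert hvJ, h]
    · intro J hJ
      simp only [Finset.mem_filter, Finset.mem_powerset, Finset.mem_image] at hJ
      obtain ⟨⟨I, hIW, rfl⟩, hJ⟩ := hJ
      have hvI : v ∉ I := fun h => hv (hIW h)
      refine ⟨I, ?_, rfl⟩
      simp only [Finset.mem_filter, Finset.mem_powerset]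
      refine ⟨fun u hu => Finset.mem_filter.2 ⟨hIW hu, ?_⟩, fun a ha b hb hab => ?_⟩
      · refine hJ (by simp) (by simp [hu]) ?_
        rintro rfl
        exact hvI hu
      · exact hJ (by simp at ha; simp [ha]) (by simp at hb; simp [hb]) hab
    · intro I hI
      simp only [Finset.mem_filter, Finset.mem_powerset] at hI
      have hvI : v ∉ I := fun h => hv (Finset.mem_filter.1 (hI.1 h)).1
      simp only [indepTerm, Finset.card_insert_of_notMem hvI, Finset.prod_insert hvI]
      ring
  · refine Finset.disjoint_filter_filter (Finset.disjoint_left.2 fun I hI hI' => ?_)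
    rw [Finset.mem_powerset] at hI
    obtain ⟨J, _, rfl⟩ := Finset.mem_image.1 hI'
    exact hv (hI (Finset.mem_insert_self v J))

/-- Compare termwise over the independent `I ⊆ W`. If `I` has no neighbor of `v`, then `I` and
`insert v I` together contribute the factor `1 - x v`. Otherwise `I` has exactly one neighbor of
`v`, only `I` itself contributes, and the denominator in that neighbor's new weight cancels `1 - x
v`. -/
theorem indepSum_insert_of_simplicial {W : Finset V} {v : V} (hv : v ∉ W)
    (hs : IsSimplicialIn G W v) {x : V → ℝ} (hx : x v ≠ 1) :
    indepSum G (insert v W) x = (1 - x v) * indepSum G W (eliminate G v x) := by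
  classical
  have hx' : 1 - x v ≠ 0 := sub_ne_zero.2 hx.symm
  rw [indepSum_insert hv]
  have h1 : indepSum G (W.filter fun u => ¬ G.Adj v u) x =
      ∑ I ∈ W.powerset.filter (fun I : Finset V => G.IsIndepSet (I : Set V)),
        if ∀ u ∈ I, ¬ G.Adj v u then indepTerm x I else 0 := by
    rw [← Finset.sum_filter]
    refine Finset.sum_congr ?_ fun _ _ => rfl
    ext I
    simp only [Finset.mem_filter, Finset.mem_powerset, Finset.subset_iff]
    constructor
    · rintro ⟨h, hI⟩
      exact ⟨⟨fun u hu => (h hu).1, hI⟩, fun u hu => (h hu).2⟩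
    · rintro ⟨⟨h, hI⟩, h'⟩
      exact ⟨fun u hu => ⟨h hu, h' u hu⟩, hI⟩
  rw [h1]
  unfold indepSum
  rw [Finset.mul_sum, Finset.mul_sum, ← Finset.sum_sub_distrib]
  refine Finset.sum_congr rfl fun I hI => ?_
  simp only [Finset.mem_filter, Finset.mem_powerset] at hI
  obtain ⟨hIW, hI⟩ := hI
  split_ifs with h
  · have : indepTerm (eliminate G v x) I = indepTerm x I := by
      simp only [indepTerm]
      rw [Finset.prod_congr rfl fun u hu => show eliminate G v x u = x u by
        simp [eliminate, h u hu]]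
    rw [this]
    ring
  · push Not at h
    obtain ⟨u, hu, hvu⟩ := h
    have : indepTerm (eliminate G v x) I = indepTerm x I / (1 - x v) := by
      simp only [indepTerm]
      rw [← Finset.mul_prod_erase I _ hu, ← Finset.mul_prod_erase I x hu,
        Finset.prod_congr rfl fun w hw => show eliminate G v x w = x w by
          have hw' := Finset.mem_erase.1 hw
          have : ¬ G.Adj v w := fun hvw =>
            hI hu hw'.2 hw'.1.symm (hs u (hIW hu) w (hIW hw'.2) hvu hvw hw'.1.symm)
          simp [eliminate, this]]
      simp only [eliminate, hvu, if_true]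
      ring
    rw [this]
    field_simp
    ring

/-- Elimination is monotone in all weights as long as that of `v` stays below `1`, so it maps the
box below `x` into the box below `eliminate G v x`; conversely every point of the latter box is
attained with the weight of `v` fixed at `x v`. -/
theorem positiveBelow_insert_iff {W : Finset V} {v : V} (hv : v ∉ W)
    (hs : IsSimplicialIn G W v) {x : V → ℝ} (hx : 0 ≤ x) :
    PositiveBelow G (insert v W) x ↔ x v < 1 ∧ PositiveBelow G W (eliminate G v x) := by
  classical
  constructor
  · intro h
    have hv1 : x v < 1 := by
      by_contra h1
      push Not at h1
      -- If `x v ≥ 1`, the indicator vector of `v` lies in the box, and the polynomial takes the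
      -- value `1 - 1 = 0` there.
      have := h (Pi.single v 1) (by simp [Pi.le_def, Pi.single_apply]; intro i; split_ifs <;> simp)
        (by
          intro u
          by_cases hu : u = v
          · subst hu; simpa using h1
          · simpa [hu] using hx u)
      rw [indepSum_insert hv, indepSum_zero, indepSum_zero] at this
      · simp at this
      · intro u hu
        have : u ≠ v := fun h => hv (h ▸ (Finset.mem_filter.1 hu).1)
        simp [this]
      · intro u hu
        have : u ≠ v := fun h => hv (h ▸ hu)
        simp [this]
    refine ⟨hv1, fun w hw hwx => ?_⟩
    have hpos : 0 < 1 - x v := by linarith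
    -- The preimage of `w` under the elimination that has weight `x v` at `v`.
    set y : V → ℝ := fun u => if u = v then x v else if G.Adj v u then w u * (1 - x v) else w u
      with hy
    have hyv : y v = x v := by simp [hy]
    have h1 := h y
      (by
        intro u
        simp only [hy]
        split_ifs
        · exact hx v
        · exact mul_nonneg (hw u) hpos.le
        · exact hw u)
      (by
        intro u
        have hu := hwx u
        simp only [hy]
        simp only [eliminate] at hu
        split_ifs with h1 h2
        · rw [h1]
        · rw [if_pos h2, le_div_iff₀ hpos] at hu
          exact hu
        · rwa [if_neg h2] at hu)
    rw [indepSum_insert_of_simplicial hv hs (by rw [hyv]; exact hv1.ne), hyv] at h1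
    have h2 := (pos_iff_pos_of_mul_pos h1).1 hpos
    rwa [indepSum_congr (y := w)] at h2
    intro u hu
    have huv : u ≠ v := fun h => hv (h ▸ hu)
    simp only [eliminate, hyv]
    simp only [hy, huv, if_false]
    split_ifs
    · field_simp
    · rfl
  · rintro ⟨hv1, h⟩ w hw hwx
    have hwv : w v < 1 := (hwx v).trans_lt hv1
    rw [indepSum_insert_of_simplicial hv hs hwv.ne]
    refine mul_pos (by linarith) (h _ (eliminate_nonneg hw hwv) ?_)
    intro u
    simp only [eliminate]
    split_ifs
    · exact div_le_div₀ (hx u) (hwx u) (by linarith) (by linarith [hwx v])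
    · exact hwx u

end Elimination

end HatGame

namespace HatGame

/-! ### The elimination procedure in integers -/

/-- The data of the problem, in the form in which the machine reads them. -/
structure Data where
  n : ℕ
  adj : ℕ → ℕ → ℕ
  num : ℕ → ℕ
  den : ℕ → ℕ

/-- The current weight of a vertex `u` that is not eliminated is `N u / M`. The numbers of colors
and of guesses collected so far are `H u` and `G u`; `el u` tells whether `u` is eliminated and
`fl` counts the failures, that is the eliminated vertices of weight at least `1`. -/
structure State where
  M : ℕ
  N : ℕ → ℕ
  H : ℕ → ℕ
  G : ℕ → ℕ
  el : ℕ → ℕ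
  fl : ℕ

/-- The function that is `f` below `k` and `g` from `k` on. -/
def mix (k : ℕ) (f g : ℕ → ℕ) : ℕ → ℕ := fun u => if u < k then f u else g u

@[simp] theorem mix_zero (f g : ℕ → ℕ) : mix 0 f g = g := by ext; simp [mix]

theorem mix_of_lt {k u : ℕ} (h : u < k) (f g : ℕ → ℕ) : mix k f g u = f u := if_pos h

theorem mix_of_ge {k u : ℕ} (h : k ≤ u) (f g : ℕ → ℕ) : mix k f g u = g u := if_neg (by omega)

@[simp] theorem mix_self (k : ℕ) (f g : ℕ → ℕ) : mix k f g k = g k := mix_of_ge le_rfl f g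

theorem update_mix (k : ℕ) (f g : ℕ → ℕ) {v : ℕ} (hv : v = f k) :
    Function.update (mix k f g) k v = mix (k + 1) f g := by
  ext u
  by_cases h : u = k
  · subst h; simp [mix, hv]
  · simp only [Function.update_of_ne h, mix]
    split_ifs <;> first | rfl | omega

/-- The last `v` below the bound with `c v = 0`, and `0` if there is none. -/
def lastZero (c : ℕ → ℕ) : ℕ → ℕ
  | 0 => 0
  | k + 1 => if c k = 0 then k else lastZero c k

theorem lastZero_spec {c : ℕ → ℕ} {k v : ℕ} (hv : v < k) (hc : c v = 0) :
    lastZero c k < k ∧ c (lastZero c k) = 0 := by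
  induction k with
  | zero => omega
  | succ k ih =>
    simp only [lastZero]
    split_ifs with h
    · exact ⟨by omega, h⟩
    · have : v < k := by
        rcases Nat.lt_succ_iff_lt_or_eq.1 hv with h' | rfl
        · exact h'
        · exact absurd hc h
      have := ih this
      exact ⟨by omega, this.2⟩

theorem lastZero_lt (c : ℕ → ℕ) {n k : ℕ} (hn : 0 < n) (hk : k ≤ n) : lastZero c k < n := by
  induction k with
  | zero => exact hn
  | succ k ih =>
    simp only [lastZero]
    split_ifs
    · omega
    · exact ih (by omega)

namespace Data

variable (I : Data)

/-- The contribution of the pair `x, y` to the obstructions against `v` being simplicial. -/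
def obstruction (el : ℕ → ℕ) (v x y : ℕ) : ℕ :=
  -- All conditions are arithmetic, as the machine evaluates them. With truncated subtraction `(x -
  -- y) + (y - x)` is the distance of `x` and `y`, which serves as the test `x ≠ y`.
  I.adj v x * I.adj v y * (1 - el x) * (1 - el y) * ((x - y) + (y - x)) * (1 - I.adj x y)

/-- The sum of all obstructions against `v` being simplicial among the remaining vertices. -/
def obstructions (el : ℕ → ℕ) (v : ℕ) : ℕ :=
  ∑ j ∈ Finset.range (I.n * I.n), I.obstruction el v (j / I.n) (j % I.n)

/-- The vertex to be eliminated next. -/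
def pivot (s : State) : ℕ := lastZero (fun v => I.obstructions s.el v + s.el v) I.n

/-- The number of guesses of the pivot modulo `M`. -/
def guess (s : State) : ℕ := s.N (I.pivot s) - (s.N (I.pivot s) - s.M)

/-- Whether the weight of the pivot is at least `1`. -/
def failed (s : State) : ℕ := 1 - (s.M - s.N (I.pivot s))

/-- At a failure the guess equals `M`, and the last summand restores `M`, so that the denominator
stays positive. -/
def nextM (s : State) : ℕ := s.M - I.guess s + I.failed s * s.M

def isPivot (s : State) (u : ℕ) : ℕ := 1 - ((u - I.pivot s) + (I.pivot s - u))

/-- Whether `u` is a neighbor of the pivot that is eliminated later. -/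
def later (s : State) (u : ℕ) : ℕ := (1 - s.el u) * I.adj (I.pivot s) u

/-- The number of values of the digit of `u` that belongs to the pivot. -/
def radix (s : State) (u : ℕ) : ℕ :=
  (I.isPivot s u + I.later s u) * s.M + (1 - (I.isPivot s u + I.later s u))

/-- The bear on `u` guesses that the sum of the digits lies in the interval from `lo` to `hi`. -/
def lo (s : State) (u : ℕ) : ℕ := I.later s u * I.guess s

def hi (s : State) (u : ℕ) : ℕ := I.isPivot s u * I.guess s + (1 - I.isPivot s u) * s.M

/-- The number of guesses of the digit of `u` that belongs to the pivot. -/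
def count (s : State) (u : ℕ) : ℕ :=
  (I.isPivot s u + I.later s u) * (I.hi s u - I.lo s u) + (1 - (I.isPivot s u + I.later s u))

/-- A failure resets all weights to `0`. Otherwise a later neighbor keeps its numerator, since its
weight is to be divided by `nextM / M`; any other remaining vertex keeps its weight, so its
numerator is rescaled to the new denominator. For remaining vertices this division is exact up to
the first failure, see `exact_next`. -/
def nextN (s : State) (u : ℕ) : ℕ :=
  (1 - I.failed s) * (I.later s u * s.N u + (1 - I.later s u) * (s.N u * I.nextM s / s.M))

/-- The elimination of the pivot. -/
def next (s : State) : State where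
  M := I.nextM s
  -- Entries from `I.n` on stay untouched, so that states can be compared with whole arrays of the
  -- memory.
  N := mix I.n (I.nextN s) s.N
  H := mix I.n (fun u => s.H u * I.radix s u) s.H
  G := mix I.n (fun u => s.G u * I.count s u) s.G
  el := Function.update s.el (I.pivot s) 1
  fl := s.fl + I.failed s

/-- The product of the denominators. -/
def denProd : ℕ := ∏ u ∈ Finset.range I.n, I.den u

def initState : State where
  M := I.denProd
  N := mix I.n (fun u => I.num u * (I.denProd / I.den u)) 0
  H := mix I.n 1 0
  G := mix I.n 1 0
  el := 0
  fl := 0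

/-- The state after `t` eliminations. -/
def state (t : ℕ) : State := I.next^[t] I.initState

@[simp] theorem state_zero : I.state 0 = I.initState := rfl

theorem state_succ (t : ℕ) : I.state (t + 1) = I.next (I.state t) :=
  Function.iterate_succ_apply' _ _ _

/-- The data come from a graph and from fractions. -/
structure Valid : Prop where
  adj_le : ∀ u < I.n, ∀ v < I.n, I.adj u v ≤ 1
  adj_self : ∀ u < I.n, I.adj u u = 0
  den_pos : ∀ u < I.n, 0 < I.den u

variable {I} {s : State}

theorem guess_eq : I.guess s = min (s.N (I.pivot s)) s.M := by
  unfold guess; omega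

theorem guess_le : I.guess s ≤ s.M := by
  rw [guess_eq]; exact min_le_right _ _

theorem failed_eq : I.failed s = if s.M ≤ s.N (I.pivot s) then 1 else 0 := by
  unfold failed; split_ifs <;> omega

theorem failed_le : I.failed s ≤ 1 := by unfold failed; omega

theorem nextM_of_le (h : s.M ≤ s.N (I.pivot s)) : I.nextM s = s.M := by
  simp [nextM, failed_eq, guess_eq, h]

theorem nextM_of_lt (h : s.N (I.pivot s) < s.M) : I.nextM s = s.M - s.N (I.pivot s) := by
  have : ¬ s.M ≤ s.N (I.pivot s) := by omega
  simp [nextM, failed_eq, guess_eq, this, h.le]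

theorem nextM_le : I.nextM s ≤ s.M := by
  rcases le_or_gt s.M (s.N (I.pivot s)) with h | h
  · rw [nextM_of_le h]
  · rw [nextM_of_lt h]; omega

theorem nextM_pos (hM : 0 < s.M) : 0 < I.nextM s := by
  rcases le_or_gt s.M (s.N (I.pivot s)) with h | h
  · rwa [nextM_of_le h]
  · rw [nextM_of_lt h]; omega

theorem isPivot_eq (u : ℕ) : I.isPivot s u = if u = I.pivot s then 1 else 0 := by
  unfold isPivot; split_ifs <;> omega

theorem pivot_lt (hn : 0 < I.n) : I.pivot s < I.n := lastZero_lt _ hn le_rfl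

theorem later_le (hI : I.Valid) {u : ℕ} (hu : u < I.n) : I.later s u ≤ 1 := by
  have h1 := hI.adj_le _ (pivot_lt (s := s) (by omega)) u hu
  have h2 : 1 - s.el u ≤ 1 := by omega
  simpa [later] using Nat.mul_le_mul h2 h1

theorem later_pivot (hI : I.Valid) (hn : 0 < I.n) : I.later s (I.pivot s) = 0 := by
  simp [later, hI.adj_self _ (pivot_lt (s := s) hn)]

/-- The three roles that a vertex can have in an elimination. -/
theorem role_cases (hI : I.Valid) {u : ℕ} (hu : u < I.n) :
    (u = I.pivot s ∧ I.later s u = 0 ∧ I.radix s u = s.M ∧ I.lo s u = 0 ∧ I.hi s u = I.guess s ∧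
      I.count s u = I.guess s) ∨
    (u ≠ I.pivot s ∧ I.later s u = 1 ∧ I.radix s u = s.M ∧ I.lo s u = I.guess s ∧ I.hi s u = s.M ∧
      I.count s u = s.M - I.guess s) ∨
    (u ≠ I.pivot s ∧ I.later s u = 0 ∧ I.radix s u = 1 ∧ I.lo s u = 0 ∧ I.hi s u = s.M ∧
      I.count s u = 1) := by
  by_cases h : u = I.pivot s
  · left
    have h0 : I.later s u = 0 := h ▸ later_pivot hI (by omega)
    have h1 : I.isPivot s u = 1 := by rw [isPivot_eq, if_pos h]
    simp only [radix, lo, hi, count, h0, h1]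
    simp [h]
  · right
    have h1 : I.isPivot s u = 0 := by rw [isPivot_eq, if_neg h]
    have h2 := later_le (s := s) hI hu
    have h3 : I.later s u = 1 ∨ I.later s u = 0 := by omega
    rcases h3 with h3 | h3 <;> simp [h, h1, h3, radix, lo, hi, count]

theorem hi_le (hI : I.Valid) {u : ℕ} (hu : u < I.n) : I.hi s u ≤ s.M := by
  have := guess_le (I := I) (s := s)
  rcases role_cases (s := s) hI hu with h | h | h <;> omega

theorem lo_le (hI : I.Valid) {u : ℕ} (hu : u < I.n) : I.lo s u ≤ s.M := by
  have := guess_le (I := I) (s := s)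
  rcases role_cases (s := s) hI hu with h | h | h <;> omega

theorem radix_pos (hI : I.Valid) (hM : 0 < s.M) {u : ℕ} (hu : u < I.n) : 0 < I.radix s u := by
  rcases role_cases (s := s) hI hu with h | h | h <;> omega

/-- This keeps the numerators within their initial bound throughout. -/
theorem nextN_le (hI : I.Valid) {u : ℕ} (hu : u < I.n) : I.nextN s u ≤ s.N u := by
  have h1 : s.N u * I.nextM s / s.M ≤ s.N u := by
    refine Nat.div_le_of_le_mul ?_
    rw [mul_comm]
    exact Nat.mul_le_mul_right _ nextM_le
  have h2 : I.later s u * s.N u + (1 - I.later s u) * (s.N u * I.nextM s / s.M) ≤ s.N u := by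
    have h3 := later_le (s := s) hI hu
    have h4 : I.later s u = 0 ∨ I.later s u = 1 := by omega
    rcases h4 with h4 | h4 <;> simp [h4, h1]
  unfold nextN
  have h5 := failed_le (I := I) (s := s)
  have h6 : I.failed s = 0 ∨ I.failed s = 1 := by omega
  rcases h6 with h6 | h6 <;> simp [h6, h2]

theorem denProd_pos (hI : I.Valid) : 0 < I.denProd :=
  Finset.prod_pos fun u hu => hI.den_pos u (Finset.mem_range.1 hu)

theorem den_dvd {u : ℕ} (hu : u < I.n) : I.den u ∣ I.denProd :=
  Finset.dvd_prod_of_mem _ (Finset.mem_range.2 hu)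

/-- Bounds for the numbers that occur in the procedure. -/
structure Bounds (I : Data) (t : ℕ) (s : State) : Prop where
  M_pos : 0 < s.M
  M_le : s.M ≤ I.denProd
  N_le : ∀ u < I.n, s.N u ≤ I.num u * I.denProd
  H_pos : ∀ u < I.n, 0 < s.H u
  H_le : ∀ u < I.n, s.H u ≤ I.denProd ^ t
  G_le : ∀ u < I.n, s.G u ≤ I.denProd ^ t
  el_le : ∀ u, s.el u ≤ 1
  fl_le : s.fl ≤ t

theorem bounds_state (hI : I.Valid) (t : ℕ) : Bounds I t (I.state t) := by
  induction t with
  | zero =>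
    refine ⟨denProd_pos hI, le_rfl, fun u hu => ?_, fun u hu => ?_, fun u hu => ?_, fun u hu => ?_,
      fun u => ?_, le_rfl⟩
    · simp only [state_zero, initState, mix_of_lt hu]
      exact Nat.mul_le_mul_left _ (Nat.div_le_self _ _)
    all_goals simp [initState, mix_of_lt, *]
  | succ t ih =>
    rw [state_succ]
    set s := I.state t
    have hD := denProd_pos hI
    have hr : ∀ u < I.n, I.radix s u ≤ I.denProd := by
      intro u hu
      have := ih.M_le
      rcases role_cases (s := s) hI hu with h | h | h <;> omega
    have hc : ∀ u < I.n, I.count s u ≤ I.denProd := by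
      intro u hu
      have := ih.M_le
      have := guess_le (I := I) (s := s)
      rcases role_cases (s := s) hI hu with h | h | h <;> omega
    refine ⟨nextM_pos ih.M_pos, nextM_le.trans ih.M_le, fun u hu => ?_, fun u hu => ?_,
      fun u hu => ?_, fun u hu => ?_, fun u => ?_, ?_⟩
    · simp only [next, mix_of_lt hu]
      exact (nextN_le hI hu).trans (ih.N_le u hu)
    · simp only [next, mix_of_lt hu]
      exact Nat.mul_pos (ih.H_pos u hu) (radix_pos hI ih.M_pos hu)
    · simp only [next, mix_of_lt hu, pow_succ]
      exact Nat.mul_le_mul (ih.H_le u hu) (hr u hu)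
    · simp only [next, mix_of_lt hu, pow_succ]
      exact Nat.mul_le_mul (ih.G_le u hu) (hc u hu)
    · simp only [next, Function.update_apply]
      split_ifs
      · exact le_rfl
      · exact ih.el_le u
    · exact Nat.add_le_add ih.fl_le failed_le

end Data

end HatGame

/-! ### Correctness of the integer procedure for chordal graphs. -/

namespace HatGame

namespace Data

variable {I : Data} {G : SimpleGraph (Fin I.n)} {r : Fin I.n → ℚ≥0} {s : State}

open Classical in
/-- The data describe the graph `G` and the vector `r`. -/
structure Describes (I : Data) (G : SimpleGraph (Fin I.n)) (r : Fin I.n → ℚ≥0) : Prop where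
  adj_eq : ∀ u v : Fin I.n, I.adj u v = if G.Adj u v then 1 else 0
  num_eq : ∀ u : Fin I.n, I.num u = (r u).num
  den_eq : ∀ u : Fin I.n, I.den u = (r u).den

theorem Describes.valid (h : I.Describes G r) : I.Valid where
  adj_le u hu v hv := by
    rw [h.adj_eq ⟨u, hu⟩ ⟨v, hv⟩]; split_ifs <;> simp
  adj_self u hu := by
    rw [h.adj_eq ⟨u, hu⟩ ⟨u, hu⟩]; simp
  den_pos u hu := by
    rw [h.den_eq ⟨u, hu⟩]; exact (r ⟨u, hu⟩).den_pos

theorem Describes.cast_eq (h : I.Describes G r) (u : Fin I.n) :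
    (r u : ℝ) = (I.num u : ℝ) / I.den u := by
  rw [h.den_eq, h.num_eq, NNRat.cast_def]

/-- The vertices that are not eliminated. -/
def remaining (I : Data) (s : State) : Finset (Fin I.n) :=
  Finset.univ.filter fun u => s.el u = 0

theorem mem_remaining {u : Fin I.n} : u ∈ I.remaining s ↔ s.el u = 0 := by simp [remaining]

/-! ### The choice of the pivot -/

theorem obstructions_eq_zero_iff (h : I.Describes G r) (hel : ∀ u, s.el u ≤ 1) (v : Fin I.n) :
    I.obstructions s.el v = 0 ↔ IsSimplicialIn G (I.remaining s) v := by
  have key : ∀ x y : Fin I.n, I.obstruction s.el v x y = 0 ↔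
      (x ∈ I.remaining s → y ∈ I.remaining s → G.Adj v x → G.Adj v y → x ≠ y → G.Adj x y) := by
    intro x y
    have hx := hel x
    have hy := hel y
    have hxy : ((x : ℕ) - y) + ((y : ℕ) - x) = 0 ↔ x = y := by
      rw [Fin.ext_iff]; omega
    simp only [obstruction, h.adj_eq, mem_remaining, mul_eq_zero, hxy]
    have hx' : 1 - s.el x = 0 ↔ ¬ s.el x = 0 := by omega
    have hy' : 1 - s.el y = 0 ↔ ¬ s.el y = 0 := by omega
    rw [hx', hy']
    by_cases h1 : G.Adj v x <;> by_cases h2 : G.Adj v y <;> by_cases h3 : G.Adj x y <;>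
      (simp [h1, h2, h3]; try tauto)
  rw [obstructions, Finset.sum_eq_zero_iff]
  constructor
  · intro hs x hx y hy hvx hvy hxy
    refine (key x y).1 ?_ hx hy hvx hvy hxy
    have hn : 0 < I.n := by have := x.2; omega
    have h1 := hs ((x : ℕ) * I.n + y) (by
      rw [Finset.mem_range]
      calc (x : ℕ) * I.n + y < (x : ℕ) * I.n + I.n := by have := y.2; omega
        _ = ((x : ℕ) + 1) * I.n := by ring
        _ ≤ I.n * I.n := Nat.mul_le_mul_right _ x.2)
    rwa [Nat.add_comm, Nat.add_mul_div_right _ _ hn, Nat.div_eq_of_lt y.2, Nat.zero_add,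
      Nat.add_mul_mod_self_right, Nat.mod_eq_of_lt y.2] at h1
  · intro hs j hj
    rw [Finset.mem_range] at hj
    have hn : 0 < I.n := by
      rcases Nat.eq_zero_or_pos I.n with h0 | h0
      · simp [h0] at hj
      · exact h0
    exact (key ⟨j / I.n, Nat.div_lt_of_lt_mul hj⟩ ⟨j % I.n, Nat.mod_lt _ hn⟩).2
      fun hx hy hvx hvy hxy => hs _ hx _ hy hvx hvy hxy

/-- The pivot is a simplicial vertex of the subgraph of the remaining vertices. -/
structure PivotSpec (I : Data) (G : SimpleGraph (Fin I.n)) (s : State) : Prop where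
  lt : I.pivot s < I.n
  el_eq : s.el (I.pivot s) = 0
  simplicial : IsSimplicialIn G (I.remaining s) ⟨I.pivot s, lt⟩

theorem pivotSpec_of_nonempty (h : I.Describes G r) (hG : IsChordal G) (hel : ∀ u, s.el u ≤ 1)
    (hs : (I.remaining s).Nonempty) : PivotSpec I G s := by
  obtain ⟨v, hv, hvs⟩ := hG.exists_simplicial hs
  have h1 := (obstructions_eq_zero_iff h hel v).2 hvs
  obtain ⟨h2, h3⟩ := lastZero_spec (c := fun v => I.obstructions s.el v + s.el v) v.2
    (by simp [h1, mem_remaining.1 hv])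
  have h4 : I.obstructions s.el (I.pivot s) = 0 ∧ s.el (I.pivot s) = 0 := by
    simpa [pivot] using h3
  exact ⟨h2, h4.2, (obstructions_eq_zero_iff h hel ⟨I.pivot s, h2⟩).1 h4.1⟩

theorem remaining_next (hp : PivotSpec I G s) :
    I.remaining (I.next s) = (I.remaining s).erase ⟨I.pivot s, hp.lt⟩ := by
  ext u
  simp only [mem_remaining, Finset.mem_erase, next, Function.update_apply, ne_eq, Fin.ext_iff]
  split_ifs with h <;> simp [h]

theorem card_remaining_state (h : I.Describes G r) (hG : IsChordal G) {t : ℕ} (ht : t ≤ I.n) :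
    (I.remaining (I.state t)).card = I.n - t := by
  induction t with
  | zero => simp [remaining, initState]
  | succ t ih =>
    have h1 := ih (by omega)
    have hp := pivotSpec_of_nonempty h hG (bounds_state h.valid t).el_le
      (Finset.card_pos.1 (by omega))
    rw [state_succ, remaining_next hp, Finset.card_erase_of_mem (mem_remaining.2 hp.el_eq), h1]
    omega

theorem pivotSpec_state (h : I.Describes G r) (hG : IsChordal G) {t : ℕ} (ht : t < I.n) :
    PivotSpec I G (I.state t) :=
  pivotSpec_of_nonempty h hG (bounds_state h.valid t).el_le
    (Finset.card_pos.1 (by rw [card_remaining_state h hG ht.le]; omega))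

theorem later_eq (h : I.Describes G r) (hel : ∀ u, s.el u ≤ 1) (hp : PivotSpec I G s)
    (u : Fin I.n) : I.later s u = 1 ↔ u ∈ I.remaining s ∧ G.Adj ⟨I.pivot s, hp.lt⟩ u := by
  have h1 := h.adj_eq ⟨I.pivot s, hp.lt⟩ u
  have h2 := hel u
  simp only at h1
  rw [later, h1, mem_remaining]
  split_ifs with h3
  · simp only [h3, and_true]; omega
  · simp [h3]

/-! ### The ratios of guesses to colors -/

/-- The invariant of a remaining vertex is `G / H * (N / M) ≤ num / den`. Being a later neighbor
multiplies `G / H` by `(M - guess) / M`, and `N / M` by the inverse or, at a failure, by `0`. The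
vertex's own elimination multiplies `G / H` by `guess / M ≤ N / M`, which leaves `G / H ≤ num / den`
from then on. Rounding down and resetting to `0` only decrease the left side, so exactness is not
needed. -/
theorem ratio_state (h : I.Describes G r) (hG : IsChordal G) {t : ℕ} (ht : t ≤ I.n) {u : ℕ}
    (hu : u < I.n) :
    ((I.state t).el u = 0 → (I.state t).G u * (I.state t).N u * I.den u ≤
      I.num u * (I.state t).H u * (I.state t).M) ∧
    ((I.state t).el u ≠ 0 → (I.state t).G u * I.den u ≤ I.num u * (I.state t).H u) := by
  have hI := h.valid
  induction t with
  | zero =>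
    simp only [state_zero, initState, mix_of_lt hu]
    refine ⟨fun _ => ?_, fun h => absurd rfl h⟩
    simp only [Pi.one_apply, one_mul, mul_one]
    rw [mul_assoc, Nat.div_mul_cancel (den_dvd hu)]
  | succ t ih =>
    obtain ⟨ih1, ih2⟩ := ih (by omega)
    have hp := pivotSpec_state h hG (t := t) (by omega)
    have hb := bounds_state hI t
    rw [state_succ]
    set s := I.state t
    have hel : ∀ w, (I.next s).el w = if w = I.pivot s then 1 else s.el w := fun w => by
      simp [next, Function.update_apply]
    have hH : (I.next s).H u = s.H u * I.radix s u := by simp [next, mix_of_lt hu]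
    have hGu : (I.next s).G u = s.G u * I.count s u := by simp [next, mix_of_lt hu]
    have hN : (I.next s).N u = I.nextN s u := mix_of_lt hu _ _
    have hM : (I.next s).M = I.nextM s := rfl
    rw [hel, hH, hGu, hN, hM]
    rcases role_cases (s := s) hI hu with ⟨h1, h2, h3, -, -, h4⟩ | ⟨h1, h2, h3, -, -, h4⟩ |
      ⟨h1, h2, h3, -, -, h4⟩
    · rw [h3, h4, if_pos h1]
      refine ⟨fun h => absurd h one_ne_zero, fun _ => ?_⟩
      have h5 := ih1 (h1 ▸ hp.el_eq)
      have h6 : I.guess s ≤ s.N u := by rw [guess_eq, ← h1]; exact min_le_left _ _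
      calc s.G u * I.guess s * I.den u ≤ s.G u * s.N u * I.den u := by gcongr
        _ ≤ I.num u * s.H u * s.M := h5
        _ = I.num u * (s.H u * s.M) := by ring
    · have h0 : s.el u = 0 := by
        have := hb.el_le u
        by_contra h
        have : s.el u = 1 := by omega
        simp [later, this] at h2
      rw [h3, h4, if_neg h1]
      refine ⟨fun _ => ?_, fun h => absurd h0 h⟩
      have h5 := ih1 h0
      rcases le_or_gt s.M (s.N (I.pivot s)) with h6 | h6
      · simp [nextN, failed_eq, h6]
      · have h7 : ¬ s.M ≤ s.N (I.pivot s) := by omega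
        have h8 : I.guess s = s.N (I.pivot s) := by rw [guess_eq]; exact min_eq_left h6.le
        simp only [nextN, failed_eq, h7, if_false, h2, nextM_of_lt h6, h8]
        simp only [Nat.sub_zero, one_mul, Nat.sub_self, zero_mul, add_zero]
        calc s.G u * (s.M - s.N (I.pivot s)) * s.N u * I.den u
            = s.G u * s.N u * I.den u * (s.M - s.N (I.pivot s)) := by ring
          _ ≤ I.num u * s.H u * s.M * (s.M - s.N (I.pivot s)) := by gcongr
          _ = I.num u * (s.H u * s.M) * (s.M - s.N (I.pivot s)) := by ring
    · rw [h3, h4, if_neg h1, mul_one, mul_one]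
      refine ⟨fun h0 => ?_, ih2⟩
      have h5 := ih1 h0
      have h6 : I.nextN s u * s.M ≤ s.N u * I.nextM s := by
        have h7 : I.nextN s u ≤ s.N u * I.nextM s / s.M := by
          simp only [nextN, h2]
          have : 1 - I.failed s ≤ 1 := by omega
          calc _ ≤ 1 * (0 * s.N u + (1 - 0) * (s.N u * I.nextM s / s.M)) := by gcongr
            _ = _ := by simp
        exact (Nat.mul_le_mul_right _ h7).trans (Nat.div_mul_le_self _ _)
      refine Nat.le_of_mul_le_mul_right ?_ hb.M_pos
      calc s.G u * I.nextN s u * I.den u * s.M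
          = s.G u * I.den u * (I.nextN s u * s.M) := by ring
        _ ≤ s.G u * I.den u * (s.N u * I.nextM s) := by gcongr
        _ = s.G u * s.N u * I.den u * I.nextM s := by ring
        _ ≤ I.num u * s.H u * s.M * I.nextM s := by gcongr
        _ = I.num u * s.H u * I.nextM s * s.M := by ring

/-! ### Correctness of the decision -/

theorem denProd_eq (I : Data) : I.denProd = ∏ u : Fin I.n, I.den u :=
  Finset.prod_range I.den

/-- The values of the signed independence polynomials are integers after multiplication with the
product of the denominators. -/
theorem exists_int_eq (h : I.Describes G r) (A : Finset (Fin I.n)) :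
    ∃ k : ℤ, (I.denProd : ℝ) * indepSum G A (fun v => (r v : ℝ)) = k := by
  classical
  -- In the term of `J` the denominators of the vertices of `J` cancel against `denProd`, and the
  -- others remain as integer factors.
  refine ⟨∑ J ∈ A.powerset.filter (fun J : Finset (Fin I.n) => G.IsIndepSet (J : Set (Fin I.n))),
    (-1) ^ J.card * ((∏ v ∈ J, (I.num v : ℤ)) * ∏ v ∈ Jᶜ, (I.den v : ℤ)), ?_⟩
  push_cast
  rw [indepSum, Finset.mul_sum]
  refine Finset.sum_congr (by ext; simp) fun J _ => ?_
  have hden : (I.denProd : ℝ) = (∏ v ∈ J, (I.den v : ℝ)) * ∏ v ∈ Jᶜ, (I.den v : ℝ) := by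
    rw [Finset.prod_mul_prod_compl, denProd_eq]; push_cast; rfl
  have hr : ∀ v : Fin I.n, (I.den v : ℝ) * (r v : ℝ) = I.num v := by
    intro v
    have h1 : (0 : ℝ) < I.den v := by exact_mod_cast h.valid.den_pos v v.2
    rw [h.cast_eq v]
    field_simp
  rw [indepTerm, hden]
  calc _ = (-1) ^ J.card * (((∏ v ∈ J, (I.den v : ℝ)) * ∏ v ∈ J, (r v : ℝ)) *
        ∏ v ∈ Jᶜ, (I.den v : ℝ)) := by ring
    _ = _ := by rw [← Finset.prod_mul_distrib, Finset.prod_congr rfl fun v _ => hr v]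

/-- As long as there was no failure, `s` represents the weights `cur` of the remaining vertices. -/
structure Exact (I : Data) (G : SimpleGraph (Fin I.n)) (r cur : Fin I.n → ℝ) (s : State) :
    Prop where
  nonneg : 0 ≤ cur
  N_eq : ∀ u ∈ I.remaining s, (s.N u : ℝ) = s.M * cur u
  M_eq : (s.M : ℝ) = I.denProd * indepSum G (I.remaining s)ᶜ r
  -- With `A = {u}` and `M_eq`, this writes `M * cur u` as a difference of two of the integers in
  -- `exists_int_eq`.
  factor : ∀ A ⊆ I.remaining s,
    indepSum G ((I.remaining s)ᶜ ∪ A) r = indepSum G (I.remaining s)ᶜ r * indepSum G A cur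
  pos_iff : PositiveBelow G Finset.univ r ↔ PositiveBelow G (I.remaining s) cur

theorem indepSum_singleton {V : Type*} [DecidableEq V] (G : SimpleGraph V) (v : V) (x : V → ℝ) :
    indepSum G {v} x = 1 - x v := by
  rw [← insert_empty_eq, indepSum_insert (Finset.notMem_empty v)]
  simp

theorem exact_init (h : I.Describes G r) :
    Exact I G (fun v => (r v : ℝ)) (fun v => (r v : ℝ)) I.initState := by
  have hrem : I.remaining I.initState = Finset.univ := by simp [remaining, initState]
  refine ⟨fun v => NNRat.cast_nonneg _, fun u _ => ?_, ?_, fun A _ => ?_, by rw [hrem]⟩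
  · simp only [initState, mix_of_lt u.2, Nat.cast_mul]
    rw [Nat.cast_div (den_dvd u.2) (by exact_mod_cast (h.valid.den_pos u u.2).ne')]
    rw [h.cast_eq u]
    ring
  · rw [hrem]
    simp [initState]
  · simp [hrem]

theorem exact_next (h : I.Describes G r) {cur : Fin I.n → ℝ} (hM : 0 < s.M)
    (hel : ∀ u, s.el u ≤ 1) (hp : PivotSpec I G s) (hf : s.N (I.pivot s) < s.M)
    (he : Exact I G (fun v => (r v : ℝ)) cur s) :
    Exact I G (fun v => (r v : ℝ)) (eliminate G ⟨I.pivot s, hp.lt⟩ cur) (I.next s) := by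
  set x : Fin I.n → ℝ := fun v => (r v : ℝ) with hx
  set v : Fin I.n := ⟨I.pivot s, hp.lt⟩ with hv
  have hvR : v ∈ I.remaining s := mem_remaining.2 hp.el_eq
  set R := I.remaining s with hR
  have hR' : I.remaining (I.next s) = R.erase v := remaining_next hp
  have hMR : (0 : ℝ) < s.M := by exact_mod_cast hM
  have hNv : (s.N (I.pivot s) : ℝ) = s.M * cur v := he.N_eq v hvR
  have hcv : cur v < 1 := by
    have h1 : (s.N (I.pivot s) : ℝ) < s.M := by exact_mod_cast hf
    rw [hNv] at h1
    by_contra h2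
    nlinarith
  have hpos : 0 < 1 - cur v := by linarith
  have hM' : ((I.next s).M : ℝ) = s.M * (1 - cur v) := by
    have : (I.next s).M = s.M - s.N (I.pivot s) := nextM_of_lt hf
    rw [this, Nat.cast_sub hf.le, hNv]
    ring
  have hcompl : (R.erase v)ᶜ = Rᶜ ∪ {v} := by
    ext u
    simp only [Finset.mem_compl, Finset.mem_erase, Finset.mem_union, Finset.mem_singleton]
    tauto
  have hE : indepSum G (R.erase v)ᶜ x = indepSum G Rᶜ x * (1 - cur v) := by
    rw [hcompl, he.factor {v} (by simpa using hvR), indepSum_singleton]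
  have hsub : ∀ A ⊆ R.erase v, v ∉ A := fun A hA hvA => (Finset.mem_erase.1 (hA hvA)).1 rfl
  have hfactor : ∀ A ⊆ R.erase v, indepSum G ((R.erase v)ᶜ ∪ A) x =
      indepSum G (R.erase v)ᶜ x * indepSum G A (eliminate G v cur) := by
    intro A hA
    have hAR : A ⊆ R := hA.trans (Finset.erase_subset _ _)
    have h1 : (R.erase v)ᶜ ∪ A = Rᶜ ∪ insert v A := by
      rw [hcompl, Finset.union_assoc, Finset.insert_eq]
    rw [h1, he.factor _ (Finset.insert_subset hvR hAR),
      indepSum_insert_of_simplicial (hsub A hA)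
        (fun a ha b hb => hp.simplicial a (hAR ha) b (hAR hb)) hcv.ne, hE]
    ring
  have hMe : ((I.next s).M : ℝ) = I.denProd * indepSum G (R.erase v)ᶜ x := by
    rw [hM', hE, he.M_eq]; ring
  refine ⟨eliminate_nonneg he.nonneg hcv, ?_, by rw [hR']; exact hMe, by rw [hR']; exact hfactor,
    ?_⟩
  · rw [hR']
    intro u hu
    have huR : u ∈ R := Finset.mem_of_mem_erase hu
    have hN : (I.next s).N u = I.nextN s u := mix_of_lt u.2 _ _
    have hf' : ¬ s.M ≤ s.N (I.pivot s) := by omega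
    rw [hN]
    simp only [nextN, failed_eq, hf', if_false, Nat.sub_zero, one_mul]
    by_cases hadj : G.Adj v u
    · have h1 : I.later s u = 1 := (later_eq h hel hp u).2 ⟨huR, hadj⟩
      rw [h1, hM']
      simp only [one_mul, Nat.sub_self, zero_mul, add_zero, eliminate, hadj, if_true]
      rw [he.N_eq u huR]
      field_simp
    · have h1 : I.later s u = 0 := by
        have h2 := later_le (s := s) h.valid u.2
        have h3 : I.later s u ≠ 1 := fun h3 => hadj ((later_eq h hel hp u).1 h3).2
        omega
      rw [h1]
      simp only [zero_mul, zero_add, Nat.sub_zero, one_mul]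
      -- The exact new numerator of `u` is the integer `k1 - k2`, hence the division by `s.M` leaves
      -- no remainder.
      obtain ⟨k1, hk1⟩ := exists_int_eq h (R.erase v)ᶜ
      obtain ⟨k2, hk2⟩ := exists_int_eq h ((R.erase v)ᶜ ∪ {u})
      rw [hfactor {u} (by simpa using hu), indepSum_singleton] at hk2
      have hk : ((I.next s).M : ℝ) * eliminate G v cur u = ((k1 - k2 : ℤ) : ℝ) := by
        push_cast
        rw [← hk1, ← hk2, hMe]
        ring
      have hcu : eliminate G v cur u = cur u := by simp [eliminate, hadj]
      have hk0 : 0 ≤ k1 - k2 := by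
        have : (0 : ℝ) ≤ ((k1 - k2 : ℤ) : ℝ) := by
          rw [← hk]
          exact mul_nonneg (Nat.cast_nonneg _) (eliminate_nonneg he.nonneg hcv u)
        exact_mod_cast this
      obtain ⟨m, hm⟩ := Int.eq_ofNat_of_zero_le hk0
      rw [hm] at hk
      have hdiv : s.N u * I.nextM s = m * s.M := by
        have : (s.N u : ℝ) * (I.next s).M = m * s.M := by
          rw [he.N_eq u huR]
          rw [hcu] at hk
          have h5 : ((I.next s).M : ℝ) * cur u = (m : ℝ) := by exact_mod_cast hk
          rw [← h5]; ring
        exact_mod_cast this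
      rw [hdiv, Nat.mul_div_cancel _ hM, hk]
      simp
  · have h1 := positiveBelow_insert_iff (Finset.notMem_erase v R)
      (fun a ha b hb => hp.simplicial a (Finset.mem_of_mem_erase ha) b
        (Finset.mem_of_mem_erase hb)) he.nonneg
    rw [Finset.insert_erase hvR] at h1
    rw [hR', he.pos_iff, h1]
    simp [hcv]

/-- Exact weights are needed only up to the first failure, which refutes positivity for good; the
later values do not matter for the decision. -/
theorem decision_state (h : I.Describes G r) (hG : IsChordal G) {t : ℕ} (ht : t ≤ I.n) :
    ((I.state t).fl = 0 → ∃ cur, Exact I G (fun v => (r v : ℝ)) cur (I.state t)) ∧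
    ((I.state t).fl ≠ 0 → ¬ PositiveBelow G Finset.univ (fun v => (r v : ℝ))) := by
  induction t with
  | zero => exact ⟨fun _ => ⟨_, exact_init h⟩, fun h => absurd rfl h⟩
  | succ t ih =>
    obtain ⟨ih1, ih2⟩ := ih (by omega)
    have hp := pivotSpec_state h hG (t := t) (by omega)
    have hb := bounds_state h.valid t
    rw [state_succ]
    set s := I.state t
    have hfl : (I.next s).fl = s.fl + I.failed s := rfl
    by_cases h0 : s.fl = 0
    · obtain ⟨cur, hc⟩ := ih1 h0
      rcases le_or_gt s.M (s.N (I.pivot s)) with h1 | h1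
      · refine ⟨fun h2 => ?_, fun _ => ?_⟩
        · rw [hfl, failed_eq, if_pos h1] at h2
          omega
        · have hvR : (⟨I.pivot s, hp.lt⟩ : Fin I.n) ∈ I.remaining s := mem_remaining.2 hp.el_eq
          rw [hc.pos_iff, ← Finset.insert_erase hvR,
            positiveBelow_insert_iff (Finset.notMem_erase _ _)
              (fun a ha b hb => hp.simplicial a (Finset.mem_of_mem_erase ha) b
                (Finset.mem_of_mem_erase hb)) hc.nonneg]
          rintro ⟨h2, -⟩
          have h3 := hc.N_eq _ hvR
          have h4 : (s.M : ℝ) ≤ s.N (I.pivot s) := by exact_mod_cast h1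
          have h5 : (0 : ℝ) < s.M := by exact_mod_cast hb.M_pos
          simp only at h3
          nlinarith
      · refine ⟨fun _ => ⟨_, exact_next h hb.M_pos hb.el_le hp h1 hc⟩, fun h2 => ?_⟩
        rw [hfl, failed_eq, if_neg (by omega)] at h2
        omega
    · exact ⟨fun h1 => absurd h1 (by rw [hfl]; omega), fun _ => ih2 h0⟩

theorem fl_eq_zero_iff (h : I.Describes G r) (hG : IsChordal G) :
    (I.state I.n).fl = 0 ↔ (fun v => (r v : ℝ)) ∈ region G := by
  have hreg : (fun v => (r v : ℝ)) ∈ region G ↔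
      PositiveBelow G Finset.univ (fun v => (r v : ℝ)) := by
    simp only [region, PositiveBelow, indepSum_univ, Set.mem_ofPred_eq, and_iff_right_iff_imp]
    exact fun _ v => NNRat.cast_nonneg _
  rw [hreg]
  obtain ⟨h1, h2⟩ := decision_state h hG (t := I.n) le_rfl
  refine ⟨fun h0 => ?_, fun hpos => by_contra fun h0 => h2 h0 hpos⟩
  obtain ⟨cur, hc⟩ := h1 h0
  have hempty : I.remaining (I.state I.n) = ∅ := by
    rw [← Finset.card_eq_zero, card_remaining_state h hG le_rfl, Nat.sub_self]
  rw [hc.pos_iff, hempty]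
  intro w _ _
  simp

end Data

end HatGame

namespace HatGame

/-! ### Counting digits -/

/-- The remainder `a % H` and the quotient `a / H` range independently. -/
theorem card_filter_range_mul (H b : ℕ) (P Q : ℕ → Prop) [DecidablePred P] [DecidablePred Q] :
    ((Finset.range (H * b)).filter fun a => P (a % H) ∧ Q (a / H)).card =
      ((Finset.range H).filter P).card * ((Finset.range b).filter Q).card := by
  rw [← Finset.card_product]
  rcases Nat.eq_zero_or_pos H with rfl | hH
  · simp
  refine Finset.card_nbij' (fun a => (a % H, a / H)) (fun p => p.1 + H * p.2) ?_ ?_ ?_ ?_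
  · intro a ha
    simp only [Finset.coe_filter, Finset.mem_range, Set.mem_ofPred_eq] at ha
    simp only [Finset.coe_product, Finset.coe_filter, Finset.mem_range, Set.mem_prod,
      Set.mem_ofPred_eq]
    exact ⟨⟨Nat.mod_lt _ hH, ha.2.1⟩, Nat.div_lt_of_lt_mul ha.1, ha.2.2⟩
  · rintro ⟨c, d⟩ h
    simp only [Finset.coe_product, Finset.coe_filter, Finset.mem_range, Set.mem_prod,
      Set.mem_ofPred_eq] at h
    obtain ⟨⟨hc, hP⟩, hd, hQ⟩ := h
    simp only [Finset.coe_filter, Finset.mem_range, Set.mem_ofPred_eq]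
    rw [Nat.add_mul_mod_self_left, Nat.mod_eq_of_lt hc, Nat.add_mul_div_left _ _ hH,
      Nat.div_eq_of_lt hc, Nat.zero_add]
    refine ⟨?_, hP, hQ⟩
    calc c + H * d < H * (d + 1) := by rw [mul_add]; omega
      _ ≤ H * b := Nat.mul_le_mul_left _ hd
  · intro a _
    exact Nat.mod_add_div a H
  · rintro ⟨c, d⟩ h
    simp only [Finset.coe_product, Finset.coe_filter, Finset.mem_range, Set.mem_prod,
      Set.mem_ofPred_eq] at h
    simp only [Prod.mk.injEq]
    rw [Nat.add_mul_mod_self_left, Nat.mod_eq_of_lt h.1.1, Nat.add_mul_div_left _ _ hH,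
      Nat.div_eq_of_lt h.1.1, Nat.zero_add]
    exact ⟨rfl, rfl⟩

/-- Adding `k` permutes the residues modulo `M`. -/
theorem card_filter_shift {M lo hi : ℕ} (hM : hi ≤ M) (k : ℕ) :
    ((Finset.range M).filter fun d => lo ≤ (k + d) % M ∧ (k + d) % M < hi).card = hi - lo := by
  set f : ℕ → ℕ := fun d => (k + d) % M with hf
  have hinj : Set.InjOn f (Finset.range M) := by
    intro a ha b hb hab
    simp only [Finset.coe_range, Set.mem_Iio] at ha hb
    have : k + a ≡ k + b [MOD M] := hab
    have := Nat.ModEq.add_left_cancel' k this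
    exact Nat.ModEq.eq_of_lt_of_lt this ha hb
  have himg : (Finset.range M).image f = Finset.range M := by
    refine Finset.eq_of_subset_of_card_le ?_ (by rw [Finset.card_image_of_injOn hinj])
    intro b hb
    obtain ⟨a, ha, rfl⟩ := Finset.mem_image.1 hb
    rw [Finset.mem_range] at ha ⊢
    exact Nat.mod_lt _ (by omega)
  have h1 : ((Finset.range M).filter fun d => lo ≤ f d ∧ f d < hi).image f = Finset.Ico lo hi := by
    rw [← Finset.filter_image (p := fun e => lo ≤ e ∧ e < hi), himg]
    ext e
    simp only [Finset.mem_filter, Finset.mem_range, Finset.mem_Ico]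
    omega
  rw [← Nat.card_Ico, ← h1, Finset.card_image_of_injOn]
  exact hinj.mono (Finset.coe_subset.2 (Finset.filter_subset _ _))

namespace Data

/-! ### The strategy -/

/-- The digit of the color `c` of `u` that belongs to elimination `t`. -/
def digit (I : Data) (t u c : ℕ) : ℕ := c / (I.state t).H u % I.radix (I.state t) u

/-- The sum of the digits that belong to elimination `t`. -/
def digitSum (I : Data) (t : ℕ) (x : ℕ → ℕ) : ℕ :=
  (∑ u ∈ Finset.range I.n, I.digit t u (x u)) % (I.state t).M

/-- The bear on `v` guesses his color in the arrangement `x`. -/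
def Guesses (I : Data) (v : ℕ) (x : ℕ → ℕ) : Prop :=
  ∀ t < I.n, I.lo (I.state t) v ≤ I.digitSum t x ∧ I.digitSum t x < I.hi (I.state t) v

variable {I : Data} {G : SimpleGraph (Fin I.n)} {r : Fin I.n → ℚ≥0}

theorem H_succ (I : Data) (t : ℕ) {u : ℕ} (hu : u < I.n) :
    (I.state (t + 1)).H u = (I.state t).H u * I.radix (I.state t) u := by
  rw [state_succ]; simp [next, mix_of_lt hu]

theorem G_succ (I : Data) (t : ℕ) {u : ℕ} (hu : u < I.n) :
    (I.state (t + 1)).G u = (I.state t).G u * I.count (I.state t) u := by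
  rw [state_succ]; simp [next, mix_of_lt hu]

theorem H_dvd {u : ℕ} (hu : u < I.n) {t t' : ℕ} (h : t ≤ t') :
    (I.state t).H u ∣ (I.state t').H u := by
  induction t', h using Nat.le_induction with
  | base => exact dvd_rfl
  | succ t' _ ih => rw [H_succ I t' hu]; exact ih.mul_right _

/-- Digit `t` depends only on the color modulo `H` at time `t + 1`, and that number divides every
later `H`. -/
theorem digit_mod {u : ℕ} (hu : u < I.n) {t t' : ℕ} (h : t < t') (c : ℕ) :
    I.digit t u (c % (I.state t').H u) = I.digit t u c := by
  obtain ⟨m, hm⟩ := H_dvd hu (Nat.succ_le_of_lt h)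
  rw [Nat.succ_eq_add_one, H_succ I t hu] at hm
  rw [digit, digit, hm, mul_assoc, Nat.mod_mul_right_div_self]
  exact Nat.mod_mod_of_dvd _ (dvd_mul_right _ _)

/-- Here `k t` stands for the fixed contribution of the other bears to the digit sum. Conditions for
different `t` concern different digits, so the counts multiply, and each shifted interval contains
`count` digits whatever `k t` is. This is why the number of guesses does not depend on the view. -/
theorem card_digits (hI : I.Valid) {v : ℕ} (hv : v < I.n) (k : ℕ → ℕ) (t : ℕ) :
    ((Finset.range ((I.state t).H v)).filter fun a => ∀ t' < t,
      I.lo (I.state t') v ≤ (k t' + I.digit t' v a) % (I.state t').M ∧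
      (k t' + I.digit t' v a) % (I.state t').M < I.hi (I.state t') v).card = (I.state t).G v := by
  induction t with
  | zero => simp [initState, mix_of_lt hv]
  | succ t ih =>
    have hH := (bounds_state hI t).H_pos v hv
    have hM := (bounds_state hI t).M_pos
    rw [H_succ I t hv, G_succ I t hv, ← ih]
    set s := I.state t with hs
    have hc : ((Finset.range (I.radix s v)).filter fun d =>
        I.lo s v ≤ (k t + d) % s.M ∧ (k t + d) % s.M < I.hi s v).card = I.count s v := by
      rcases role_cases (s := s) hI hv with ⟨-, -, h3, h4, h5, h6⟩ | ⟨-, -, h3, h4, h5, h6⟩ |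
        ⟨-, -, h3, h4, h5, h6⟩
      · rw [h3, h4, h5, h6, card_filter_shift guess_le, Nat.sub_zero]
      · rw [h3, h4, h5, h6, card_filter_shift le_rfl]
      · rw [h3, h4, h5, h6]
        simp [Nat.mod_lt _ hM]
    rw [← hc, ← card_filter_range_mul]
    congr 1
    refine Finset.filter_congr fun a ha => ?_
    rw [Finset.mem_range] at ha
    have hdig : I.digit t v a = a / s.H v := by
      rw [digit, ← hs]
      exact Nat.mod_eq_of_lt (Nat.div_lt_of_lt_mul ha)
    constructor
    · intro h
      refine ⟨fun t' ht' => ?_, ?_⟩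
      · rw [hs, digit_mod hv ht']
        exact h t' (by omega)
      · rw [← hdig]
        exact h t (by omega)
    · rintro ⟨h1, h2⟩ t' ht'
      rcases Nat.lt_succ_iff_lt_or_eq.1 ht' with h | rfl
      · have := h1 t' h
        rwa [hs, digit_mod hv h] at this
      · rw [hdig]
        exact h2

/-- A digit of radix `1` is always `0`. -/
theorem digitSum_congr {t : ℕ} {x y : ℕ → ℕ}
    (h : ∀ u < I.n, I.radix (I.state t) u ≠ 1 → x u = y u) : I.digitSum t x = I.digitSum t y := by
  rw [digitSum, digitSum, Finset.sum_congr rfl fun u hu => ?_]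
  by_cases h1 : I.radix (I.state t) u = 1
  · simp [digit, h1, Nat.mod_one]
  · rw [h u (Finset.mem_range.1 hu) h1]

open Classical in
/-- The colors seen by the bear on `v`, together with the color `a` of `v` itself. -/
noncomputable def viewColors {n : ℕ} {G : SimpleGraph (Fin n)} {h : Fin n → ℕ} (v : Fin n)
    (c : View G h v) (a : ℕ) : ℕ → ℕ := fun u =>
  if u = v then a
  else if hu : u < n then if hv : G.Adj v ⟨u, hu⟩ then (c ⟨⟨u, hu⟩, hv⟩ : ℕ) else 0 else 0

theorem card_guesses (hI : I.Valid) {h : Fin I.n → ℕ} (hh : ∀ v : Fin I.n, h v = (I.state I.n).H v)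
    (v : Fin I.n) (c : View G h v)
    [DecidablePred fun a : Fin (h v) => I.Guesses v (viewColors v c a)] :
    ((Finset.univ : Finset (Fin (h v))).filter
      fun a : Fin (h v) => I.Guesses v (viewColors v c a)).card =
      (I.state I.n).G v := by
  classical
  set k : ℕ → ℕ := fun t =>
    ∑ u ∈ (Finset.range I.n).erase (v : ℕ), I.digit t u (viewColors v c 0 u) with hk
  rw [← card_digits hI v.2 k, ← hh v,
    ← Finset.card_image_of_injective _ (Fin.val_injective (n := h v))]
  congr 1
  have hsum : ∀ (a t : ℕ), I.digitSum t (viewColors v c a) =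
      (k t + I.digit t v a) % (I.state t).M := by
    intro a t
    rw [digitSum, ← Finset.sum_erase_add _ _ (Finset.mem_range.2 v.2), hk]
    have h1 : viewColors v c a v = a := by simp [viewColors]
    rw [h1]
    congr 2
    refine Finset.sum_congr rfl fun u hu => ?_
    have : u ≠ v := (Finset.mem_erase.1 hu).1
    simp [viewColors, this]
  ext a
  simp only [Finset.mem_image, Finset.mem_filter, Finset.mem_univ, true_and, Finset.mem_range,
    Guesses, hsum]
  constructor
  · rintro ⟨b, hb, rfl⟩
    exact ⟨b.2, hb⟩
  · rintro ⟨ha, hb⟩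
    exact ⟨⟨a, ha⟩, hb, rfl⟩

open Classical in
/-- The strategy given by the eliminations. -/
noncomputable def strategy (hI : I.Valid) (G : SimpleGraph (Fin I.n)) :
    Strategy G (fun v => (I.state I.n).H v) (fun v => (I.state I.n).G v) := fun v c =>
  ⟨Finset.univ.filter fun a : Fin _ => I.Guesses v (viewColors v c a), card_guesses hI (fun _ => rfl) v c⟩

theorem el_mono {u t t' : ℕ} (h : t ≤ t') (hu : (I.state t).el u = 1) :
    (I.state t').el u = 1 := by
  induction t', h using Nat.le_induction with
  | base => exact hu
  | succ t' _ ih =>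
    rw [state_succ]
    simp only [next, Function.update_apply]
    split_ifs
    · rfl
    · exact ih

theorem el_pivot {t t' : ℕ} (h : t < t') : (I.state t').el (I.pivot (I.state t)) = 1 :=
  el_mono (Nat.succ_le_of_lt h) (by rw [Nat.succ_eq_add_one, state_succ]; simp [next])

/-- Nontrivial digits occur only at the pivot and its later neighbors, a clique because the pivot is
simplicial. Hence a bear with a nontrivial digit sees every other hat that enters the sum. -/
theorem adj_of_radix (h : I.Describes G r) {s : State} (hel : ∀ u, s.el u ≤ 1)
    (hp : PivotSpec I G s) {u v : Fin I.n} (huv : u ≠ v) (hu : I.radix s u ≠ 1)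
    (hv : I.radix s v ≠ 1) : G.Adj v u := by
  have key : ∀ w : Fin I.n, I.radix s w ≠ 1 →
      w = ⟨I.pivot s, hp.lt⟩ ∨ (w ∈ I.remaining s ∧ G.Adj ⟨I.pivot s, hp.lt⟩ w) := by
    intro w hw
    rcases role_cases (s := s) h.valid w.2 with h1 | h1 | h1
    · exact Or.inl (Fin.ext h1.1)
    · exact Or.inr ((later_eq h hel hp w).1 h1.2.1)
    · exact absurd h1.2.2.1 hw
  rcases key u hu with h1 | h1 <;> rcases key v hv with h2 | h2
  · exact absurd (h1.trans h2.symm) huv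
  · rw [h1]; exact h2.2.symm
  · rw [h2]; exact h1.2
  · exact hp.simplicial v h2.1 u h1.1 h2.2 h1.2 huv.symm

theorem exists_failed {t : ℕ} (h : (I.state t).fl ≠ 0) : ∃ t' < t, I.failed (I.state t') ≠ 0 := by
  induction t with
  | zero => exact absurd rfl h
  | succ t ih =>
    by_cases h0 : I.failed (I.state t) = 0
    · rw [state_succ] at h
      have h1 : (I.state t).fl ≠ 0 := by simpa [next, h0] using h
      obtain ⟨t', ht', hf⟩ := ih h1
      exact ⟨t', by omega, hf⟩
    · exact ⟨t, by omega, h0⟩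

theorem strategy_isWinning (h : I.Describes G r) (hG : IsChordal G)
    (hfl : (I.state I.n).fl ≠ 0) : (strategy h.valid G).IsWinning := by
  classical
  intro φ
  set y : ℕ → ℕ := fun u => if hu : u < I.n then (φ ⟨u, hu⟩ : ℕ) else 0 with hy
  have hlt : ∀ t x, I.digitSum t x < (I.state t).M := fun t x =>
    Nat.mod_lt _ (bounds_state h.valid t).M_pos
  -- At a failure the guess is all of `M`, which exceeds every residue.
  have hex : ∃ t, t < I.n ∧ I.digitSum t y < I.guess (I.state t) := by
    obtain ⟨t, ht, hf⟩ := exists_failed hfl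
    refine ⟨t, ht, ?_⟩
    have h1 : (I.state t).M ≤ (I.state t).N (I.pivot (I.state t)) := by
      rw [failed_eq] at hf
      by_contra h1
      simp [h1] at hf
    rw [guess_eq, min_eq_right h1]
    exact hlt t y
  -- The winner is the pivot of the first elimination whose digit sum is below its guess.
  obtain ⟨htn, htg⟩ := Nat.find_spec hex
  have hmin : ∀ t' < Nat.find hex, I.guess (I.state t') ≤ I.digitSum t' y := by
    intro t' ht'
    have := Nat.find_min hex ht'
    by_contra h1
    exact this ⟨by omega, by omega⟩
  set t := Nat.find hex
  have hp := pivotSpec_state h hG htn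
  refine ⟨⟨I.pivot (I.state t), hp.lt⟩, ?_⟩
  set v : Fin I.n := ⟨I.pivot (I.state t), hp.lt⟩ with hv
  simp only [strategy, Finset.mem_filter, Finset.mem_univ, true_and]
  intro t' ht'
  have hp' := pivotSpec_state h hG ht'
  have hb' := bounds_state h.valid t'
  set x := viewColors (h := fun v => (I.state I.n).H v) v (fun u : G.neighborSet v => φ u) (φ v)
    with hx
  have hsum : I.radix (I.state t') v ≠ 1 → I.digitSum t' x = I.digitSum t' y := by
    intro hr
    refine digitSum_congr fun u hu hru => ?_
    simp only [hx, hy, viewColors, hu, dif_pos]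
    by_cases huv : u = v
    · have h0 : (⟨u, hu⟩ : Fin I.n) = v := Fin.ext huv
      rw [if_pos huv]
      exact congrArg (fun w => (φ w : ℕ)) h0.symm
    · have hadj : G.Adj v ⟨u, hu⟩ :=
        adj_of_radix h hb'.el_le hp' (fun h => huv (congrArg Fin.val h)) hru hr
      simp [huv, hadj]
  rcases role_cases (s := I.state t') h.valid v.2 with
    ⟨h1, -, h3, h4, h5, -⟩ | ⟨h1, h2, h3, h4, h5, -⟩ | ⟨-, -, -, h4, h5, -⟩
  -- A vertex is the pivot only once.
  · have htt : t' = t := by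
      rcases lt_trichotomy t t' with h6 | h6 | h6
      · have h7 : (I.state t').el v = 1 := el_pivot h6
        rw [h1, hp'.el_eq] at h7
        omega
      · exact h6.symm
      · have h7 := el_pivot (I := I) h6
        rw [← h1, hv] at h7
        simp only [hp.el_eq] at h7
        omega
    rw [h4, h5]
    refine ⟨Nat.zero_le _, ?_⟩
    -- If `M = 1`, the bear need not see the others: the digit sum is `0` for all hats.
    by_cases hr : I.radix (I.state t') v = 1
    · have h6 : (I.state t').M = 1 := h3.symm.trans hr
      have h7 := hlt t' x
      have h8 : 0 < I.guess (I.state t) := by omega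
      rw [htt] at h7 h6 ⊢
      omega
    · rw [hsum hr, htt]
      exact htg
  -- The pivot of `t` is eliminated from time `t + 1` on, so it is a later neighbor only before `t`,
  -- where minimality puts the digit sum at or above the guess.
  · have htt : t' < t := by
      rcases lt_trichotomy t t' with h6 | h6 | h6
      · have h7 : (I.state t').el v = 1 := el_pivot h6
        simp [later, h7] at h2
      · rw [← h6] at h1
        exact absurd rfl h1
      · exact h6
    rw [h4, h5]
    refine ⟨?_, hlt t' x⟩
    by_cases hr : I.radix (I.state t') v = 1
    · have h6 : (I.state t').M = 1 := h3.symm.trans hr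
      have h7 := hlt t' y
      have h8 := hmin t' htt
      omega
    · rw [hsum hr]
      exact hmin t' htt
  · rw [h4, h5]
    exact ⟨Nat.zero_le _, hlt t' x⟩

end Data

end HatGame

namespace HatGame

namespace Cmd

variable {B N : ℕ} {Q : Mem → Prop} {s : Mem}

theorem wp_times_of {c : ℕ} {e : Expr} {p : Cmd} (hc : c ∉ p.writes) (I : ℕ → Mem → Prop) {n : ℕ}
    (hn : e.eval s = n) (hN : n ≤ N)
    (hI : ∀ k s s', (∀ A, A ≠ c → s' A = s A) → I k s → I k s')
    (h0 : I 0 s)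
    (hstep : ∀ k < n, ∀ s', (∀ A, A ∉ (times c e p).writes → s' A = s A) → s' c 0 = k → I k s' →
      Wp B N p (I (k + 1)) s')
    (hQ : ∀ s', (∀ A, A ∉ (times c e p).writes → s' A = s A) → I n s' → Q s') :
    Wp B N (times c e p) Q s :=
  (wp_times hc I hn hN hI h0 hstep).mono hQ

end Cmd

open Cmd

/-! ### The decision program -/

/-- The problem stored in an array. -/
def Data.ofArray (x : ℕ → ℕ) : Data where
  n := x 1
  adj u v := x (2 + u * x 1 + v)
  num u := x (2 + x 1 * x 1 + u)
  den u := x (2 + x 1 * x 1 + x 1 + u)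

namespace Decide

/-! The arrays: `0` input, `1` output, `2` to `7` the fields of the state, `8` obstructions,
`9` pivot, `10` guess, `11` failed, `12` the next `M`, `13` to `15` loop counters, `16` to `20` the
description of the strategy. -/

def cell (A : ℕ) : Expr := .read A 0
def nE : Expr := .read 0 1
def adjE (u v : Expr) : Expr := .read 0 (2 + u * nE + v)
def numE (u : Expr) : Expr := .read 0 (2 + nE * nE + u)
def denE (u : Expr) : Expr := .read 0 (2 + nE * nE + nE + u)

def initCmd : Cmd :=
  .write 2 0 1 >>
  .times 13 nE (.write 2 0 (cell 2 * denE (cell 13))) >>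
  .times 13 nE
    (.write 3 (cell 13) (numE (cell 13) * (cell 2 / denE (cell 13))) >>
      .write 4 (cell 13) 1 >> .write 5 (cell 13) 1)

def obstructionE (v x y : Expr) : Expr :=
  adjE v x * adjE v y * (1 - .read 6 x) * (1 - .read 6 y) * ((x - y) + (y - x)) * (1 - adjE x y)

def obstructionsCmd : Cmd :=
  .write 8 0 0 >>
  .times 15 (nE * nE)
    (.write 8 0 (cell 8 + obstructionE (cell 14) (cell 15 / nE) (cell 15 % nE)))

def pivotCmd : Cmd :=
  .write 9 0 0 >>
  .times 14 nE
    (obstructionsCmd >> .cond (cell 8 + .read 6 (cell 14)) .skip (.write 9 0 (cell 14)))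

def isPivotE : Expr := 1 - ((cell 14 - cell 9) + (cell 9 - cell 14))
def laterE : Expr := (1 - .read 6 (cell 14)) * adjE (cell 9) (cell 14)
def radixE : Expr := (isPivotE + laterE) * cell 2 + (1 - (isPivotE + laterE))
def loE : Expr := laterE * cell 10
def hiE : Expr := isPivotE * cell 10 + (1 - isPivotE) * cell 2
def countE : Expr := (isPivotE + laterE) * (hiE - loE) + (1 - (isPivotE + laterE))
def nextNE : Expr :=
  (1 - cell 11) * (laterE * .read 3 (cell 14) +
    (1 - laterE) * (.read 3 (cell 14) * cell 12 / cell 2))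
def indexE : Expr := cell 13 * nE + cell 14

/-- Array `16` records the old `H`, so it is written before array `4` changes. -/
def updateCmd : Cmd :=
  .write 16 indexE (.read 4 (cell 14)) >>
  .write 17 indexE radixE >>
  .write 18 indexE loE >>
  .write 19 indexE hiE >>
  .write 20 indexE (cell 2) >>
  .write 5 (cell 14) (.read 5 (cell 14) * countE) >>
  .write 4 (cell 14) (.read 4 (cell 14) * radixE) >>
  .write 3 (cell 14) nextNE

/-- All vertices are updated from the old `M` and `el`; these are overwritten only after the loop.
-/
def eliminateCmd : Cmd :=
  .write 10 0 (.read 3 (cell 9) - (.read 3 (cell 9) - cell 2)) >>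
  .write 11 0 (1 - (cell 2 - .read 3 (cell 9))) >>
  .write 12 0 (cell 2 - cell 10 + cell 11 * cell 2) >>
  .times 14 nE updateCmd >>
  .write 2 0 (cell 12) >>
  .write 6 (cell 9) 1 >>
  .write 7 0 (cell 7 + cell 11)

def stepCmd : Cmd := pivotCmd >> eliminateCmd

/-- Cells `0` and `1` of the output array hold its length and the verdict. Hence `h` starts at cell
`2`, `g` at `2 + n`, and the table, with five entries per pair of an elimination and a vertex, at `2
+ 2 * n`. -/
def copyCmd : Cmd :=
  .times 13 nE
    (.write 1 (2 + cell 13) (.read 4 (cell 13)) >>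
      .write 1 (2 + nE + cell 13) (.read 5 (cell 13))) >>
  .times 13 (nE * nE)
    (.write 1 (2 + 2 * nE + 5 * cell 13) (.read 16 (cell 13)) >>
      .write 1 (2 + 2 * nE + 5 * cell 13 + 1) (.read 17 (cell 13)) >>
      .write 1 (2 + 2 * nE + 5 * cell 13 + 2) (.read 18 (cell 13)) >>
      .write 1 (2 + 2 * nE + 5 * cell 13 + 3) (.read 19 (cell 13)) >>
      .write 1 (2 + 2 * nE + 5 * cell 13 + 4) (.read 20 (cell 13)))

def outputCmd : Cmd :=
  .cond (cell 7)
    (.write 1 0 (1 + 2 * nE + 5 * (nE * nE)) >> .write 1 1 0 >> copyCmd)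
    (.write 1 0 1 >> .write 1 1 1)

def decideCmd : Cmd := initCmd >> .times 13 nE stepCmd >> outputCmd

theorem wellFormed_decideCmd : decideCmd.WellFormed := by
  refine ⟨?_, ?_, ?_⟩
  all_goals
    simp only [initCmd, outputCmd, copyCmd, stepCmd, pivotCmd, eliminateCmd, updateCmd,
      obstructionsCmd, WellFormed, AndThen.andThen, HAndThen.hAndThen, Cmd.writes]
    try decide

@[simp] theorem eval_cell (s : Mem) (A : ℕ) : (cell A).eval s = s A 0 := rfl
@[simp] theorem eval_nE (s : Mem) : nE.eval s = s 0 1 := rfl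

/-- The numbers that occur have at most `B` bits, and the loops make at most `N` rounds. -/
structure Fits (I : Data) (B N : ℕ) : Prop where
  sq_le : I.n * I.n ≤ N
  -- The cubic term bounds the sum of `n * n` obstructions, each at most `n`; the other terms cover
  -- the length of the output.
  cube_lt : I.n * I.n * I.n + 5 * (I.n * I.n) + 2 * I.n + 2 < 2 ^ B
  den_lt : I.denProd < 2 ^ B
  num_lt : ∀ u < I.n, I.num u * I.denProd < 2 ^ B
  pow_lt : I.denProd ^ I.n < 2 ^ B

theorem Fits.le {I : Data} {B N : ℕ} (h : Fits I B N) : I.n ≤ N :=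
  (Nat.le_mul_self I.n).trans h.sq_le

theorem Fits.lt {I : Data} {B N k : ℕ} (h : Fits I B N) (hk : k ≤ I.n + 1) : k < 2 ^ B := by
  have := h.cube_lt
  omega

variable {B N : ℕ} {x : ℕ → ℕ} {s : Mem}

local notation "𝓘" => Data.ofArray x

theorem wp_obstructionsCmd {el : ℕ → ℕ} {v : ℕ} (hI : (𝓘).Valid) (hF : Fits 𝓘 B N) (h0 : s 0 = x)
    (h6 : s 6 = el) (hv : s 14 0 = v) (hvn : v < x 1) :
    Wp B N obstructionsCmd (fun s' => s' 8 0 = (𝓘).obstructions el v) s := by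
  have hn : (𝓘).n = x 1 := rfl
  rw [obstructionsCmd, wp_seq, wp_write]
  refine ⟨by simp, ?_⟩
  refine wp_times_of (by decide) (fun k s' => s' 8 0 =
    ∑ j ∈ Finset.range k, (𝓘).obstruction el v (j / x 1) (j % x 1)) (n := x 1 * x 1)
    (by simp [Mem.set_apply, h0]) hF.sq_le (fun k s s' h h' => by rw [h 8 (by decide)]; exact h')
    (by simp) ?_ (fun s' _ h => h)
  intro k hk s' hfr hk' h8
  have h0' : s' 0 = x := by rw [hfr 0 (by decide)]; simp [Mem.set_apply, h0]
  have h6' : s' 6 = el := by rw [hfr 6 (by decide)]; simp [Mem.set_apply, h6]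
  have h14' : s' 14 0 = v := by rw [hfr 14 (by decide)]; simp [Mem.set_apply, hv]
  have hval : (cell 8 + obstructionE (cell 14) (cell 15 / nE) (cell 15 % nE)).eval s' =
      ∑ j ∈ Finset.range (k + 1), (𝓘).obstruction el v (j / x 1) (j % x 1) := by
    rw [Finset.sum_range_succ, ← h8]
    simp [obstructionE, adjE, Data.obstruction, Data.ofArray, h0', h6', h14', hk']
  rw [wp_write, hval]
  refine ⟨?_, by simp⟩
  have hx1 : 0 < x 1 := by omega
  have hb : ∀ j ∈ Finset.range (k + 1), (𝓘).obstruction el v (j / x 1) (j % x 1) ≤ x 1 := by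
    intro j hj
    have hj' : j < x 1 * x 1 := by have := Finset.mem_range.1 hj; omega
    have ha : j / x 1 < x 1 := Nat.div_lt_of_lt_mul hj'
    have hb : j % x 1 < x 1 := Nat.mod_lt _ hx1
    generalize j / x 1 = a at ha ⊢
    generalize j % x 1 = b at hb ⊢
    have h1 := hI.adj_le v hvn a ha
    have h2 := hI.adj_le v hvn b hb
    have h3 : (1 - el a) ≤ 1 := by omega
    have h4 : (1 - el b) ≤ 1 := by omega
    have h5 : (a - b) + (b - a) ≤ x 1 := by omega
    have h6 : 1 - (𝓘).adj a b ≤ 1 := by omega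
    calc (𝓘).obstruction el v a b ≤ 1 * 1 * 1 * 1 * x 1 * 1 := by
          unfold Data.obstruction; gcongr
      _ = x 1 := by ring
  have h1 := Finset.sum_le_card_nsmul _ _ _ hb
  rw [Finset.card_range, smul_eq_mul] at h1
  have h2 := hF.cube_lt
  have h3 : (k + 1) * x 1 ≤ x 1 * x 1 * x 1 := Nat.mul_le_mul_right _ hk
  rw [hn] at h2
  omega

theorem wp_pivotCmd {st : State} (hI : (𝓘).Valid) (hF : Fits 𝓘 B N) (h0 : s 0 = x)
    (h6 : s 6 = st.el) :
    Wp B N pivotCmd (fun s' => s' 9 0 = (𝓘).pivot st) s := by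
  rw [pivotCmd, wp_seq, wp_write]
  refine ⟨by simp, ?_⟩
  refine wp_times_of (by decide) (fun k s' => s' 9 0 =
    lastZero (fun v => (𝓘).obstructions st.el v + st.el v) k) (n := x 1)
    (by simp [Mem.set_apply, h0]) hF.le (fun k s s' h h' => by rw [h 9 (by decide)]; exact h')
    (by simp [lastZero]) ?_ (fun s' _ h => h)
  intro k hk s' hfr hk' h9
  have h0' : s' 0 = x := by rw [hfr 0 (by decide)]; simp [Mem.set_apply, h0]
  have h6' : s' 6 = st.el := by rw [hfr 6 (by decide)]; simp [Mem.set_apply, h6]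
  rw [wp_seq]
  refine (wp_obstructionsCmd hI hF h0' h6' hk' hk).mono fun s2 hfr2 h8 => ?_
  have h14 : s2 14 0 = k := by rw [hfr2 14 (by decide), hk']
  have h6'' : s2 6 = st.el := by rw [hfr2 6 (by decide), h6']
  have h9' : s2 9 = s' 9 := hfr2 9 (by decide)
  rw [wp_cond]
  simp only [Expr.eval_add, eval_cell, Expr.eval_read, h8, h14, h6'']
  simp only [lastZero]
  split_ifs with hz
  · rw [wp_write]
    refine ⟨?_, by simp [h14]⟩
    simp only [eval_cell, h14]
    have : (𝓘).n = x 1 := rfl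
    exact hF.lt (by omega)
  · rw [wp_skip, h9']
    exact h9

end Decide

end HatGame

/-! ### The decision program: one elimination and its table entries. -/

namespace HatGame

open Cmd

/-- The function `f` of a state and a vertex, tabulated over all eliminations. -/
def Data.table (I : Data) (f : State → ℕ → ℕ) (j : ℕ) : ℕ := f (I.state (j / I.n)) (j % I.n)

theorem Data.table_apply (I : Data) (f : State → ℕ → ℕ) (t : ℕ) {u : ℕ} (hu : u < I.n) :
    I.table f (t * I.n + u) = f (I.state t) u := by
  have hn : 0 < I.n := by omega
  rw [Data.table, Nat.add_comm, Nat.add_mul_div_right _ _ hn, Nat.div_eq_of_lt hu, Nat.zero_add,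
    Nat.add_mul_mod_self_right, Nat.mod_eq_of_lt hu]

namespace Decide

variable {B N : ℕ} {x : ℕ → ℕ} {s : Mem}

local notation "𝓘" => Data.ofArray x

/-- The memory holds the input `x` and the state `st`. -/
structure Holds (x : ℕ → ℕ) (st : State) (s : Mem) : Prop where
  input : s 0 = x
  M : s 2 0 = st.M
  N : s 3 = st.N
  H : s 4 = st.H
  G : s 5 = st.G
  el : s 6 = st.el
  fl : s 7 0 = st.fl

/-- The memory holds the first `m` entries of the tables that describe the strategy. -/
structure Tables (x : ℕ → ℕ) (m : ℕ) (s : Mem) : Prop where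
  H : s 16 = mix m ((Data.ofArray x).table State.H) 0
  radix : s 17 = mix m ((Data.ofArray x).table (Data.ofArray x).radix) 0
  lo : s 18 = mix m ((Data.ofArray x).table (Data.ofArray x).lo) 0
  hi : s 19 = mix m ((Data.ofArray x).table (Data.ofArray x).hi) 0
  M : s 20 = mix m ((Data.ofArray x).table fun st _ => st.M) 0

/-- The memory holds what is needed to update the entries of vertex `k`. -/
structure Context (x : ℕ → ℕ) (st : State) (k : ℕ) (s : Mem) : Prop where
  input : s 0 = x
  M : s 2 0 = st.M
  el : s 6 = st.el
  pivot : s 9 0 = (Data.ofArray x).pivot st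
  guess : s 10 0 = (Data.ofArray x).guess st
  failed : s 11 0 = (Data.ofArray x).failed st
  nextM : s 12 0 = (Data.ofArray x).nextM st
  counter : s 14 0 = k

variable {st : State} {k : ℕ}

theorem Context.set (h : Context x st k s) {A : ℕ} (hA : A ∉ [0, 2, 6, 9, 10, 11, 12, 14])
    (i v : ℕ) : Context x st k (s.set A i v) := by
  have key : ∀ A' ∈ [0, 2, 6, 9, 10, 11, 12, 14], s.set A i v A' = s A' := fun A' hA' =>
    Mem.set_of_ne _ _ _ (fun h => hA (h ▸ hA'))
  exact ⟨by rw [key 0 (by decide)]; exact h.input, by rw [key 2 (by decide)]; exact h.M,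
    by rw [key 6 (by decide)]; exact h.el, by rw [key 9 (by decide)]; exact h.pivot,
    by rw [key 10 (by decide)]; exact h.guess, by rw [key 11 (by decide)]; exact h.failed,
    by rw [key 12 (by decide)]; exact h.nextM, by rw [key 14 (by decide)]; exact h.counter⟩

theorem Context.eval_isPivotE (h : Context x st k s) : isPivotE.eval s = (𝓘).isPivot st k := by
  simp [isPivotE, Data.isPivot, h.counter, h.pivot]

theorem Context.eval_laterE (h : Context x st k s) : laterE.eval s = (𝓘).later st k := by
  simp [laterE, adjE, Data.later, h.counter, h.pivot, h.el, h.input]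
  simp [Data.ofArray]

theorem Context.eval_radixE (h : Context x st k s) : radixE.eval s = (𝓘).radix st k := by
  simp [radixE, Data.radix, h.eval_isPivotE, h.eval_laterE, h.M]

theorem Context.eval_loE (h : Context x st k s) : loE.eval s = (𝓘).lo st k := by
  simp [loE, Data.lo, h.eval_laterE, h.guess]

theorem Context.eval_hiE (h : Context x st k s) : hiE.eval s = (𝓘).hi st k := by
  simp [hiE, Data.hi, h.eval_isPivotE, h.guess, h.M]

theorem Context.eval_countE (h : Context x st k s) : countE.eval s = (𝓘).count st k := by
  simp [countE, Data.count, h.eval_isPivotE, h.eval_laterE, h.eval_loE, h.eval_hiE]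

theorem Context.eval_nextNE (h : Context x st k s) (ha : s 3 k = st.N k) :
    nextNE.eval s = (𝓘).nextN st k := by
  simp [nextNE, Data.nextN, h.eval_laterE, h.failed, h.nextM, h.M, h.counter, ha]

/-- The state of the memory while the entries of the vertices are updated. -/
structure Updating (x : ℕ → ℕ) (t k : ℕ) (s : Mem) : Prop where
  N : s 3 = mix k ((Data.ofArray x).nextN ((Data.ofArray x).state t)) ((Data.ofArray x).state t).N
  H : s 4 = mix k (fun u => ((Data.ofArray x).state t).H u *
    (Data.ofArray x).radix ((Data.ofArray x).state t) u) ((Data.ofArray x).state t).H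
  G : s 5 = mix k (fun u => ((Data.ofArray x).state t).G u *
    (Data.ofArray x).count ((Data.ofArray x).state t) u) ((Data.ofArray x).state t).G
  tables : Tables x (t * x 1 + k) s

theorem Tables.congr {m : ℕ} (h : Tables x m s) {s' : Mem}
    (h' : ∀ A ∈ [16, 17, 18, 19, 20], s' A = s A) : Tables x m s' :=
  ⟨by rw [h' 16 (by decide)]; exact h.H, by rw [h' 17 (by decide)]; exact h.radix,
    by rw [h' 18 (by decide)]; exact h.lo, by rw [h' 19 (by decide)]; exact h.hi,
    by rw [h' 20 (by decide)]; exact h.M⟩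

/-- The eight assignments are followed one at a time. None of them changes an array that occurs in
`Context`, so the expressions for radix, interval and count keep their values throughout. -/
theorem wp_updateCmd {t : ℕ} (hI : (𝓘).Valid) (hF : Fits 𝓘 B N) (ht : t < x 1) (hk : k < x 1)
    (hc : Context x ((𝓘).state t) k s) (ht' : s 13 0 = t) (hu : Updating x t k s) :
    Wp B N updateCmd (Updating x t (k + 1)) s := by
  have hn : (𝓘).n = x 1 := rfl
  have hb := Data.bounds_state hI t
  have hb' := Data.bounds_state hI (t + 1)
  have hD := Data.denProd_pos hI
  have hM : ((𝓘).state t).M < 2 ^ B := hb.M_le.trans_lt hF.den_lt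
  have hpow : ∀ t' ≤ x 1, (𝓘).denProd ^ t' < 2 ^ B := fun t' h =>
    (Nat.pow_le_pow_right hD h).trans_lt hF.pow_lt
  have hH := (hb'.H_le k hk).trans_lt (hpow _ ht)
  have hG := (hb'.G_le k hk).trans_lt (hpow _ ht)
  rw [Data.H_succ _ t hk] at hH
  rw [Data.G_succ _ t hk] at hG
  have hH0 := (hb.H_le k hk).trans_lt (hpow _ ht.le)
  have hN := ((Data.nextN_le hI hk).trans (hb.N_le k hk)).trans_lt (hF.num_lt k hk)
  have hrad : (𝓘).radix ((𝓘).state t) k < 2 ^ B := by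
    have h1 := hb.H_pos k hk
    refine lt_of_le_of_lt ?_ hH
    exact Nat.le_mul_of_pos_left _ h1
  have hlo := (Data.lo_le (s := (𝓘).state t) hI hk).trans_lt hM
  have hhi := (Data.hi_le (s := (𝓘).state t) hI hk).trans_lt hM
  have hidx : ∀ s' : Mem, s' 0 = x → s' 13 0 = t → s' 14 0 = k →
      indexE.eval s' = t * x 1 + k := by
    intro s' h1 h2 h3
    simp [indexE, h1, h2, h3]
  have e4 : s 4 k = ((𝓘).state t).H k := by rw [hu.H]; simp
  have e5 : s 5 k = ((𝓘).state t).G k := by rw [hu.G]; simp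
  have e3 : s 3 k = ((𝓘).state t).N k := by rw [hu.N]; simp
  have tab : ∀ f, (𝓘).table f (t * x 1 + k) = f ((𝓘).state t) k := fun f =>
    Data.table_apply _ f t hk
  generalize hj : t * x 1 + k = j at hidx tab
  have hut := hu.tables
  rw [hj] at hut
  rw [updateCmd]
  have v1 : (Expr.read 4 (cell 14)).eval s = ((𝓘).state t).H k := by simp [hc.counter, e4]
  rw [wp_seq, wp_write, hidx s hc.input ht' hc.counter, v1]
  refine ⟨hH0, ?_⟩
  generalize hs1 : s.set 16 j (((𝓘).state t).H k) = s1
  have c1 : Context x ((𝓘).state t) k s1 := hs1 ▸ hc.set (by decide) _ _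
  have f1 : ∀ A, A ≠ 16 → s1 A = s A := fun A hA => hs1 ▸ Mem.set_of_ne _ _ _ hA
  rw [wp_seq, wp_write, hidx s1 c1.input (by rw [f1 13 (by decide), ht']) c1.counter, c1.eval_radixE]
  refine ⟨hrad, ?_⟩
  generalize hs2 : s1.set 17 j ((𝓘).radix ((𝓘).state t) k) = s2
  have c2 : Context x ((𝓘).state t) k s2 := hs2 ▸ c1.set (by decide) _ _
  have f2 : ∀ A, A ≠ 17 → s2 A = s1 A := fun A hA => hs2 ▸ Mem.set_of_ne _ _ _ hA
  rw [wp_seq, wp_write, hidx s2 c2.input (by rw [f2 13 (by decide), f1 13 (by decide), ht']) c2.counter,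
    c2.eval_loE]
  refine ⟨hlo, ?_⟩
  generalize hs3 : s2.set 18 j ((𝓘).lo ((𝓘).state t) k) = s3
  have c3 : Context x ((𝓘).state t) k s3 := hs3 ▸ c2.set (by decide) _ _
  have f3 : ∀ A, A ≠ 18 → s3 A = s2 A := fun A hA => hs3 ▸ Mem.set_of_ne _ _ _ hA
  rw [wp_seq, wp_write, hidx s3 c3.input (by
    rw [f3 13 (by decide), f2 13 (by decide), f1 13 (by decide), ht']) c3.counter, c3.eval_hiE]
  refine ⟨hhi, ?_⟩
  generalize hs4 : s3.set 19 j ((𝓘).hi ((𝓘).state t) k) = s4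
  have c4 : Context x ((𝓘).state t) k s4 := hs4 ▸ c3.set (by decide) _ _
  have f4 : ∀ A, A ≠ 19 → s4 A = s3 A := fun A hA => hs4 ▸ Mem.set_of_ne _ _ _ hA
  rw [wp_seq, wp_write, hidx s4 c4.input (by
    rw [f4 13 (by decide), f3 13 (by decide), f2 13 (by decide), f1 13 (by decide), ht'])
    c4.counter, eval_cell, c4.M]
  refine ⟨hM, ?_⟩
  generalize hs5 : s4.set 20 j ((𝓘).state t).M = s5
  have c5 : Context x ((𝓘).state t) k s5 := hs5 ▸ c4.set (by decide) _ _
  have f5 : ∀ A, A ∉ [16, 17, 18, 19, 20] → s5 A = s A := by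
    intro A hA
    simp only [List.mem_cons, not_or] at hA
    rw [← hs5, Mem.set_of_ne _ _ _ hA.2.2.2.2.1, f4 A hA.2.2.2.1, f3 A hA.2.2.1, f2 A hA.2.1,
      f1 A hA.1]
  have v6 : (Expr.read 5 (cell 14) * countE).eval s5 =
      ((𝓘).state t).G k * (𝓘).count ((𝓘).state t) k := by
    simp [c5.counter, c5.eval_countE, f5, e5]
  rw [wp_seq, wp_write, v6, eval_cell, c5.counter]
  refine ⟨hG, ?_⟩
  generalize hs6 : s5.set 5 k (((𝓘).state t).G k * (𝓘).count ((𝓘).state t) k) = s6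
  have c6 : Context x ((𝓘).state t) k s6 := hs6 ▸ c5.set (by decide) _ _
  have f6 : ∀ A, A ≠ 5 → s6 A = s5 A := fun A hA => hs6 ▸ Mem.set_of_ne _ _ _ hA
  have v7 : (Expr.read 4 (cell 14) * radixE).eval s6 =
      ((𝓘).state t).H k * (𝓘).radix ((𝓘).state t) k := by
    simp [c6.counter, c6.eval_radixE, f6, f5, e4]
  rw [wp_seq, wp_write, v7, eval_cell, c6.counter]
  refine ⟨hH, ?_⟩
  generalize hs7 : s6.set 4 k (((𝓘).state t).H k * (𝓘).radix ((𝓘).state t) k) = s7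
  have c7 : Context x ((𝓘).state t) k s7 := hs7 ▸ c6.set (by decide) _ _
  have f7 : ∀ A, A ≠ 4 → s7 A = s6 A := fun A hA => hs7 ▸ Mem.set_of_ne _ _ _ hA
  have h73 : s7 3 = s 3 := by rw [f7 3 (by decide), f6 3 (by decide), f5 3 (by decide)]
  rw [wp_write, c7.eval_nextNE (by rw [h73, e3]), eval_cell, c7.counter]
  refine ⟨hN, ?_⟩
  generalize hs8 : s7.set 3 k ((𝓘).nextN ((𝓘).state t) k) = s8
  have f8 : ∀ A, A ≠ 3 → s8 A = s7 A := fun A hA => hs8 ▸ Mem.set_of_ne _ _ _ hA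
  have f85 : ∀ A, A ∉ [3, 4, 5] → s8 A = s5 A := by
    intro A hA
    simp only [List.mem_cons, not_or] at hA
    rw [f8 A hA.1, f7 A hA.2.1, f6 A hA.2.2.1]
  refine ⟨?_, ?_, ?_, ?_⟩
  · rw [← hs8, Mem.set_same, h73, hu.N]
    exact update_mix _ _ _ rfl
  · rw [f8 4 (by decide), ← hs7, Mem.set_same, f6 4 (by decide), f5 4 (by decide), hu.H]
    exact update_mix _ _ _ rfl
  · rw [f8 5 (by decide), f7 5 (by decide), ← hs6, Mem.set_same, f5 5 (by decide), hu.G]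
    exact update_mix _ _ _ rfl
  · rw [← Nat.add_assoc, hj]
    refine ⟨?_, ?_, ?_, ?_, ?_⟩
    · rw [f85 16 (by decide), ← hs5, Mem.set_of_ne _ _ _ (by decide), f4 16 (by decide),
        f3 16 (by decide), f2 16 (by decide), ← hs1, Mem.set_same, hut.H]
      exact update_mix _ _ _ (tab _).symm
    · rw [f85 17 (by decide), ← hs5, Mem.set_of_ne _ _ _ (by decide), f4 17 (by decide),
        f3 17 (by decide), ← hs2, Mem.set_same, f1 17 (by decide), hut.radix]
      exact update_mix _ _ _ (tab _).symm
    · rw [f85 18 (by decide), ← hs5, Mem.set_of_ne _ _ _ (by decide), f4 18 (by decide), ← hs3,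
        Mem.set_same, f2 18 (by decide), f1 18 (by decide), hut.lo]
      exact update_mix _ _ _ (tab _).symm
    · rw [f85 19 (by decide), ← hs5, Mem.set_of_ne _ _ _ (by decide), ← hs4, Mem.set_same,
        f3 19 (by decide), f2 19 (by decide), f1 19 (by decide), hut.hi]
      exact update_mix _ _ _ (tab _).symm
    · rw [f85 20 (by decide), ← hs5, Mem.set_same, f4 20 (by decide), f3 20 (by decide),
        f2 20 (by decide), f1 20 (by decide), hut.M]
      exact update_mix _ _ _ (tab fun st _ => st.M).symm

theorem wp_eliminateCmd {t : ℕ} (hI : (𝓘).Valid) (hF : Fits 𝓘 B N) (ht : t < x 1)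
    (hs : Holds x ((𝓘).state t) s) (ht' : s 13 0 = t) (hp : s 9 0 = (𝓘).pivot ((𝓘).state t))
    (htab : Tables x (t * x 1) s) :
    Wp B N eliminateCmd
      (fun s' => Holds x ((𝓘).state (t + 1)) s' ∧ Tables x ((t + 1) * x 1) s') s := by
  have hb := Data.bounds_state hI t
  have hb' := Data.bounds_state hI (t + 1)
  have hM : ((𝓘).state t).M < 2 ^ B := hb.M_le.trans_lt hF.den_lt
  rw [Data.state_succ] at hb' ⊢
  generalize hst : (𝓘).state t = st at *
  have hg : (𝓘).guess st < 2 ^ B := Data.guess_le.trans_lt hM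
  have hf : (𝓘).failed st < 2 ^ B := Data.failed_le.trans_lt (hF.lt (by omega))
  have hM' : (𝓘).nextM st < 2 ^ B := Data.nextM_le.trans_lt hM
  rw [eliminateCmd]
  have v1 : (Expr.read 3 (cell 9) - (.read 3 (cell 9) - cell 2)).eval s = (𝓘).guess st := by
    simp [Data.guess, hs.N, hs.M, hp]
  rw [wp_seq, wp_write, v1]
  refine ⟨hg, ?_⟩
  have v2 : (1 - (cell 2 - Expr.read 3 (cell 9))).eval
      (s.set 10 (Expr.eval s 0) ((𝓘).guess st)) = (𝓘).failed st := by
    simp [Data.failed, hs.N, hs.M, hp, Mem.set_apply]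
  rw [wp_seq, wp_write, v2]
  refine ⟨hf, ?_⟩
  rw [wp_seq, wp_write]
  set s3 := (s.set 10 (Expr.eval s 0) ((𝓘).guess st)).set 11
    (Expr.eval (s.set 10 (Expr.eval s 0) ((𝓘).guess st)) 0) ((𝓘).failed st) with hs3
  have v3 : (cell 2 - cell 10 + cell 11 * cell 2).eval s3 = (𝓘).nextM st := by
    simp [hs3, Data.nextM, hs.M, Mem.set_apply]
  rw [v3]
  refine ⟨hM', ?_⟩
  set s4 := s3.set 12 (Expr.eval s3 0) ((𝓘).nextM st) with hs4
  have f4 : ∀ A, A ∉ [10, 11, 12] → s4 A = s A := by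
    intro A hA
    simp only [List.mem_cons, not_or] at hA
    rw [hs4, Mem.set_of_ne _ _ _ hA.2.2.1, hs3, Mem.set_of_ne _ _ _ hA.2.1,
      Mem.set_of_ne _ _ _ hA.1]
  have g10 : s4 10 0 = (𝓘).guess st := by simp [hs4, hs3, Mem.set_apply]
  have g11 : s4 11 0 = (𝓘).failed st := by simp [hs4, hs3, Mem.set_apply]
  have g12 : s4 12 0 = (𝓘).nextM st := by simp [hs4]
  rw [wp_seq]
  refine wp_times_of (by decide) (fun k s' => Updating x t k s') (n := x 1)
    (by simp [f4, hs.input]) hF.le ?_ ?_ ?_ ?_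
  · intro k s s' h h'
    exact ⟨by rw [h 3 (by decide)]; exact h'.N, by rw [h 4 (by decide)]; exact h'.H,
      by rw [h 5 (by decide)]; exact h'.G, h'.tables.congr fun A hA => h A (by
        rintro rfl; revert hA; decide)⟩
  · refine ⟨?_, ?_, ?_, ?_⟩
    · rw [f4 3 (by decide), hs.N, mix_zero, hst]
    · rw [f4 4 (by decide), hs.H, mix_zero, hst]
    · rw [f4 5 (by decide), hs.G, mix_zero, hst]
    · refine htab.congr fun A hA => f4 A ?_
      intro h
      fin_cases hA <;> revert h <;> decide
  · intro k hk s' hfr hk' hu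
    refine wp_updateCmd hI hF ht hk ?_ (by rw [hfr 13 (by decide), f4 13 (by decide), ht']) hu
    rw [hst]
    exact ⟨by rw [hfr 0 (by decide), f4 0 (by decide), hs.input],
      by rw [hfr 2 (by decide), f4 2 (by decide), hs.M],
      by rw [hfr 6 (by decide), f4 6 (by decide), hs.el],
      by rw [hfr 9 (by decide), f4 9 (by decide), hp],
      by rw [hfr 10 (by decide), g10], by rw [hfr 11 (by decide), g11],
      by rw [hfr 12 (by decide), g12], hk'⟩
  · intro s5 hfr hu
    rw [wp_seq, wp_write, wp_seq, wp_write, wp_write]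
    have e12 : s5 12 0 = (𝓘).nextM st := by rw [hfr 12 (by decide), g12]
    have e9 : s5 9 0 = (𝓘).pivot st := by rw [hfr 9 (by decide), f4 9 (by decide), hp]
    have e7 : s5 7 0 = st.fl := by rw [hfr 7 (by decide), f4 7 (by decide), hs.fl]
    have e11 : s5 11 0 = (𝓘).failed st := by rw [hfr 11 (by decide), g11]
    have e6 : s5 6 = st.el := by rw [hfr 6 (by decide), f4 6 (by decide), hs.el]
    have e0 : s5 0 = x := by rw [hfr 0 (by decide), f4 0 (by decide), hs.input]
    have hfl : st.fl + (𝓘).failed st < 2 ^ B := by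
      have h1 : st.fl + (𝓘).failed st ≤ t + 1 := hb'.fl_le
      have h2 : (𝓘).n = x 1 := rfl
      exact hF.lt (by omega)
    refine ⟨by simp [e12, hM'], by simpa using hF.lt (k := 1) (by omega),
      by simpa [Mem.set_apply, e7, e11] using hfl, ?_⟩
    have hn : (𝓘).n = x 1 := rfl
    have hN := hu.N
    have hH := hu.H
    have hG := hu.G
    rw [hst, ← hn] at hN hH hG
    refine ⟨⟨?_, ?_, ?_, ?_, ?_, ?_, ?_⟩, ?_⟩
    · simp [Mem.set_apply, e0]
    · simp [Mem.set_apply, e12, Data.next]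
    · simp [Mem.set_apply, hN, Data.next]
    · simp [Mem.set_apply, hH, Data.next]
    · simp [Mem.set_apply, hG, Data.next]
    · simp [Mem.set_apply, e6, e9, Data.next]
    · simp [Mem.set_apply, e7, e11, Data.next]
    · have h1 : t * x 1 + x 1 = (t + 1) * x 1 := by ring
      rw [← h1]
      exact hu.tables.congr fun A hA => by fin_cases hA <;> simp [Mem.set_apply]

end Decide

end HatGame

/-! ### The decision program: initialization, output and total correctness. -/

namespace HatGame

open Cmd

/-- The entries of the description of the strategy. -/
def Data.entry (I : Data) (i : ℕ) : ℕ :=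
  if i % 5 = 0 then I.table State.H (i / 5)
  else if i % 5 = 1 then I.table I.radix (i / 5)
  else if i % 5 = 2 then I.table I.lo (i / 5)
  else if i % 5 = 3 then I.table I.hi (i / 5)
  else I.table (fun st _ => st.M) (i / 5)

/-- The description of the strategy. -/
def Data.description (I : Data) : List ℕ := (List.range (5 * (I.n * I.n))).map I.entry

namespace Decide

variable {B N : ℕ} {x : ℕ → ℕ} {s : Mem}

local notation "𝓘" => Data.ofArray x

theorem Fits.table_lt {I : Data} (hF : Fits I B N) (hI : I.Valid) {j : ℕ} (hj : j < I.n * I.n) :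
    I.table State.H j < 2 ^ B ∧ I.table I.radix j < 2 ^ B ∧ I.table I.lo j < 2 ^ B ∧
      I.table I.hi j < 2 ^ B ∧ I.table (fun st _ => st.M) j < 2 ^ B := by
  have ht : j / I.n < I.n := Nat.div_lt_of_lt_mul hj
  have hu : j % I.n < I.n := Nat.mod_lt _ (by
    rcases Nat.eq_zero_or_pos I.n with h | h
    · simp [h] at hj
    · exact h)
  have hb := Data.bounds_state hI (j / I.n)
  have hM := hb.M_le.trans_lt hF.den_lt
  have hD := Data.denProd_pos hI
  have h1 : 1 < 2 ^ B := hF.lt (by omega)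
  refine ⟨?_, ?_, (Data.lo_le hI hu).trans_lt hM, (Data.hi_le hI hu).trans_lt hM, hM⟩
  · exact ((hb.H_le _ hu).trans (Nat.pow_le_pow_right hD ht.le)).trans_lt hF.pow_lt
  · show I.radix (I.state (j / I.n)) (j % I.n) < 2 ^ B
    rcases Data.role_cases (s := I.state (j / I.n)) hI hu with h | h | h <;> omega

theorem Fits.entry_lt {I : Data} (hF : Fits I B N) (hI : I.Valid) {i : ℕ}
    (hi : i < 5 * (I.n * I.n)) : I.entry i < 2 ^ B := by
  obtain ⟨h1, h2, h3, h4, h5⟩ := hF.table_lt hI (j := i / 5) (by omega)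
  unfold Data.entry
  split_ifs <;> assumption

theorem Fits.colors_lt {I : Data} (hF : Fits I B N) (hI : I.Valid) {u : ℕ} (hu : u < I.n) :
    (I.state I.n).H u < 2 ^ B ∧ (I.state I.n).G u < 2 ^ B :=
  ⟨((Data.bounds_state hI I.n).H_le u hu).trans_lt hF.pow_lt,
    ((Data.bounds_state hI I.n).G_le u hu).trans_lt hF.pow_lt⟩

theorem wp_initCmd (hI : (𝓘).Valid) (hF : Fits 𝓘 B N) (h0 : s 0 = x) (hs : ∀ A ≠ 0, s A = 0) :
    Wp B N initCmd (fun s' => Holds x (𝓘).initState s' ∧ Tables x 0 s') s := by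
  have h1 : 1 < 2 ^ B := hF.lt (by omega)
  rw [initCmd, wp_seq, wp_write]
  refine ⟨by simpa using h1, ?_⟩
  rw [wp_seq]
  refine wp_times_of (by decide) (fun k s' => s' 2 0 = ∏ u ∈ Finset.range k, (𝓘).den u) (n := x 1)
    (by simp [Mem.set_apply, h0]) hF.le (fun k s s' h h' => by rw [h 2 (by decide)]; exact h')
    (by simp) ?_ ?_
  · intro k hk s' hfr hk' h2
    have h0' : s' 0 = x := by rw [hfr 0 (by decide)]; simp [Mem.set_apply, h0]
    have hval : (cell 2 * denE (cell 13)).eval s' = ∏ u ∈ Finset.range (k + 1), (𝓘).den u := by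
      rw [Finset.prod_range_succ, ← h2]
      simp [denE, Data.ofArray, h0', hk']
    rw [wp_write, hval]
    refine ⟨lt_of_le_of_lt ?_ hF.den_lt, by simp⟩
    refine Finset.prod_le_prod_of_subset_of_one_le' (Finset.range_mono hk) fun u hu _ => ?_
    exact hI.den_pos u (Finset.mem_range.1 hu)
  · intro s1 hfr h2
    have h2' : s1 2 0 = (𝓘).denProd := h2
    have g1 : ∀ A, A ∉ [2, 13] → s1 A = s A := by
      intro A hA
      simp only [List.mem_cons, not_or] at hA
      rw [hfr A (by simp [writes]; tauto), Mem.set_of_ne _ _ _ hA.1]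
    have h0' : s1 0 = x := by rw [g1 0 (by decide), h0]
    refine wp_times_of (by decide) (fun k s' =>
      s' 3 = mix k (fun u => (𝓘).num u * ((𝓘).denProd / (𝓘).den u)) 0 ∧
      s' 4 = mix k 1 0 ∧ s' 5 = mix k 1 0) (n := x 1)
      (by simp [h0']) hF.le (fun k s s' h h' => by
        rw [h 3 (by decide), h 4 (by decide), h 5 (by decide)]; exact h') ?_ ?_ ?_
    · simp only [mix_zero]
      exact ⟨by rw [g1 3 (by decide), hs 3 (by decide)], by rw [g1 4 (by decide), hs 4 (by decide)],
        by rw [g1 5 (by decide), hs 5 (by decide)]⟩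
    · rintro k hk s' hfr' hk' ⟨e3, e4, e5⟩
      have i0 : s' 0 = x := by rw [hfr' 0 (by decide), h0']
      have i2 : s' 2 0 = (𝓘).denProd := by rw [hfr' 2 (by decide), h2']
      have hval : (numE (cell 13) * (cell 2 / denE (cell 13))).eval s' =
          (𝓘).num k * ((𝓘).denProd / (𝓘).den k) := by
        simp only [numE, denE, Expr.eval_mul, Expr.eval_div, Expr.eval_read, Expr.eval_add,
          eval_cell, eval_nE, i0, i2, hk']
        rfl
      rw [wp_seq, wp_write, hval, wp_seq, wp_write, wp_write]
      refine ⟨?_, by simpa using h1, by simpa using h1, ?_, ?_, ?_⟩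
      · exact (Nat.mul_le_mul_left _ (Nat.div_le_self _ _)).trans_lt (hF.num_lt k hk)
      · simp only [eval_cell, hk', Mem.set_apply]
        simp only [e3, Nat.reduceEqDiff, if_false, if_true]
        exact update_mix _ _ _ rfl
      · simp [Mem.set_apply, hk', e4]
        exact update_mix _ _ _ rfl
      · simp [Mem.set_apply, hk', e5]
        exact update_mix _ _ _ rfl
    · rintro s' hfr' ⟨e3, e4, e5⟩
      have g2 : ∀ A, A ∉ [2, 3, 4, 5, 13] → s' A = s A := by
        intro A hA
        simp only [List.mem_cons, not_or] at hA
        rw [hfr' A (by simp [writes, HAndThen.hAndThen, AndThen.andThen]; tauto),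
          g1 A (by simp; tauto)]
      refine ⟨⟨?_, ?_, e3, e4, e5, ?_, ?_⟩, ⟨?_, ?_, ?_, ?_, ?_⟩⟩
      · rw [g2 0 (by decide), h0]
      · rw [hfr' 2 (by decide), h2']; rfl
      · rw [g2 6 (by decide), hs 6 (by decide)]; rfl
      · rw [g2 7 (by decide), hs 7 (by decide)]; rfl
      all_goals rw [g2 _ (by decide), hs _ (by decide), mix_zero]

theorem wp_steps (hI : (𝓘).Valid) (hF : Fits 𝓘 B N)
    (hs : Holds x (𝓘).initState s ∧ Tables x 0 s) :
    Wp B N (times 13 nE stepCmd)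
      (fun s' => Holds x ((𝓘).state (x 1)) s' ∧ Tables x (x 1 * x 1) s') s := by
  refine wp_times_of (by decide) (fun k s' => Holds x ((𝓘).state k) s' ∧ Tables x (k * x 1) s')
    (n := x 1) (by simp [hs.1.input]) hF.le ?_ (by simpa using hs) ?_ (fun s' _ h => h)
  · rintro k s s' h ⟨h1, h2⟩
    refine ⟨⟨by rw [h 0 (by decide)]; exact h1.input, by rw [h 2 (by decide)]; exact h1.M,
      by rw [h 3 (by decide)]; exact h1.N, by rw [h 4 (by decide)]; exact h1.H,
      by rw [h 5 (by decide)]; exact h1.G, by rw [h 6 (by decide)]; exact h1.el,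
      by rw [h 7 (by decide)]; exact h1.fl⟩, h2.congr fun A hA => h A ?_⟩
    rintro rfl
    revert hA
    decide
  · rintro k hk s' hfr hk' ⟨h1, h2⟩
    rw [stepCmd, wp_seq]
    refine (wp_pivotCmd hI hF h1.input h1.el).mono fun s2 hfr2 hp => ?_
    refine wp_eliminateCmd hI hF hk ?_ (by rw [hfr2 13 (by decide), hk']) hp ?_
    · exact ⟨by rw [hfr2 0 (by decide)]; exact h1.input, by rw [hfr2 2 (by decide)]; exact h1.M,
        by rw [hfr2 3 (by decide)]; exact h1.N, by rw [hfr2 4 (by decide)]; exact h1.H,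
        by rw [hfr2 5 (by decide)]; exact h1.G, by rw [hfr2 6 (by decide)]; exact h1.el,
        by rw [hfr2 7 (by decide)]; exact h1.fl⟩
    · refine h2.congr fun A hA => hfr2 A ?_
      fin_cases hA <;> decide

theorem wp_copyCmd {st : State} {m : ℕ} (hI : (𝓘).Valid) (hF : Fits 𝓘 B N)
    (hst : st = (𝓘).state (x 1)) (h1 : s 1 0 = m ∧ s 1 1 = 0)
    (hs : Holds x st s) (ht : Tables x (x 1 * x 1) s) :
    Wp B N copyCmd (fun s' => s' 1 0 = m ∧ s' 1 1 = 0 ∧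
      (∀ u < x 1, s' 1 (2 + u) = st.H u ∧ s' 1 (2 + x 1 + u) = st.G u) ∧
      ∀ i < 5 * (x 1 * x 1), s' 1 (2 + 2 * x 1 + i) = (𝓘).entry i) s := by
  have hn : (𝓘).n = x 1 := rfl
  rw [copyCmd, wp_seq]
  refine wp_times_of (by decide) (fun k s' => s' 1 0 = m ∧ s' 1 1 = 0 ∧
      ∀ u < k, s' 1 (2 + u) = st.H u ∧ s' 1 (2 + x 1 + u) = st.G u) (n := x 1)
    (by simp [hs.input]) hF.le (fun k s s' h h' => by rw [h 1 (by decide)]; exact h')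
    ⟨h1.1, h1.2, by simp⟩ ?_ ?_
  · rintro k hk s' hfr hk' ⟨e0, e1, e2⟩
    have i0 : s' 0 = x := by rw [hfr 0 (by decide), hs.input]
    have i4 : s' 4 = st.H := by rw [hfr 4 (by decide), hs.H]
    have i5 : s' 5 = st.G := by rw [hfr 5 (by decide), hs.G]
    have hlt := hF.colors_lt hI hk
    rw [hn, ← hst] at hlt
    rw [wp_seq, wp_write, wp_write]
    refine ⟨by simpa [hk', i4] using hlt.1, by simpa [Mem.set_apply, hk', i5] using hlt.2, ?_⟩
    simp only [Mem.set_apply, Expr.eval_add, Expr.eval_read, Expr.eval_ofNat, eval_cell, eval_nE,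
      OfNat.ofNat_ne_one, zero_ne_one, if_true, if_false,
      i0, i4, i5, hk', Function.update_apply]
    refine ⟨?_, ?_, fun u hu => ?_⟩
    · rw [if_neg (by omega), if_neg (by omega)]; exact e0
    · rw [if_neg (by omega), if_neg (by omega)]; exact e1
    · rw [if_neg (by omega)]
      by_cases h : u = k
      · subst h; simp
      · rw [if_neg (by omega), if_neg (by omega), if_neg (by omega)]
        exact e2 u (by omega)
  · rintro s1 hfr ⟨e0, e1, e2⟩
    have i0 : s1 0 = x := by rw [hfr 0 (by decide), hs.input]
    refine wp_times_of (by decide) (fun k s' => s' 1 0 = m ∧ s' 1 1 = 0 ∧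
      (∀ u < x 1, s' 1 (2 + u) = st.H u ∧ s' 1 (2 + x 1 + u) = st.G u) ∧
      ∀ i < 5 * k, s' 1 (2 + 2 * x 1 + i) = (𝓘).entry i) (n := x 1 * x 1)
      (by simp [i0]) hF.sq_le (fun k s s' h h' => by rw [h 1 (by decide)]; exact h')
      ⟨e0, e1, e2, by simp⟩ ?_ (fun _ _ h => h)
    rintro k hk s' hfr' hk' ⟨e0, e1, e2, e3⟩
    obtain ⟨l0, l1, l2, l3, l4⟩ := hF.table_lt hI (j := k) hk
    have i0' : s' 0 = x := by rw [hfr' 0 (by decide), i0]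
    have i16 : s' 16 k = (𝓘).table State.H k := by
      rw [hfr' 16 (by decide), hfr 16 (by decide), ht.H, mix_of_lt hk]
    have i17 : s' 17 k = (𝓘).table (𝓘).radix k := by
      rw [hfr' 17 (by decide), hfr 17 (by decide), ht.radix, mix_of_lt hk]
    have i18 : s' 18 k = (𝓘).table (𝓘).lo k := by
      rw [hfr' 18 (by decide), hfr 18 (by decide), ht.lo, mix_of_lt hk]
    have i19 : s' 19 k = (𝓘).table (𝓘).hi k := by
      rw [hfr' 19 (by decide), hfr 19 (by decide), ht.hi, mix_of_lt hk]
    have i20 : s' 20 k = (𝓘).table (fun st _ => st.M) k := by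
      rw [hfr' 20 (by decide), hfr 20 (by decide), ht.M, mix_of_lt hk]
    rw [wp_seq, wp_write, wp_seq, wp_write, wp_seq, wp_write, wp_seq, wp_write, wp_write]
    refine ⟨by simpa [hk', i16] using l0, by simpa [Mem.set_apply, hk', i17] using l1,
      by simpa [Mem.set_apply, hk', i18] using l2, by simpa [Mem.set_apply, hk', i19] using l3,
      by simpa [Mem.set_apply, hk', i20] using l4, ?_⟩
    simp only [Mem.set_apply, Expr.eval_add, Expr.eval_mul, Expr.eval_read, Expr.eval_ofNat,
      eval_cell, eval_nE, Nat.reduceEqDiff, OfNat.ofNat_ne_one, zero_ne_one,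
      if_true, if_false, i0', i16, i17, i18, i19, i20, hk', Function.update_apply]
    -- Cells in front of the current block of five are not changed in this round.
    have hout : ∀ j, j < 2 + 2 * x 1 + 5 * k →
        (if j = 2 + 2 * x 1 + 5 * k + 4 then (𝓘).table (fun st _ => st.M) k
        else if j = 2 + 2 * x 1 + 5 * k + 3 then (𝓘).table (𝓘).hi k
        else if j = 2 + 2 * x 1 + 5 * k + 2 then (𝓘).table (𝓘).lo k
        else if j = 2 + 2 * x 1 + 5 * k + 1 then (𝓘).table (𝓘).radix k
        else if j = 2 + 2 * x 1 + 5 * k then (𝓘).table State.H k else s' 1 j) = s' 1 j := by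
      intro j hj
      rw [if_neg (by omega), if_neg (by omega), if_neg (by omega), if_neg (by omega),
        if_neg (by omega)]
    refine ⟨?_, ?_, fun u hu => ⟨?_, ?_⟩, fun i hi => ?_⟩
    · rw [if_neg (by omega)]; exact e0
    · rw [if_neg (by omega), if_neg (by omega)]; exact e1
    · rw [hout _ (by omega)]; exact (e2 u hu).1
    · rw [hout _ (by omega)]; exact (e2 u hu).2
    · by_cases h : i < 5 * k
      · rw [hout _ (by omega)]; exact e3 i h
      · have hk5 : i / 5 = k := by omega
        have hi5 : i = 5 * k + i % 5 := by omega
        have hr : i % 5 < 5 := Nat.mod_lt _ (by norm_num)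
        unfold Data.entry
        rw [hk5]
        generalize i % 5 = d at hi5 hr
        subst hi5
        interval_cases d <;> simp [← Nat.add_assoc]

theorem output_eq {st : State} {n m : ℕ} {e : ℕ → ℕ} (h0 : s 1 0 = 1 + 2 * n + m) (h1 : s 1 1 = 0)
    (h2 : ∀ u < n, s 1 (2 + u) = st.H u ∧ s 1 (2 + n + u) = st.G u)
    (h3 : ∀ i < m, s 1 (2 + 2 * n + i) = e i) :
    output s = 0 :: (List.ofFn (fun u : Fin n => st.H u) ++ List.ofFn (fun u : Fin n => st.G u) ++
      (List.range m).map e) := by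
  unfold output
  rw [h0]
  refine List.ext_getElem (by simp; omega) fun i hi hi' => ?_
  simp only [List.length_map, List.length_range] at hi
  rw [List.getElem_map, List.getElem_range]
  rcases i with _ | i
  · simpa using h1
  · rw [List.getElem_cons_succ]
    by_cases c1 : i < n
    · rw [List.getElem_append_left (by simp; omega), List.getElem_append_left (by simpa using c1)]
      rw [List.getElem_ofFn, ← (h2 i c1).1]
      congr 1; omega
    · by_cases c2 : i < 2 * n
      · rw [List.getElem_append_left (by simp; omega), List.getElem_append_right (by simp; omega)]
        rw [List.getElem_ofFn]
        simp only [List.length_ofFn]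
        rw [← (h2 (i - n) (by omega)).2]
        congr 1; omega
      · rw [List.getElem_append_right (by simp; omega)]
        simp only [List.length_append, List.length_ofFn, List.getElem_map, List.getElem_range]
        rw [← h3 (i - (n + n)) (by omega)]
        congr 1; omega

theorem wp_decideCmd (hI : (𝓘).Valid) (hF : Fits 𝓘 B N) (h0 : s 0 = x) (hs : ∀ A ≠ 0, s A = 0) :
    Wp B N decideCmd (fun s' => output s' =
      if ((𝓘).state (x 1)).fl = 0 then [1]
      else 0 :: (List.ofFn (fun u : Fin (x 1) => ((𝓘).state (x 1)).H u) ++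
        List.ofFn (fun u : Fin (x 1) => ((𝓘).state (x 1)).G u) ++ (𝓘).description)) s := by
  have hn : (𝓘).n = x 1 := rfl
  have h1 : 1 < 2 ^ B := hF.lt (by omega)
  rw [decideCmd, wp_seq]
  refine (wp_initCmd hI hF h0 hs).mono fun s1 _ hs1 => ?_
  rw [wp_seq]
  refine (wp_steps hI hF hs1).mono fun s2 _ hs2 => ?_
  obtain ⟨hs2, ht2⟩ := hs2
  rw [outputCmd, wp_cond, eval_cell, hs2.fl]
  split_ifs with hfl
  · rw [wp_seq, wp_write, wp_write]
    refine ⟨by simpa using h1, by simpa using h1, ?_⟩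
    simp [output]
  · rw [wp_seq, wp_write]
    have hlen : (1 + 2 * nE + 5 * (nE * nE)).eval s2 = 1 + 2 * x 1 + 5 * (x 1 * x 1) := by
      simp [hs2.input]
    rw [hlen]
    refine ⟨?_, ?_⟩
    · have := hF.cube_lt
      rw [hn] at this
      omega
    rw [wp_seq, wp_write]
    refine ⟨by simp, ?_⟩
    refine (wp_copyCmd (st := (𝓘).state (x 1)) (m := 1 + 2 * x 1 + 5 * (x 1 * x 1)) hI hF rfl
      ?_ ?_ ?_).mono ?_
    · simp
    · exact ⟨by simp [Mem.set_apply, hs2.input], by simp [Mem.set_apply, hs2.M],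
        by simp [Mem.set_apply, hs2.N], by simp [Mem.set_apply, hs2.H],
        by simp [Mem.set_apply, hs2.G], by simp [Mem.set_apply, hs2.el],
        by simp [Mem.set_apply, hs2.fl]⟩
    · exact ht2.congr fun A hA => by fin_cases hA <;> simp [Mem.set_apply]
    · rintro s' _ ⟨e0, e1, e2, e3⟩
      exact output_eq e0 e1 e2 e3

end Decide

end HatGame

namespace HatGame

open Cmd

/-! ### The evaluation program -/

namespace Data

variable (I : Data) (j : ℕ)

theorem entry_mul : I.entry (5 * j) = I.table State.H j := by
  have h1 : 5 * j % 5 = 0 := by omega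
  have h2 : 5 * j / 5 = j := by omega
  simp [entry, h2]

theorem entry_mul_add_one : I.entry (5 * j + 1) = I.table I.radix j := by
  have h1 : (5 * j + 1) % 5 = 1 := by omega
  have h2 : (5 * j + 1) / 5 = j := by omega
  simp [entry, h1, h2]

theorem entry_mul_add_two : I.entry (5 * j + 2) = I.table I.lo j := by
  have h1 : (5 * j + 2) % 5 = 2 := by omega
  have h2 : (5 * j + 2) / 5 = j := by omega
  simp [entry, h1, h2]

theorem entry_mul_add_three : I.entry (5 * j + 3) = I.table I.hi j := by
  have h1 : (5 * j + 3) % 5 = 3 := by omega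
  have h2 : (5 * j + 3) / 5 = j := by omega
  simp [entry, h1, h2]

theorem entry_mul_add_four : I.entry (5 * j + 4) = I.table (fun st _ => st.M) j := by
  have h1 : (5 * j + 4) % 5 = 4 := by omega
  have h2 : (5 * j + 4) / 5 = j := by omega
  simp [entry, h1, h2]

end Data

namespace Evaluate

open Decide

/-! The arrays: `0` input, `1` output, `2` the answer, `3` the sum of digits, `13` and `14` loop
counters. -/

/-- Entry `5 * (t * n + u) + d` of the description. -/
def entryE (t u : Expr) (d : ℕ) : Expr := .read 0 (4 + nE + (5 * (t * nE + u) + .const d))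

def vertexE : Expr := .read 0 2

def sumCmd : Cmd :=
  .write 3 0 0 >>
  .times 14 nE (.write 3 0 (cell 3 +
    .read 0 (4 + cell 14) / entryE (cell 13) (cell 14) 0 % entryE (cell 13) (cell 14) 1))

def residueE : Expr := cell 3 % entryE (cell 13) vertexE 4

/-- By truncation `1 - (lo - residue)` and `1 - (1 - (hi - residue))` are the 0/1 values of `lo ≤
residue` and `residue < hi`. -/
def testCmd : Cmd :=
  sumCmd >>
  .write 2 0 (cell 2 * (1 - (entryE (cell 13) vertexE 2 - residueE)) *
    (1 - (1 - (entryE (cell 13) vertexE 3 - residueE))))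

/-- The query has `0` in place of the color of `v`; writing the candidate color there completes the
list to the arrangement that `Guesses` refers to. -/
def evaluateCmd : Cmd :=
  .write 0 (4 + vertexE) (.read 0 3) >>
  .write 2 0 1 >>
  .times 13 nE testCmd >>
  .write 1 0 1 >>
  .write 1 1 (cell 2)

theorem wellFormed_evaluateCmd : evaluateCmd.WellFormed := by
  simp only [evaluateCmd, testCmd, sumCmd, WellFormed, AndThen.andThen, HAndThen.hAndThen,
    Cmd.writes]
  decide

variable {B N : ℕ} {s : Mem} {I : Data} {v : ℕ} {c : ℕ → ℕ}

/-- The array `y` holds the description of the strategy, the vertex `v` and the colors `c`. -/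
structure Query (I : Data) (v : ℕ) (c y : ℕ → ℕ) : Prop where
  n_eq : y 1 = I.n
  vertex : y 2 = v
  color : ∀ u < I.n, y (4 + u) = c u
  entry : ∀ i < 5 * (I.n * I.n), y (4 + I.n + i) = I.entry i

theorem Query.eval_entryE {y : ℕ → ℕ} (h : Query I v c y) (h0 : s 0 = y) {t u : Expr} {d : ℕ}
    (hd : d < 5) (ht : t.eval s < I.n) (hu : u.eval s < I.n) :
    (entryE t u d).eval s = I.entry (5 * (t.eval s * I.n + u.eval s) + d) := by
  have h1 : t.eval s * I.n + u.eval s < I.n * I.n := by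
    calc t.eval s * I.n + u.eval s < t.eval s * I.n + I.n := by omega
      _ = (t.eval s + 1) * I.n := by ring
      _ ≤ I.n * I.n := Nat.mul_le_mul_right _ ht
  rw [← h.entry _ (by omega)]
  simp [entryE, h0, h.n_eq]

/-- Every digit is at most its color, so bounds on the partial sums of the colors guarantee that no
value overflows. -/
theorem wp_sumCmd {y : ℕ → ℕ} (hq : Query I v c y) (hN : I.n ≤ N)
    (hB : ∀ k ≤ I.n, ∑ u ∈ Finset.range k, c u < 2 ^ B) (h0 : s 0 = y) {t : ℕ} (ht : t < I.n)
    (h13 : s 13 0 = t) :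
    Wp B N sumCmd (fun s' => s' 3 0 = ∑ u ∈ Finset.range I.n, I.digit t u (c u)) s := by
  rw [sumCmd, wp_seq, wp_write]
  refine ⟨by simp, ?_⟩
  refine wp_times_of (by decide)
    (fun k s' => s' 3 0 = ∑ u ∈ Finset.range k, I.digit t u (c u)) (n := I.n)
    (by simp [Mem.set_apply, h0, hq.n_eq]) hN
    (fun k s s' h h' => by rw [h 3 (by decide)]; exact h') (by simp) ?_ (fun s' _ h => h)
  intro k hk s' hfr hk' h3
  have h0' : s' 0 = y := by rw [hfr 0 (by decide)]; simp [Mem.set_apply, h0]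
  have h13' : s' 13 0 = t := by rw [hfr 13 (by decide)]; simp [Mem.set_apply, h13]
  have hval : (cell 3 + Expr.read 0 (4 + cell 14) / entryE (cell 13) (cell 14) 0 %
      entryE (cell 13) (cell 14) 1).eval s' = ∑ u ∈ Finset.range (k + 1), I.digit t u (c u) := by
    rw [Finset.sum_range_succ, ← h3]
    simp only [Expr.eval_add, Expr.eval_mod, Expr.eval_div, Expr.eval_read, eval_cell]
    rw [hq.eval_entryE h0' (by norm_num) (by simpa [h13'] using ht) (by simpa [hk'] using hk),
      hq.eval_entryE h0' (by norm_num) (by simpa [h13'] using ht) (by simpa [hk'] using hk)]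
    simp only [eval_cell, h13', hk', add_zero, Data.entry_mul, Data.entry_mul_add_one,
      Data.table_apply _ _ _ hk, h0', Expr.eval_ofNat, hq.color k hk, Data.digit]
  rw [wp_write, hval]
  refine ⟨lt_of_le_of_lt ?_ (hB (k + 1) hk), by simp⟩
  exact Finset.sum_le_sum fun u _ => (Nat.mod_le _ _).trans (Nat.div_le_self _ _)

theorem wp_testCmd {y : ℕ → ℕ} (hq : Query I v c y) (hv : v < I.n) (hN : I.n ≤ N)
    (hB1 : 1 < 2 ^ B) (hB : ∀ k ≤ I.n, ∑ u ∈ Finset.range k, c u < 2 ^ B) (h0 : s 0 = y) {t : ℕ}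
    (ht : t < I.n) (h13 : s 13 0 = t) {P : Prop} [Decidable P]
    (h2 : s 2 0 = if P then 1 else 0) :
    Wp B N testCmd (fun s' => s' 2 0 = if P ∧ I.lo (I.state t) v ≤ I.digitSum t c ∧
      I.digitSum t c < I.hi (I.state t) v then 1 else 0) s := by
  rw [testCmd, wp_seq]
  refine (wp_sumCmd hq hN hB h0 ht h13).mono fun s' hfr h3 => ?_
  have h0' : s' 0 = y := by rw [hfr 0 (by decide), h0]
  have h13' : s' 13 0 = t := by rw [hfr 13 (by decide), h13]
  have h2' : s' 2 0 = if P then 1 else 0 := by rw [hfr 2 (by decide), h2]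
  have hvE : vertexE.eval s' = v := by simp [vertexE, h0', hq.vertex]
  have he : ∀ d < 5, (entryE (cell 13) vertexE d).eval s' = I.entry (5 * (t * I.n + v) + d) := by
    intro d hd
    rw [hq.eval_entryE h0' hd (by simpa [h13'] using ht) (by rw [hvE]; exact hv), hvE, eval_cell,
      h13']
  have hres : residueE.eval s' = I.digitSum t c := by
    rw [residueE, Expr.eval_mod, he 4 (by norm_num), eval_cell, h3, Data.entry_mul_add_four,
      Data.table_apply _ _ _ hv, Data.digitSum]
  have hval : (cell 2 * (1 - (entryE (cell 13) vertexE 2 - residueE)) *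
      (1 - (1 - (entryE (cell 13) vertexE 3 - residueE)))).eval s' =
      if P ∧ I.lo (I.state t) v ≤ I.digitSum t c ∧ I.digitSum t c < I.hi (I.state t) v
        then 1 else 0 := by
    simp only [Expr.eval_mul, Expr.eval_sub, Expr.eval_ofNat, eval_cell, hres,
      he 2 (by norm_num), he 3 (by norm_num), Data.entry_mul_add_two, Data.entry_mul_add_three,
      Data.table_apply _ _ _ hv, h2']
    by_cases hP : P
    · by_cases ha : I.lo (I.state t) v ≤ I.digitSum t c
      · by_cases hb : I.digitSum t c < I.hi (I.state t) v
        · have h4 : 1 - (I.hi (I.state t) v - I.digitSum t c) = 0 := by omega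
          simp [hP, ha, hb, h4, Nat.sub_eq_zero_of_le ha]
        · simp [hP, hb, Nat.sub_eq_zero_of_le (not_lt.1 hb)]
      · have h4 : 1 - (I.lo (I.state t) v - I.digitSum t c) = 0 := by omega
        simp [ha, h4]
    · simp [hP]
  rw [wp_write, hval]
  refine ⟨?_, by simp⟩
  split_ifs <;> omega

open Classical in
theorem wp_evaluateCmd {a : ℕ} (hq : Query I v c (Function.update (s 0) (4 + v) a))
    (h2 : s 0 2 = v) (h3 : s 0 3 = a) (hv : v < I.n) (hN : I.n ≤ N) (hB1 : 1 < 2 ^ B)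
    (ha : a < 2 ^ B) (hB : ∀ k ≤ I.n, ∑ u ∈ Finset.range k, c u < 2 ^ B) :
    Wp B N evaluateCmd (fun s' => output s' = [if I.Guesses v c then 1 else 0]) s := by
  rw [evaluateCmd, wp_seq, wp_write]
  have e1 : (4 + vertexE).eval s = 4 + v := by simp [vertexE, h2]
  have e2 : (Expr.read 0 3).eval s = a := by simp [h3]
  rw [e1, e2]
  refine ⟨ha, ?_⟩
  rw [wp_seq, wp_write]
  refine ⟨by simpa using hB1, ?_⟩
  rw [wp_seq]
  refine wp_times_of (by decide) (fun k s' => s' 2 0 = if ∀ t < k,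
    I.lo (I.state t) v ≤ I.digitSum t c ∧ I.digitSum t c < I.hi (I.state t) v then 1 else 0)
    (n := I.n) (by simpa [Mem.set_apply] using hq.n_eq) hN
    (fun k s s' h h' => by rw [h 2 (by decide)]; exact h') (by simp) ?_ ?_
  · intro k hk s' hfr hk' h
    have h0 : s' 0 = Function.update (s 0) (4 + v) a := by
      rw [hfr 0 (by decide)]; simp [Mem.set_apply]
    refine (wp_testCmd hq hv hN hB1 hB h0 hk hk' h).mono fun s2 _ hs2 => ?_
    rw [hs2]
    simp only [Nat.forall_lt_succ_right]
  · intro s' _ h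
    rw [wp_seq, wp_write, wp_write]
    refine ⟨by simpa using hB1, ?_, ?_⟩
    · simp only [eval_cell, Mem.set_apply]
      simp only [OfNat.ofNat_ne_one, if_false, h]
      split_ifs <;> omega
    · have hg : s' 2 0 = if I.Guesses v c then 1 else 0 := by
        rw [h]
        by_cases hg : I.Guesses v c
        · rw [if_pos hg]
          exact if_pos hg
        · rw [if_neg hg]
          exact if_neg hg
      simp [output, Mem.set_apply, hg]

end Evaluate

end HatGame

namespace HatGame

open Cmd

/-! ### Bit lengths -/

theorem length_le_bitSize (x : List ℕ) : x.length ≤ bitSize x := by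
  induction x with
  | nil => simp
  | cons k x ih => simp only [bitSize, List.map_cons, List.sum_cons, List.length_cons] at ih ⊢; omega

theorem lt_two_pow_bitSize {x : List ℕ} {k : ℕ} (hk : k ∈ x) : k < 2 ^ bitSize x := by
  have h1 : k.size + 1 ≤ bitSize x :=
    List.single_le_sum (by simp) _ (List.mem_map_of_mem (f := fun k : ℕ => k.size + 1) hk)
  exact (Nat.lt_size_self k).trans_le (Nat.pow_le_pow_right (by norm_num) (by omega))

theorem bitSize_le {x : List ℕ} {B : ℕ} (h : ∀ k ∈ x, k < 2 ^ B) :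
    bitSize x ≤ x.length * (B + 1) := by
  have := List.sum_le_card_nsmul (x.map fun k => k.size + 1) (B + 1) (by
    simp only [List.mem_map, forall_exists_index, and_imp, forall_apply_eq_imp_iff₂]
    exact fun k hk => Nat.succ_le_succ (Nat.size_le.2 (h k hk)))
  simpa [bitSize] using this

theorem initMem_bounded {x : List ℕ} {B : ℕ} (hB : bitSize x ≤ B) : (initMem x).Bounded B := by
  intro A i
  have hp : 2 ^ bitSize x ≤ 2 ^ B := Nat.pow_le_pow_right (by norm_num) hB
  unfold initMem
  split_ifs
  · rw [List.getD_eq_getElem?_getD]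
    by_cases hi : i < (x.length :: x).length
    · rw [List.getElem?_eq_getElem hi, Option.getD_some]
      rcases List.mem_cons.1 (List.getElem_mem hi) with h | h
      · rw [h]
        exact ((length_le_bitSize x).trans_lt Nat.lt_two_pow_self).trans_le hp
      · exact (lt_two_pow_bitSize h).trans_le hp
    · rw [List.getElem?_eq_none (by omega)]
      simp
  · positivity

theorem outputsWithin_of_wp {p : Cmd} (hp : p.WellFormed) {B N : ℕ} (hN : N < 2 ^ B)
    {x y : List ℕ} (hx : bitSize x ≤ B)
    (h : Wp B N p (fun s => output s = y) (initMem x)) {T : ℕ}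
    (hT : p.timeBound.eval N * (B + 1) ^ 2 ≤ T) : OutputsWithin p.compile x T y := by
  obtain ⟨-, t, ht, hle⟩ := runs_compile hN hp (initMem_bounded hx) h.1
  exact ⟨t, _, ht, hle.trans hT, h.2⟩

theorem getD_ofFn {n : ℕ} (f : Fin n → ℕ) {i : ℕ} (hi : i < n) :
    (List.ofFn f).getD i 0 = f ⟨i, hi⟩ := by
  rw [List.getD_eq_getElem _ _ (by simpa using hi)]
  simp

/-! ### The input -/

section Input

variable {n : ℕ} (G : SimpleGraph (Fin n)) (r : Fin n → ℚ≥0)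

/-- The data that the decision program reads. -/
noncomputable def inputData : Data where
  -- The size is not read from the list, so that `Fin (inputData G r).n` is `Fin n` by definition.
  n := n
  adj := (Data.ofArray (initMem (encodeInput G r) 0)).adj
  num := (Data.ofArray (initMem (encodeInput G r) 0)).num
  den := (Data.ofArray (initMem (encodeInput G r) 0)).den

theorem initMem_succ (x : List ℕ) (i : ℕ) : initMem x 0 (i + 1) = x.getD i 0 := by
  simp [initMem]

theorem initMem_encodeInput_one : initMem (encodeInput G r) 0 1 = n := by
  rw [initMem_succ (encodeInput G r) 0]
  simp [encodeInput]

theorem ofArray_encodeInput :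
    Data.ofArray (initMem (encodeInput G r) 0) = inputData G r := by
  simp only [inputData, Data.ofArray, initMem_encodeInput_one]

open Classical in
-- The matrix as one list over `Fin (n * n)`: the entry of `u` and `v` sits at index `u * n + v`,
-- where the program looks it up.
theorem encodeInput_eq : encodeInput G r = n :: (List.ofFn (fun k : Fin (n * n) =>
      if G.Adj k.divNat k.modNat then 1 else 0) ++
    (List.ofFn (fun v => (r v).num) ++ List.ofFn (fun v => (r v).den))) := by
  rw [List.ofFn_mul]
  simp only [encodeInput, List.cons_append, List.append_assoc]
  congr 2
  rw [List.flatMap_def, List.ofFn_eq_map]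
  congr 2
  ext u : 1
  congr 1
  ext v : 1
  have h1 : (⟨(u : ℕ) * n + v, by
      calc (u : ℕ) * n + v < (u : ℕ) * n + n := by omega
        _ = ((u : ℕ) + 1) * n := by ring
        _ ≤ n * n := Nat.mul_le_mul_right _ u.2⟩ : Fin (n * n)).divNat = u := by
    apply Fin.ext
    simp only [Fin.coe_divNat]
    rw [Nat.add_comm, Nat.add_mul_div_right _ _ (by have := u.2; omega), Nat.div_eq_of_lt v.2,
      Nat.zero_add]
  have h2 : (⟨(u : ℕ) * n + v, by
      calc (u : ℕ) * n + v < (u : ℕ) * n + n := by omega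
        _ = ((u : ℕ) + 1) * n := by ring
        _ ≤ n * n := Nat.mul_le_mul_right _ u.2⟩ : Fin (n * n)).modNat = v := by
    apply Fin.ext
    simp only [Fin.coe_modNat]
    rw [Nat.add_comm, Nat.add_mul_mod_self_right, Nat.mod_eq_of_lt v.2]
  rw [h1, h2]

theorem length_encodeInput : (encodeInput G r).length = 1 + n * n + 2 * n := by
  rw [encodeInput_eq]
  simp
  ring

theorem le_bitSize_encodeInput : n ≤ bitSize (encodeInput G r) := by
  have h1 := length_le_bitSize (encodeInput G r)
  rw [length_encodeInput] at h1
  omega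

theorem inputData_describes : (inputData G r).Describes G r := by
  classical
  have hx : ∀ k, initMem (encodeInput G r) 0 (2 + k) = (List.ofFn (fun k : Fin (n * n) =>
      if G.Adj k.divNat k.modNat then 1 else 0) ++
      (List.ofFn (fun v => (r v).num) ++ List.ofFn (fun v => (r v).den))).getD k 0 := by
    intro k
    rw [show 2 + k = (k + 1) + 1 by omega, initMem_succ, encodeInput_eq, List.getD_cons_succ]
  have hadj : ∀ u v : Fin n, (inputData G r).adj u v = if G.Adj u v then 1 else 0 := by
    intro u v
    have hlt : (u : ℕ) * n + v < n * n := by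
      calc (u : ℕ) * n + v < (u : ℕ) * n + n := by omega
        _ = ((u : ℕ) + 1) * n := by ring
        _ ≤ n * n := Nat.mul_le_mul_right _ u.2
    have h1 : (⟨(u : ℕ) * n + v, hlt⟩ : Fin (n * n)).divNat = u := by
      apply Fin.ext
      simp only [Fin.coe_divNat]
      rw [Nat.add_comm, Nat.add_mul_div_right _ _ (by have := u.2; omega), Nat.div_eq_of_lt v.2,
        Nat.zero_add]
    have h2 : (⟨(u : ℕ) * n + v, hlt⟩ : Fin (n * n)).modNat = v := by
      apply Fin.ext
      simp only [Fin.coe_modNat]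
      rw [Nat.add_comm, Nat.add_mul_mod_self_right, Nat.mod_eq_of_lt v.2]
    simp only [inputData, Data.ofArray, initMem_encodeInput_one]
    rw [Nat.add_assoc, hx, List.getD_append _ _ _ _ (by simpa using hlt), getD_ofFn _ hlt, h1, h2]
  have hnum : ∀ u : Fin n, (inputData G r).num u = (r u).num := by
    intro u
    simp only [inputData, Data.ofArray, initMem_encodeInput_one]
    rw [Nat.add_assoc, hx, List.getD_append_right _ _ _ _ (by simp),
      List.getD_append _ _ _ _ (by simp)]
    simp only [List.length_ofFn, Nat.add_sub_cancel_left]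
    rw [getD_ofFn _ u.2]
  have hden : ∀ u : Fin n, (inputData G r).den u = (r u).den := by
    intro u
    simp only [inputData, Data.ofArray, initMem_encodeInput_one]
    rw [Nat.add_assoc, Nat.add_assoc, hx, List.getD_append_right _ _ _ _ (by simp),
      List.getD_append_right _ _ _ _ (by simp)]
    simp only [List.length_ofFn, Nat.add_sub_cancel_left]
    rw [getD_ofFn _ u.2]
  exact ⟨fun u v => (hadj u v).trans (by congr), hnum, hden⟩

/-- The word length that suffices for the decision program. -/
def wordLength (L : ℕ) : ℕ := L ^ 3 + L ^ 2 + 3 * L + 4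

/-- The denominators are at most `2 ^ L` and there are `n ≤ L` of them, so `denProd ≤ 2 ^ (L ^ 2)`
and `denProd ^ n ≤ 2 ^ (L ^ 3)`. The remaining terms of `wordLength` cover the numerators and the
cubic bound. -/
theorem inputData_fits :
    Decide.Fits (inputData G r) (wordLength (bitSize (encodeInput G r)))
      (bitSize (encodeInput G r) ^ 2) := by
  have hn := le_bitSize_encodeInput G r
  have hd := inputData_describes G r
  have hb := initMem_bounded (le_refl (bitSize (encodeInput G r)))
  set L := bitSize (encodeInput G r) with hL
  have hI : (inputData G r).n = n := rfl
  have hden : ∀ u, (inputData G r).den u ≤ 2 ^ L := fun u => (hb 0 _).le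
  have hnum : ∀ u, (inputData G r).num u ≤ 2 ^ L := fun u => (hb 0 _).le
  have hD : (inputData G r).denProd ≤ 2 ^ (L ^ 2) := by
    calc (inputData G r).denProd ≤ ∏ _u ∈ Finset.range n, 2 ^ L :=
          Finset.prod_le_prod' fun u _ => hden u
      _ = 2 ^ (L * n) := by rw [Finset.prod_const, Finset.card_range, pow_mul]
      _ ≤ 2 ^ (L ^ 2) := Nat.pow_le_pow_right (by norm_num) (by rw [sq]; gcongr)
  have hlt : ∀ a, a < wordLength L → 2 ^ a < 2 ^ wordLength L := fun a ha =>
    Nat.pow_lt_pow_right (by norm_num) ha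
  refine ⟨?_, ?_, ?_, fun u _ => ?_, ?_⟩
  · rw [hI, sq]; gcongr
  · rw [hI]
    have h1 : n + 1 ≤ 2 ^ L := Nat.succ_le_of_lt (hn.trans_lt Nat.lt_two_pow_self)
    calc n * n * n + 5 * (n * n) + 2 * n + 2 < 2 ^ 3 * ((n + 1) * (n + 1) * (n + 1)) := by
          nlinarith [sq_nonneg n]
      _ ≤ 2 ^ 3 * (2 ^ L * 2 ^ L * 2 ^ L) := by gcongr
      _ = 2 ^ (3 * L + 3) := by rw [← pow_add, ← pow_add, ← pow_add]; congr 1; ring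
      _ ≤ 2 ^ wordLength L := (hlt _ (by unfold wordLength; omega)).le
  · exact hD.trans_lt (hlt _ (by unfold wordLength; omega))
  · calc (inputData G r).num u * (inputData G r).denProd ≤ 2 ^ L * 2 ^ (L ^ 2) :=
          Nat.mul_le_mul (hnum u) hD
      _ = 2 ^ (L + L ^ 2) := by rw [pow_add]
      _ < 2 ^ wordLength L := hlt _ (by unfold wordLength; omega)
  · calc (inputData G r).denProd ^ n ≤ (2 ^ (L ^ 2)) ^ n := Nat.pow_le_pow_left hD n
      _ = 2 ^ (L ^ 2 * n) := by rw [pow_mul]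
      _ ≤ 2 ^ (L ^ 3) := Nat.pow_le_pow_right (by norm_num) (by rw [pow_succ L 2]; gcongr)
      _ < 2 ^ wordLength L := hlt _ (by unfold wordLength; omega)

theorem sq_lt_two_pow_wordLength (L : ℕ) : L ^ 2 < 2 ^ wordLength L :=
  (Nat.lt_two_pow_self (n := L ^ 2)).trans_le
    (Nat.pow_le_pow_right (by norm_num) (by unfold wordLength; omega))

/-- The output of the decision program. -/
theorem decide_outputsWithin {T : ℕ}
    (hT : Decide.decideCmd.timeBound.eval (bitSize (encodeInput G r) ^ 2) *
      (wordLength (bitSize (encodeInput G r)) + 1) ^ 2 ≤ T) :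
    OutputsWithin Decide.decideCmd.compile (encodeInput G r) T
      (if ((inputData G r).state n).fl = 0 then [1]
      else 0 :: (List.ofFn (fun u : Fin n => ((inputData G r).state n).H u) ++
        List.ofFn (fun u : Fin n => ((inputData G r).state n).G u) ++
        (inputData G r).description)) := by
  have h := Decide.wp_decideCmd (x := initMem (encodeInput G r) 0) (s := initMem (encodeInput G r))
    (B := wordLength (bitSize (encodeInput G r))) (N := bitSize (encodeInput G r) ^ 2)
    (by rw [ofArray_encodeInput]; exact (inputData_describes G r).valid)
    (by rw [ofArray_encodeInput]; exact inputData_fits G r) rfl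
    (fun A hA => by ext i; simp [initMem, hA])
  rw [ofArray_encodeInput, initMem_encodeInput_one] at h
  exact outputsWithin_of_wp Decide.wellFormed_decideCmd (sq_lt_two_pow_wordLength _)
    (by unfold wordLength; omega) h hT

theorem bitSize_description_le :
    bitSize (List.ofFn (fun u : Fin n => ((inputData G r).state n).H u) ++
      List.ofFn (fun u : Fin n => ((inputData G r).state n).G u) ++ (inputData G r).description) ≤
    (2 * bitSize (encodeInput G r) + 5 * bitSize (encodeInput G r) ^ 2) *
      (wordLength (bitSize (encodeInput G r)) + 1) := by
  have hF := inputData_fits G r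
  have hI := (inputData_describes G r).valid
  have hn := le_bitSize_encodeInput G r
  have hnI : (inputData G r).n = n := rfl
  refine (bitSize_le (B := wordLength (bitSize (encodeInput G r))) ?_).trans
    (Nat.mul_le_mul_right _ ?_)
  · intro k hk
    simp only [List.mem_append, List.mem_ofFn, Data.description, List.mem_map,
      List.mem_range] at hk
    rcases hk with (⟨u, rfl⟩ | ⟨u, rfl⟩) | ⟨i, hi, rfl⟩
    · exact (hF.colors_lt hI u.2).1
    · exact (hF.colors_lt hI u.2).2
    · exact hF.entry_lt hI hi
  · simp only [List.length_append, List.length_ofFn, Data.description, List.length_map,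
      List.length_range, hnI]
    nlinarith

end Input

/-! ### Queries -/

theorem evaluate_outputsWithin {I : Data} {G : SimpleGraph (Fin I.n)} {h : Fin I.n → ℕ}
    (v : Fin I.n) (c : View G h v) (a : Fin (h v)) [Decidable (I.Guesses v (Data.viewColors v c a))]
    {T : ℕ} (hT : Evaluate.evaluateCmd.timeBound.eval
        (bitSize (encodeQuery I.description v c a)) *
      (2 * bitSize (encodeQuery I.description v c a) + 2) ^ 2 ≤ T) :
    OutputsWithin Evaluate.evaluateCmd.compile (encodeQuery I.description v c a) T
      [if I.Guesses v (Data.viewColors v c a) then 1 else 0] := by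
  classical
  set q := encodeQuery I.description v c a with hq
  set colors : List ℕ := List.ofFn (fun u => if hu : G.Adj v u then (c ⟨u, hu⟩ : ℕ) else 0)
    with hcolors
  have hqe : q = I.n :: (v : ℕ) :: (a : ℕ) :: (colors ++ I.description) := by
    simp only [hq, encodeQuery, hcolors, List.cons_append]
  set L := bitSize q with hL
  have hlen := length_le_bitSize q
  have hn : I.n ≤ L := by
    refine le_trans ?_ hlen
    rw [hqe]
    simp only [List.length_cons, List.length_append, hcolors, List.length_ofFn]
    omega
  have hL1 : 1 < 2 ^ (2 * L + 1) := Nat.one_lt_two_pow (by omega)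
  have hpow : 2 ^ L ≤ 2 ^ (2 * L + 1) := Nat.pow_le_pow_right (by norm_num) (by omega)
  have e1 : initMem q 0 1 = I.n := by rw [initMem_succ q 0, hqe]; rfl
  have e2 : initMem q 0 2 = v := by rw [initMem_succ q 1, hqe]; rfl
  have e3 : initMem q 0 3 = a := by rw [initMem_succ q 2, hqe]; rfl
  have e4 : ∀ k, initMem q 0 (4 + k) = (colors ++ I.description).getD k 0 := by
    intro k
    rw [show 4 + k = (k + 3) + 1 by omega, initMem_succ, hqe]
    rfl
  have ec : ∀ u, u < I.n → u ≠ v → initMem q 0 (4 + u) = Data.viewColors v c a u := by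
    intro u hu huv
    rw [e4, List.getD_append _ _ _ _ (by simpa [hcolors] using hu), hcolors, getD_ofFn _ hu]
    simp [Data.viewColors, huv, hu]
  have ha : (a : ℕ) < 2 ^ L := lt_two_pow_bitSize (by rw [hqe]; simp)
  have hview : ∀ u < I.n, Data.viewColors v c a u ≤ 2 ^ L := by
    intro u hu
    by_cases huv : u = v
    · simpa [Data.viewColors, huv] using ha.le
    · rw [← ec u hu huv]
      exact (initMem_bounded le_rfl 0 _).le
  -- Words of `2 * L + 1` bits suffice: at most `L` colors are added, each at most `2 ^ L`.
  have hw := Evaluate.wp_evaluateCmd (B := 2 * L + 1) (N := L) (I := I) (v := v) (a := a)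
    (c := Data.viewColors v c a) (s := initMem q) ?_ e2 e3 v.2 hn hL1 (ha.trans_le hpow) ?_
  · refine outputsWithin_of_wp Evaluate.wellFormed_evaluateCmd
      ((Nat.lt_two_pow_self (n := L)).trans_le hpow) (by omega) (hw.mono fun s' _ hs' => ?_) hT
    rw [hs']
    congr!
  · refine ⟨?_, ?_, fun u hu => ?_, fun i hi => ?_⟩
    · rw [Function.update_of_ne (by omega), e1]
    · rw [Function.update_of_ne (by omega), e2]
    · by_cases huv : u = v
      · subst huv
        simp [Data.viewColors]
      · rw [Function.update_of_ne (by omega), ec u hu huv]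
    · rw [Function.update_of_ne (by have := v.2; omega), Nat.add_assoc, e4,
        List.getD_append_right _ _ _ _ (by simp [hcolors])]
      simp only [hcolors, List.length_ofFn, Nat.add_sub_cancel_left, Data.description]
      rw [List.getD_eq_getElem _ _ (by simpa using hi)]
      simp
  · intro k hk
    calc ∑ u ∈ Finset.range k, Data.viewColors v c a u ≤ ∑ _u ∈ Finset.range k, 2 ^ L :=
          Finset.sum_le_sum fun u hu => hview u (by have := Finset.mem_range.1 hu; omega)
      _ = k * 2 ^ L := by simp
      _ ≤ 2 ^ L * 2 ^ L :=
          Nat.mul_le_mul_right _ ((hk.trans hn).trans Nat.lt_two_pow_self.le)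
      _ = 2 ^ (2 * L) := by rw [← pow_add]; congr 1; ring
      _ < 2 ^ (2 * L + 1) := Nat.pow_lt_pow_right (by norm_num) (by omega)

/-! ### The output as a represented strategy with the required ratios. -/

theorem Data.mem_strategy {I : Data} (hI : I.Valid) {G : SimpleGraph (Fin I.n)} (v : Fin I.n)
    (c : View G (fun v => (I.state I.n).H v) v) (a : Fin ((I.state I.n).H v)) :
    a ∈ (strategy hI G v c).1 ↔ I.Guesses v (viewColors v c a) := by
  simp [strategy]

theorem represents_strategy {I : Data} (hI : I.Valid) (G : SimpleGraph (Fin I.n)) :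
    Represents Evaluate.evaluateCmd.compile
      (Evaluate.evaluateCmd.timeBound * (2 * Polynomial.X + 2) ^ 2) I.description
      (Data.strategy hI G) := by
  classical
  intro v c a
  have h := evaluate_outputsWithin v c a
    (T := (Evaluate.evaluateCmd.timeBound * (2 * Polynomial.X + 2) ^ 2).eval
      (bitSize (encodeQuery I.description v c a))) (by simp)
  convert h using 3
  exact Data.mem_strategy hI v c a

theorem Data.ratio_le {I : Data} {G : SimpleGraph (Fin I.n)} {r : Fin I.n → ℚ≥0}
    (h : I.Describes G r) (hG : IsChordal G) (v : Fin I.n) :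
    ((I.state I.n).G v : ℚ≥0) / ((I.state I.n).H v : ℚ≥0) ≤ r v := by
  have hb := (Data.bounds_state h.valid I.n).H_pos v v.2
  have hd := h.valid.den_pos v v.2
  have hempty : I.remaining (I.state I.n) = ∅ := by
    rw [← Finset.card_eq_zero, Data.card_remaining_state h hG le_rfl, Nat.sub_self]
  have hel : (I.state I.n).el v ≠ 0 := fun h0 => by
    have : v ∈ I.remaining (I.state I.n) := Data.mem_remaining.2 h0
    simp [hempty] at this
  have h1 := (Data.ratio_state h hG le_rfl v.2).2 hel
  have h2 : r v = (I.num v : ℚ≥0) / (I.den v : ℚ≥0) := by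
    rw [h.num_eq, h.den_eq, NNRat.num_div_den]
  rw [h2, div_le_div_iff₀ (by exact_mod_cast hb) (by exact_mod_cast hd)]
  exact_mod_cast h1

end HatGame

open HatGame

/-- One program `alg` decides `r ∈ 𝓡(G)` (first entry of the output) and, if `r ∉ 𝓡(G)`, also
outputs `h`, `g` and a description `σ` of a winning strategy for `(G, h, g)`; it runs in time
`p`, its output has length at most `p'`, and descriptions are evaluated by one program `ev` in
time `q`. -/
theorem corollary3 :
    ∃ (alg ev : HatGame.Prog) (p p' q : Polynomial ℕ),
      ∀ (n : ℕ) (G : SimpleGraph (Fin n)) (r : Fin n → ℚ≥0), HatGame.IsChordal G →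
        ((fun v => (r v : ℝ)) ∈ HatGame.region G →
          HatGame.OutputsWithin alg (HatGame.encodeInput G r)
            (p.eval (HatGame.bitSize (HatGame.encodeInput G r))) [1]) ∧
        ((fun v => (r v : ℝ)) ∉ HatGame.region G →
          ∃ (h g : Fin n → ℕ) (σ : List ℕ),
            HatGame.OutputsWithin alg (HatGame.encodeInput G r)
              (p.eval (HatGame.bitSize (HatGame.encodeInput G r)))
              (0 :: (List.ofFn h ++ List.ofFn g ++ σ)) ∧
            HatGame.bitSize (List.ofFn h ++ List.ofFn g ++ σ) ≤
              p'.eval (HatGame.bitSize (HatGame.encodeInput G r)) ∧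
            (∀ v, 0 < h v ∧ (g v : ℚ≥0) / (h v : ℚ≥0) ≤ r v) ∧
            ∃ Γ : HatGame.Strategy G h g, Γ.IsWinning ∧ HatGame.Represents ev q σ Γ) := by
  classical
  -- `W` is `wordLength` as a polynomial. Below, `timeBound` is composed with the square because a
  -- loop of the decision program makes at most `n * n ≤ L ^ 2` rounds, for inputs of bit length
  -- `L`.
  let W : Polynomial ℕ := Polynomial.X ^ 3 + Polynomial.X ^ 2 + 3 * Polynomial.X + 4
  have hW : ∀ L, W.eval L = wordLength L := fun L => by simp [W, wordLength]
  refine ⟨Decide.decideCmd.compile, Evaluate.evaluateCmd.compile,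
    Decide.decideCmd.timeBound.comp (Polynomial.X ^ 2) * (W + 1) ^ 2,
    (2 * Polynomial.X + 5 * Polynomial.X ^ 2) * (W + 1),
    Evaluate.evaluateCmd.timeBound * (2 * Polynomial.X + 2) ^ 2, fun n G r hG => ?_⟩
  have hd := inputData_describes G r
  have hout := decide_outputsWithin G r (T := _) le_rfl
  have hfl := Data.fl_eq_zero_iff hd hG
  simp only [Polynomial.eval_mul, Polynomial.eval_comp, Polynomial.eval_pow, Polynomial.eval_X,
    Polynomial.eval_add, Polynomial.eval_one, Polynomial.eval_ofNat, hW]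
  refine ⟨fun hr => ?_, fun hr => ?_⟩
  · have h0 : ((inputData G r).state n).fl = 0 := hfl.2 hr
    rwa [if_pos h0] at hout
  · have h0 : ((inputData G r).state n).fl ≠ 0 := fun h0 => hr (hfl.1 h0)
    rw [if_neg h0] at hout
    refine ⟨fun v => ((inputData G r).state n).H v, fun v => ((inputData G r).state n).G v,
      (inputData G r).description, hout, bitSize_description_le G r,
      fun v => ⟨(Data.bounds_state hd.valid n).H_pos v v.2, Data.ratio_le hd hG v⟩,
      Data.strategy hd.valid G, Data.strategy_isWinning hd hG h0, represents_strategy hd.valid G⟩
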